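/- Let $n\ge 4$, $\mu\in(0,2)$ and $\gamma>1$. There is a constant $C>0$, depending only on $n,\mu,\gamma$, such that the following holds for all $0\le t_0<T<\infty$. Let $\phi\in C([t_0,T];H^1_{\mathrm{loc}}(\mathbb R^n))\cap C^1([t_0,T];L^2_{\mathrm{loc}}(\mathbb R^n))$ be a real-valued solution, in the sense of distributions, of the Cauchy problem $$\partial_t^2\phi-\Delta\phi+\frac{\mu}{t}\,\partial_t\phi=F\quad\text{in }(t_0,T)\times\mathbb R^n,\qquad \phi(t_0,\cdot)=0,\quad \partial_t\phi(t_0,\cdot)=0,$$ where $F\in L^1_{\mathrm{loc}}((t_0,T)\times\mathbb R^n)$ is real-valued. Write $r=|x|$, $u=t-|x|$, $\underline u=t+|x|$. Then $$\sup_{t_0<t\le T}t^{\frac{\mu}{2}}\Big(\big\|(1+|u|)^{\frac12}\nabla_{t,x}\phi(t,\cdot)\big\|_{L^2(\mathbb R^n)}+\Big\|(1+|u|)^{\frac12}\frac{\phi(t,\cdot)}{r}\Big\|_{L^2(\mathbb R^n)}+\Big\|(1+|u|)^{\frac12}\frac{\phi(t,\cdot)}{t}\Big\|_{L^2(\mathbb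 R^n)}\Big)\le C\,\Big\|(1+|u|)^{\frac{\gamma}{2}}(1+|\underline u|)^{\frac{\gamma}{2}}\,t^{\frac{\mu}{2}}F\Big\|_{L^2([t_0,T]\times\mathbb R^n)},$$ where both sides are read in $[0,\infty]$; in particular, the left side is finite whenever the right side is. -/

import Mathlib

open MeasureTheory Set Filter Topology
open scoped ContDiff ENNReal

/-- `g` is the weak (distributional) gradient of `f` on `ℝⁿ`. -/
structure HasWeakGradient {n : ℕ} (f : EuclideanSpace ℝ (Fin n) → ℝ)
    (g : EuclideanSpace ℝ (Fin n) → EuclideanSpace ℝ (Fin n)) : Prop where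
  locallyIntegrable : LocallyIntegrable f
  locallyIntegrable_grad : LocallyIntegrable g
  integral_eq : ∀ ζ : EuclideanSpace ℝ (Fin n) → ℝ, ContDiff ℝ ∞ ζ → HasCompactSupport ζ →
    ∀ v : EuclideanSpace ℝ (Fin n),
      ∫ x, f x * fderiv ℝ ζ x v = -∫ x, inner ℝ (g x) v * ζ x

/-- `w ∈ C(I; L²_loc(ℝⁿ; V))`: every slice is square integrable on every ball, and the slices
depend continuously on `t ∈ I` in the `L²` norm of every ball. -/
structure ContinuousOnL2Loc {n : ℕ} {V : Type*} [NormedAddCommGroup V] (I : Set ℝ)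
    (w : ℝ → EuclideanSpace ℝ (Fin n) → V) : Prop where
  memLp : ∀ t ∈ I, ∀ R : ℝ, MemLp (w t) 2 (volume.restrict (Metric.ball 0 R))
  tendsto : ∀ s ∈ I, ∀ R : ℝ,
    Tendsto (fun t => eLpNorm (w t - w s) 2 (volume.restrict (Metric.ball 0 R)))
      (𝓝[I] s) (𝓝 0)

/-- On the time interval `I`, the map `t ↦ w t` is differentiable as a map into `L²_loc(ℝⁿ)`
(one-sided at end points of `I`), with derivative `w'`. -/
def HasTimeDerivL2Loc {n : ℕ} (I : Set ℝ) (w w' : ℝ → EuclideanSpace ℝ (Fin n) → ℝ) : Prop :=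
  ∀ s ∈ I, ∀ R : ℝ,
    Tendsto
      (fun t => eLpNorm ((t - s)⁻¹ • (w t - w s) - w' s) 2 (volume.restrict (Metric.ball 0 R)))
      (𝓝[I \ {s}] s) (𝓝 0)

/-- `φ`, with time derivative `φt` and spatial gradient `φx`, is a (weak, locally finite energy)
solution of
`∂ₜ²φ - Δφ + (μ / t) ∂ₜφ = F` on `(t₀, T) × ℝⁿ`, `φ(t₀, ·) = 0`, `∂ₜφ(t₀, ·) = 0`:
it belongs to `C([t₀, T]; H¹_loc) ∩ C¹([t₀, T]; L²_loc)`, it satisfies the equation in the sense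
of distributions, and it attains the zero Cauchy data. -/
structure IsDampedWaveSolution {n : ℕ} (μ t₀ T : ℝ) (F φ φt : ℝ → EuclideanSpace ℝ (Fin n) → ℝ)
    (φx : ℝ → EuclideanSpace ℝ (Fin n) → EuclideanSpace ℝ (Fin n)) : Prop where
  locallyIntegrableOn_source : LocallyIntegrableOn
    (fun z : ℝ × EuclideanSpace ℝ (Fin n) => F z.1 z.2) (Ioo t₀ T ×ˢ univ)
  continuousOn : ContinuousOnL2Loc (Icc t₀ T) φ
  continuousOn_grad : ContinuousOnL2Loc (Icc t₀ T) φx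
  continuousOn_timeDeriv : ContinuousOnL2Loc (Icc t₀ T) φt
  hasWeakGradient : ∀ t ∈ Icc t₀ T, HasWeakGradient (φ t) (φx t)
  hasTimeDeriv : HasTimeDerivL2Loc (Icc t₀ T) φ φt
  equation : ∀ η : ℝ × EuclideanSpace ℝ (Fin n) → ℝ, ContDiff ℝ ∞ η → HasCompactSupport η →
    tsupport η ⊆ Ioo t₀ T ×ˢ univ →
      ∫ t in t₀..T, ∫ x,
        (-(φt t x * deriv (fun s => η (s, x)) t) + fderiv ℝ (fun y => η (t, y)) x (φx t x)
          + μ / t * φt t x * η (t, x))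
      = ∫ z : ℝ × EuclideanSpace ℝ (Fin n), F z.1 z.2 * η z
  initial : φ t₀ =ᵐ[volume] 0
  initial_timeDeriv : φt t₀ =ᵐ[volume] 0

/-! The substitution `ψ = t ^ (μ / 2) φ` removes the damping: `∂ₜ²ψ - Δψ + α ψ / t² = t ^ (μ / 2) F`
with `α = μ (2 - μ) / 4`, which is positive exactly because `0 < μ < 2`. Write `r = |x|`, `u = t -
r`, `w = t + r`, `m = (n - 1) / 2` and `D = (∂ᵣ + m / r) ψ = r ^ (-m) ∂ᵣ (r ^ m ψ)`. The equation is
multiplied by `a (∂ₜψ - D) / 2 + h (∂ₜψ + D) / 2`, where `a = ⟨u⟩ p(w) χ(w)` and `h = ⟨w⟩ p(u)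
χ(w)`. Here `p` is a ghost weight, bounded above and below with `p' = -⟨s⟩ ^ (-γ)`; it exists
because `γ > 1`. The factor `χ` is a decreasing cutoff that makes everything compactly supported.

The resulting energy is a sum of squares (`energyDensity_eq`). It contains the Hardy term `m (m - 1)
ψ² / r²`, coercive since `n ≥ 4` gives `m > 1`, and the potential term `α ψ² / t²`. Its time
derivative is a spatial divergence plus a bulk term (`energyRate_eq`). In the bulk the angular,
Hardy and potential terms have a good sign, by `sq_div_bracket_bound` and `div_bracket_bound`. The
squares of `∂ₜψ ± D` appear with the negative factor `p'` and absorb the source (`bulk_le`); the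
price is `⟨u⟩⟨w⟩ ^ γ + ⟨w⟩⟨u⟩ ^ γ`, which is dominated by the weight on `F`.

The multiplier is singular on the axis `r = 0`. Cutting out a ball of radius of order `δ` costs the
cutoff derivative `δ ^ (-2)` times a flux `δ ^ (-1)` (`abs_flux_le`) times a volume `δ ^ n`, which
tends to `0` as `n ≥ 4` (`exists_integral_waveEnergy_le`). Fatou's lemma then removes the axis
cutoff and `χ` (`lintegral_coerciveForm_le`).

A weak solution is reduced to this situation by mollifying in space only. The mollified time
derivative is then absolutely continuous in time (`absolutelyContinuous_of_weakDeriv`), which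
suffices for the fundamental theorem of calculus at fixed `x` (`regularWave_mollify`). The weight of
the source varies by a bounded factor on unit balls, so mollification preserves the right-hand side
up to a constant (`lintegral_sourceDensity_mollify_le`). A last use of Fatou's lemma returns to the
solution itself (`lintegral_normDensity_le`). -/

namespace DampedWave

/-! ### Brackets, the ghost weight, and the two scalar inequalities behind the sign of the bulk. -/

/-- The smooth weight `⟨s⟩ = √(1 + s²)`. -/
noncomputable def bracket (s : ℝ) : ℝ := √(1 + s ^ 2)

lemma one_le_bracket (s : ℝ) : 1 ≤ bracket s := by
  rw [bracket, Real.one_le_sqrt]; nlinarith [sq_nonneg s]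

lemma bracket_pos (s : ℝ) : 0 < bracket s := one_pos.trans_le (one_le_bracket s)

lemma sq_bracket (s : ℝ) : bracket s ^ 2 = 1 + s ^ 2 := Real.sq_sqrt (by positivity)

lemma bracket_le (s : ℝ) : bracket s ≤ 1 + |s| := by
  apply le_of_sq_le_sq _ (by positivity)
  rw [sq_bracket]; nlinarith [sq_abs s, abs_nonneg s]

lemma le_bracket (s : ℝ) : 1 + |s| ≤ 2 * bracket s := by
  apply le_of_sq_le_sq _ (by have := bracket_pos s; positivity)
  rw [mul_pow, sq_bracket]; nlinarith [sq_abs s, sq_nonneg (|s| - 1)]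

lemma contDiff_bracket {k : WithTop ℕ∞} : ContDiff ℝ k bracket := by
  unfold bracket
  exact ContDiff.sqrt (by fun_prop) fun s => by positivity

lemma hasDerivAt_bracket (s : ℝ) : HasDerivAt bracket (s / bracket s) s := by
  have h : HasDerivAt (fun s : ℝ => 1 + s ^ 2) (2 * s) s := by
    simpa using (hasDerivAt_pow 2 s).const_add 1
  refine (h.sqrt (by positivity)).congr_deriv ?_
  exact mul_div_mul_left s (bracket s) two_ne_zero

lemma bracket_le_bracket {s s' : ℝ} (h : |s| ≤ |s'|) : bracket s ≤ bracket s' :=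
  Real.sqrt_le_sqrt (by gcongr 1 + ?_; exact sq_le_sq.2 h)

/-- A bounded, strictly positive weight whose derivative is `-⟨s⟩ ^ (-γ)`. -/
lemma exists_ghost_weight {γ : ℝ} (hγ : 1 < γ) : ∃ (M : ℝ) (p : ℝ → ℝ), (∀ s, 1 ≤ p s) ∧
    (∀ s, p s ≤ M) ∧ ∀ s, HasDerivAt p (-(bracket s) ^ (-γ)) s := by
  have hq : Continuous fun s => bracket s ^ (-γ) :=
    (contDiff_bracket (k := 0)).continuous.rpow_const fun s => Or.inl (bracket_pos s).ne'
  have hq0 : ∀ s, 0 ≤ bracket s ^ (-γ) := fun s => Real.rpow_nonneg (bracket_pos s).le _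
  have hint : Integrable fun s => bracket s ^ (-γ) := by
    have := integrable_rpow_neg_one_add_norm_sq (E := ℝ) (μ := volume) (r := γ) (by simpa using hγ)
    refine this.congr (Eventually.of_forall fun s => ?_)
    simp only [bracket, Real.norm_eq_abs, sq_abs, Real.sqrt_eq_rpow]
    rw [← Real.rpow_mul (by positivity)]
    ring_nf
  set I := ∫ s, bracket s ^ (-γ)
  have hI : ∀ s, |∫ y in (0 : ℝ)..s, bracket y ^ (-γ)| ≤ I := fun s => by
    refine (intervalIntegral.norm_integral_le_integral_norm_uIoc (f := fun y => bracket y ^ (-γ))).trans ?_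
    simp only [Real.norm_eq_abs, abs_of_nonneg (hq0 _)]
    exact setIntegral_le_integral hint (Eventually.of_forall hq0)
  refine ⟨1 + 2 * I, fun s => 1 + I - ∫ y in (0 : ℝ)..s, bracket y ^ (-γ), fun s => ?_, fun s => ?_,
    fun s => ?_⟩
  · linarith [(abs_le.1 (hI s)).2]
  · linarith [(abs_le.1 (hI s)).1]
  · exact (intervalIntegral.integral_hasDerivAt_right (hq.intervalIntegrable _ _)
      (hq.stronglyMeasurableAtFilter _ _) hq.continuousAt).const_sub _

/-- This makes the coefficient of the angular and Hardy terms nonpositive. With `f = ⟨t - r⟩` and `h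
= ⟨t + r⟩` one has `h² - f² = 4 t r`. For equal weights the claim then reduces to the monotonicity
of `s / ⟨s⟩`. The excess `pu - pw ≥ 0` multiplies `h / r - (t + r) / h`, which is nonnegative. -/
lemma sq_div_bracket_bound {t r pu pw : ℝ} (ht : 0 < t) (hr : 0 < r) (hw : 0 ≤ pw) (hp : pw ≤ pu) :
    (t - r) / bracket (t - r) * pw + (t + r) / bracket (t + r) * pu
      ≤ (bracket (t + r) * pu - bracket (t - r) * pw) / r := by
  have hFu := bracket_pos (t - r)
  have hFw := bracket_pos (t + r)
  have su := sq_bracket (t - r)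
  have sw := sq_bracket (t + r)
  set f := bracket (t - r)
  set h := bracket (t + r)
  have hfh : f ≤ h := by
    refine bracket_le_bracket ?_
    rw [abs_le, abs_of_pos (by positivity : 0 < t + r)]; constructor <;> linarith
  have hA : 0 ≤ h / r - (t + r) / h := by
    rw [sub_nonneg, div_le_div_iff₀ hFw hr]; nlinarith [mul_pos ht hr]
  have hmono : (t - r) * h ≤ (t + r) * f := by
    by_cases h0 : t - r ≤ 0
    · have h1 : (t - r) * h ≤ 0 := mul_nonpos_of_nonpos_of_nonneg h0 hFw.le
      have h2 : 0 ≤ (t + r) * f := by positivity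
      linarith
    · apply le_of_sq_le_sq _ (by positivity)
      rw [mul_pow, mul_pow, su, sw]
      nlinarith [mul_pos ht hr]
  have hAB : f / r + (t - r) / f ≤ h / r - (t + r) / h := by
    have key : (h - f) * (h + f) = 4 * (t * r) := by nlinarith
    have : (t - r) / f + (t + r) / h ≤ (h - f) / r := by
      have e1 : (h - f) / r = 4 * t / (h + f) := by
        rw [div_eq_div_iff hr.ne' (by positivity)]; linarith
      rw [e1, div_add_div _ _ hFu.ne' hFw.ne', div_le_div_iff₀ (by positivity) (by positivity)]
      have : 0 ≤ ((t + r) * f - (t - r) * h) * (h - f) :=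
        mul_nonneg (by linarith) (by linarith)
      nlinarith
    have e2 : (h - f) / r = h / r - f / r := sub_div _ _ _
    linarith
  have : 0 ≤ pw * ((h / r - (t + r) / h) - (f / r + (t - r) / f))
      + (pu - pw) * (h / r - (t + r) / h) :=
    add_nonneg (mul_nonneg hw (by linarith)) (mul_nonneg (by linarith) hA)
  have e3 : (h * pu - f * pw) / r = h / r * pu - f / r * pw := by ring
  rw [e3]; nlinarith

/-- This makes the coefficient of the potential term nonpositive. The difference belonging to `t -
r` alone may have the wrong sign; adding the one belonging to `t + r` repairs it, again because `s /
⟨s⟩` increases, and `pw ≤ pu` puts the larger weight on the good one. -/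
lemma div_bracket_bound {t r pu pw : ℝ} (ht : 0 < t) (hr : 0 < r) (hw : 0 ≤ pw) (hp : pw ≤ pu) :
    (t - r) / bracket (t - r) * pw + (t + r) / bracket (t + r) * pu
      ≤ (bracket (t + r) * pu + bracket (t - r) * pw) / t := by
  have hFu := bracket_pos (t - r)
  have hFw := bracket_pos (t + r)
  have su := sq_bracket (t - r)
  have sw := sq_bracket (t + r)
  set f := bracket (t - r)
  set h := bracket (t + r)
  have hmono : (t - r) / f ≤ (t + r) / h := by
    rw [div_le_div_iff₀ hFu hFw]
    by_cases h0 : t - r ≤ 0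
    · have h1 : (t - r) * h ≤ 0 := mul_nonpos_of_nonpos_of_nonneg h0 hFw.le
      have h2 : 0 ≤ (t + r) * f := by positivity
      linarith
    · apply le_of_sq_le_sq _ (by positivity)
      rw [mul_pow, mul_pow, su, sw]
      nlinarith [mul_pos ht hr]
  have e1 : f / t - (t - r) / f = (1 / f - r * ((t - r) / f)) / t := by
    field_simp; rw [su]; ring
  have e2 : h / t - (t + r) / h = (1 / h + r * ((t + r) / h)) / t := by
    field_simp; rw [sw]; ring
  have h2 : 0 ≤ h / t - (t + r) / h := by rw [e2]; positivity
  have h3 : 0 ≤ (f / t - (t - r) / f) + (h / t - (t + r) / h) := by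
    rw [e1, e2, ← add_div]
    have : 0 ≤ r * ((t + r) / h - (t - r) / f) := mul_nonneg hr.le (by linarith)
    have h4 : 0 < 1 / f := by positivity
    have h5 : 0 < 1 / h := by positivity
    exact div_nonneg (by linarith) ht.le
  have e3 : (h * pu + f * pw) / t = h / t * pu + f / t * pw := by ring
  rw [e3]
  have : 0 ≤ pw * ((f / t - (t - r) / f) + (h / t - (t + r) / h))
      + (pu - pw) * (h / t - (t + r) / h) :=
    add_nonneg (mul_nonneg hw h3) (mul_nonneg (by linarith) h2)
  nlinarith

/-! ### Pointwise algebra of the multiplier: energy, flux and bulk. -/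

/-- Energy density of the multiplier `a ∂_u + h ∂_w`, written in terms of the time derivative `P`,
the value `ψ`, the radial part `xg = ⟪x, ∇ψ⟫` and `gg = ‖∇ψ‖ ^ 2`. -/
noncomputable def energyDensity (m α a h t r P ψ xg gg : ℝ) : ℝ :=
  (a + h) / 4 * (P ^ 2 + gg + 2 * m * ψ * xg / r ^ 2 + (m ^ 2 + m * (m - 1)) * ψ ^ 2 / r ^ 2
    + α * ψ ^ 2 / t ^ 2) + (h - a) / (2 * r) * P * (xg + m * ψ)

/-- The coefficient of `∇ψ` in the energy flux. -/
noncomputable def fluxGrad (m a h r P ψ xg : ℝ) : ℝ :=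
  (a + h) / 2 * P + (h - a) / (2 * r) * (xg + m * ψ)

/-- The coefficient of `x` in the energy flux. -/
noncomputable def fluxRadial (m α a h t r P ψ gg : ℝ) : ℝ :=
  (h - a) / (4 * r) * (P ^ 2 - gg + m * ψ ^ 2 / r ^ 2 - α * ψ ^ 2 / t ^ 2)
    + m * ((a + h) / 2) * P * ψ / r ^ 2

/-- Completing squares in the null directions: the cross term `2 m ψ xg / r²` and part of the `m²`
term are absorbed into `((xg + m ψ) / r)²`. What remains is the angular gradient, the Hardy term and
the potential, so positivity is visible. -/
lemma energyDensity_eq {m α a h t r P ψ xg gg : ℝ} (hr : r ≠ 0) :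
    energyDensity m α a h t r P ψ xg gg =
      a / 4 * (P - (xg + m * ψ) / r) ^ 2 + h / 4 * (P + (xg + m * ψ) / r) ^ 2
      + (a + h) / 4 * (gg - xg ^ 2 / r ^ 2 + m * (m - 1) * ψ ^ 2 / r ^ 2 + α * ψ ^ 2 / t ^ 2) := by
  unfold energyDensity
  field_simp
  ring

/-- Time derivative of `energyDensity`. -/
noncomputable def energyRate (m α a h t r P ψ xg gg at' ht Pt xpg gpg : ℝ) : ℝ :=
  (at' + ht) / 4 * (P ^ 2 + gg + 2 * m * ψ * xg / r ^ 2 + (m ^ 2 + m * (m - 1)) * ψ ^ 2 / r ^ 2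
    + α * ψ ^ 2 / t ^ 2) + (ht - at') / (2 * r) * P * (xg + m * ψ)
  + (a + h) / 4 * (2 * P * Pt + 2 * gpg + 2 * m * (P * xg + ψ * xpg) / r ^ 2
    + (m ^ 2 + m * (m - 1)) * (2 * ψ * P) / r ^ 2 + α * (2 * ψ * P) / t ^ 2 - 2 * α * ψ ^ 2 / t ^ 3)
  + (h - a) / (2 * r) * (Pt * (xg + m * ψ) + P * (xpg + m * P))

/-- Derivative of `fluxGrad` along a spatial curve. -/
noncomputable def fluxGradRate (m a h r P ψ xg a' h' r' P' ψ' xg' : ℝ) : ℝ :=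
  (a' + h') / 2 * P + (a + h) / 2 * P' + ((h' - a') / (2 * r) - (h - a) * r' / (2 * r ^ 2)) * (xg + m * ψ)
   + (h - a) / (2 * r) * (xg' + m * ψ')

/-- Derivative of `fluxRadial` along a spatial curve. -/
noncomputable def fluxRadialRate (m α a h t r P ψ gg a' h' r' P' ψ' gg' : ℝ) : ℝ :=
  ((h' - a') / (4 * r) - (h - a) * r' / (4 * r ^ 2)) * (P ^ 2 - gg + m * ψ ^ 2 / r ^ 2 - α * ψ ^ 2 / t ^ 2)
  + (h - a) / (4 * r) * (2 * P * P' - gg' + 2 * m * ψ * ψ' / r ^ 2 - 2 * m * ψ ^ 2 * r' / r ^ 3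
      - 2 * α * ψ * ψ' / t ^ 2)
  + m * ((a' + h') / 2) * P * ψ / r ^ 2 + m * ((a + h) / 2) * (P' * ψ + P * ψ') / r ^ 2
  - 2 * m * ((a + h) / 2) * P * ψ * r' / r ^ 3

/-- The multiplier identity. The energy flux is `fluxGrad • ∇ψ + fluxRadial • x`, so its divergence
consists of `fluxGrad` times the Laplacian, the derivative of `fluxGrad` along `∇ψ`, the derivative
of `fluxRadial` along `x`, and `fluxRadial` times `div x = n = 2 m + 1`. The variables `au, aw, hu,
hw` stand for derivatives of the weights in `t - r` and `t + r`, `trH` for the Laplacian, and `xHg`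
for the Hessian applied to `x` and `∇ψ`. The last bracket is the bulk. -/
lemma energyRate_eq {m α a h t r P ψ xg gg au aw hu hw trH G xpg gpg xHg : ℝ} (hr : r ≠ 0)
    (ht : t ≠ 0) :
    energyRate m α a h t r P ψ xg gg (au + aw) (hu + hw) (trH - α / t ^ 2 * ψ + G) xpg gpg =
      fluxGrad m a h r P ψ xg * trH
      + fluxGradRate m a h r P ψ xg ((aw - au) * (xg / r)) ((hw - hu) * (xg / r)) (xg / r) gpg gg
          (gg + xHg)
      + (2 * m + 1) * fluxRadial m α a h t r P ψ gg
      + fluxRadialRate m α a h t r P ψ gg ((aw - au) * r) ((hw - hu) * r) r xpg xg (2 * xHg)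
      + (aw / 2 * (P - (xg + m * ψ) / r) ^ 2 + hu / 2 * (P + (xg + m * ψ) / r) ^ 2
        + ((au + hw) - (h - a) / r) / 2 * (gg - xg ^ 2 / r ^ 2 + m * (m - 1) * ψ ^ 2 / r ^ 2)
        + ((au + hw) - (a + h) / t) / 2 * (α * ψ ^ 2 / t ^ 2)
        + G / 2 * (a * (P - (xg + m * ψ) / r) + h * (P + (xg + m * ψ) / r))) := by
  unfold energyRate fluxGrad fluxGradRate fluxRadial fluxRadialRate
  field_simp
  ring

/-- The part of `energyRate_eq` that is not a divergence is controlled by the source alone. -/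
lemma bulk_le {m α t r fu fw pu pw c c' qu qw iu iw M P ψ xg gg G : ℝ} (hm : 1 ≤ m) (hα : 0 ≤ α)
    (hr : 0 < r) (ht : 0 < t) (hfu : fu = bracket (t - r)) (hfw : fw = bracket (t + r))
    (hpu : 1 ≤ pu) (hpw : 1 ≤ pw) (hpuM : pu ≤ M) (hpwM : pw ≤ M) (hp : pw ≤ pu)
    (hc0 : 0 ≤ c) (hc1 : c ≤ 1) (hc' : c' ≤ 0) (hqu : 0 < qu) (hqw : 0 < qw)
    (hiu : qu * iu = 1) (hiw : qw * iw = 1) (hxg : xg ^ 2 ≤ r ^ 2 * gg) :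
    (fu * (-qw * c + pw * c')) / 2 * (P - (xg + m * ψ) / r) ^ 2
      + (fw * c * -qu) / 2 * (P + (xg + m * ψ) / r) ^ 2
      + (((t - r) / fu * (pw * c) + ((t + r) / fw * c + fw * c') * pu)
          - (fw * c * pu - fu * pw * c) / r) / 2
        * (gg - xg ^ 2 / r ^ 2 + m * (m - 1) * ψ ^ 2 / r ^ 2)
      + (((t - r) / fu * (pw * c) + ((t + r) / fw * c + fw * c') * pu)
          - (fu * pw * c + fw * c * pu) / t) / 2 * (α * ψ ^ 2 / t ^ 2)
      + G / 2 * (fu * pw * c * (P - (xg + m * ψ) / r) + fw * c * pu * (P + (xg + m * ψ) / r))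
      ≤ M ^ 2 / 8 * (fu * iw + fw * iu) * G ^ 2 := by
  set y := P - (xg + m * ψ) / r
  set z := P + (xg + m * ψ) / r
  have hfu0 : 0 < fu := hfu ▸ bracket_pos _
  have hfw0 : 0 < fw := hfw ▸ bracket_pos _
  have hiw0 : 0 < iw := by by_contra h; nlinarith
  have hiu0 : 0 < iu := by by_contra h; nlinarith
  have hfc : 0 ≤ -(fw * c' * pu) := by
    have := mul_nonneg hfw0.le (mul_nonneg (neg_nonneg.2 hc') (zero_le_one.trans hpu))
    linarith
  have hS : ((t - r) / fu * (pw * c) + ((t + r) / fw * c + fw * c') * pu)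
          - (fw * c * pu - fu * pw * c) / r ≤ 0 := by
    have := sq_div_bracket_bound ht hr (zero_le_one.trans hpw) hp
    rw [← hfu, ← hfw] at this
    have := mul_le_mul_of_nonneg_left this hc0
    have e : c * ((fw * pu - fu * pw) / r) = (fw * c * pu - fu * pw * c) / r := by ring
    rw [e] at this
    linarith
  have hT : ((t - r) / fu * (pw * c) + ((t + r) / fw * c + fw * c') * pu)
          - (fu * pw * c + fw * c * pu) / t ≤ 0 := by
    have := div_bracket_bound ht hr (zero_le_one.trans hpw) hp
    rw [← hfu, ← hfw] at this
    have := mul_le_mul_of_nonneg_left this hc0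
    have e : c * ((fw * pu + fu * pw) / t) = (fu * pw * c + fw * c * pu) / t := by ring
    rw [e] at this
    linarith
  have hang : 0 ≤ gg - xg ^ 2 / r ^ 2 + m * (m - 1) * ψ ^ 2 / r ^ 2 := by
    have h1 : xg ^ 2 / r ^ 2 ≤ gg := by rw [div_le_iff₀ (by positivity)]; linarith
    have h2 : 0 ≤ m * (m - 1) * ψ ^ 2 / r ^ 2 := by
      have : 0 ≤ m - 1 := by linarith
      positivity
    linarith
  have hpot : 0 ≤ α * ψ ^ 2 / t ^ 2 := by positivity
  have hS' := mul_nonneg (neg_nonneg.2 hS) hang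
  have hT' := mul_nonneg (neg_nonneg.2 hT) hpot
  -- The ghost-weight term, quadratic in a null derivative `y`, absorbs the source by completing the
  -- square; the square is centred at `G p / (2 q)`, with `i = 1 / q`.
  have absorb : ∀ f q i p y : ℝ, 0 < f → 0 < q → q * i = 1 → 0 < i → 1 ≤ p → p ≤ M →
      -(f * q * c) / 2 * y ^ 2 + G / 2 * (f * p * c * y) ≤ M ^ 2 / 8 * (f * i) * G ^ 2 := by
    intro f q i p y hf hq hqi hi hp1 hpM
    have h1 : 0 ≤ f * c / 2 * (q * (y - G * p * i / 2) ^ 2) := by positivity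
    have h2 : f * c / 2 * (q * (y - G * p * i / 2) ^ 2)
        = f * q * c / 2 * y ^ 2 - G / 2 * (f * p * c * y) * (q * i)
          + f * i * c * (q * i) * p ^ 2 / 8 * G ^ 2 := by ring
    rw [hqi] at h2
    have h3 : f * i * c * 1 * p ^ 2 / 8 * G ^ 2 ≤ M ^ 2 / 8 * (f * i) * G ^ 2 := by
      have : c * p ^ 2 ≤ 1 * M ^ 2 := by gcongr
      have := mul_le_mul_of_nonneg_left this (by positivity : 0 ≤ f * i / 8 * G ^ 2)
      linarith
    linarith
  have h1 := absorb fu qw iw pw y hfu0 hqw hiw hiw0 hpw hpwM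
  have h2 := absorb fw qu iu pu z hfw0 hqu hiu hiu0 hpu hpuM
  have h3 : 0 ≤ -(fu * (pw * c') / 2 * y ^ 2) := by
    have : 0 ≤ fu * (pw * -c') / 2 * y ^ 2 := by
      have : 0 ≤ -c' := by linarith
      have : 0 ≤ pw := by linarith
      positivity
    linarith
  linarith

/-- Lowering both null weights to a common `f` turns the squares of `P ± (xg + m ψ) / r` into twice
the sum of the two squares. -/
lemma energyDensity_ge {m α a h f t r P ψ xg gg : ℝ} (hm : 1 ≤ m) (hα : 0 ≤ α) (hr : 0 < r)
    (ha : f ≤ a) (hh : f ≤ h) (hxg : xg ^ 2 ≤ r ^ 2 * gg) :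
    f / 2 * (P ^ 2 + ((xg + m * ψ) / r) ^ 2 + (gg - xg ^ 2 / r ^ 2) + m * (m - 1) * (ψ / r) ^ 2
      + α * (ψ / t) ^ 2) ≤ energyDensity m α a h t r P ψ xg gg := by
  rw [energyDensity_eq hr.ne']
  have h1 : 0 ≤ gg - xg ^ 2 / r ^ 2 := by
    rw [sub_nonneg, div_le_iff₀ (by positivity)]; linarith
  have h2 : 0 ≤ m * (m - 1) * (ψ / r) ^ 2 := by
    have : 0 ≤ m - 1 := by linarith
    positivity
  have h3 : 0 ≤ α * (ψ / t) ^ 2 := by positivity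
  have h4 := mul_le_mul_of_nonneg_right ha (sq_nonneg (P - (xg + m * ψ) / r))
  have h5 := mul_le_mul_of_nonneg_right hh (sq_nonneg (P + (xg + m * ψ) / r))
  have h6 := mul_le_mul_of_nonneg_right (add_le_add ha hh) (add_nonneg (add_nonneg h1 h2) h3)
  have e1 : m * (m - 1) * ψ ^ 2 / r ^ 2 = m * (m - 1) * (ψ / r) ^ 2 := by ring
  have e2 : α * ψ ^ 2 / t ^ 2 = α * (ψ / t) ^ 2 := by ring
  rw [e1, e2]
  linarith

lemma energyDensity_nonneg {m α a h t r P ψ xg gg : ℝ} (hm : 1 ≤ m) (hα : 0 ≤ α) (hr : 0 < r)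
    (ha : 0 ≤ a) (hh : 0 ≤ h) (hxg : xg ^ 2 ≤ r ^ 2 * gg) :
    0 ≤ energyDensity m α a h t r P ψ xg gg := by
  simpa using energyDensity_ge (t := t) (P := P) (ψ := ψ) hm hα hr ha hh hxg

/-- The quantity is `x` paired with the energy flux, which is all that a radial cutoff sees. Near
the axis it is only of size `1 / r`, the worst term being `m ψ² (h - a) / (4 r)`. The assumption
`|ψ| ≤ K t` keeps `ψ / t` under control down to `t = 0`. -/
lemma abs_flux_le {m α a h t r P ψ xg gg L K T : ℝ} (hm : 0 ≤ m) (hα : 0 ≤ α) (hr : 0 < r)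
    (hr1 : r ≤ 1) (ht : 0 < t) (htT : t ≤ T) (ha : 0 ≤ a) (haL : a ≤ L) (hh : 0 ≤ h) (hhL : h ≤ L)
    (hP : |P| ≤ K) (hψ : |ψ| ≤ K * t) (hxg : |xg| ≤ r * K) (hgg0 : 0 ≤ gg) (hgg : gg ≤ K ^ 2) :
    |xg * fluxGrad m a h r P ψ xg + r ^ 2 * fluxRadial m α a h t r P ψ gg|
      ≤ L * K ^ 2 * (2 + 2 * m * T + m * T ^ 2 + α) / r := by
  have hK : 0 ≤ K := (abs_nonneg _).trans hP
  have hL : 0 ≤ L := ha.trans haL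
  have hA : |(a + h) / 2| ≤ L := by rw [abs_le]; constructor <;> linarith
  have hB : |(h - a) / 2| ≤ L / 2 := by rw [abs_le]; constructor <;> linarith
  have hψT : |ψ| ≤ K * T := hψ.trans (by gcongr)
  have hψt : (ψ / t) ^ 2 ≤ K ^ 2 := by
    rw [div_pow, div_le_iff₀ (by positivity), ← mul_pow, ← sq_abs]; gcongr
  have hP2 : P ^ 2 ≤ K ^ 2 := by rw [← sq_abs]; gcongr
  have hψ2 : ψ ^ 2 ≤ (K * T) ^ 2 := by rw [← sq_abs]; gcongr
  have hT : 0 ≤ T := ht.le.trans htT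
  rw [le_div_iff₀ hr]
  have e : (xg * fluxGrad m a h r P ψ xg + r ^ 2 * fluxRadial m α a h t r P ψ gg) * r
      = r * (xg * ((a + h) / 2) * P) + (h - a) / 2 * (xg * (xg + m * ψ))
        + ((h - a) / 2 * (r ^ 2 * (P ^ 2 - gg - α * (ψ / t) ^ 2) + m * ψ ^ 2)) / 2
        + r * (m * ((a + h) / 2) * P * ψ) := by
    unfold fluxGrad fluxRadial
    field_simp
    ring
  have hx1 : |xg| ≤ K := hxg.trans (mul_le_of_le_one_left hK hr1)
  have b1 : |r * (xg * ((a + h) / 2) * P)| ≤ 1 * (K * L * K) := by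
    rw [abs_mul, abs_mul, abs_mul, abs_of_pos hr]; gcongr
  have b2 : |(h - a) / 2 * (xg * (xg + m * ψ))| ≤ L / 2 * (K * (K + m * (K * T))) := by
    rw [abs_mul, abs_mul]; gcongr
    refine (abs_add_le _ _).trans ?_
    rw [abs_mul, abs_of_nonneg hm]; gcongr
  have b3 : |((h - a) / 2 * (r ^ 2 * (P ^ 2 - gg - α * (ψ / t) ^ 2) + m * ψ ^ 2)) / 2|
      ≤ L / 2 * (1 * (K ^ 2 + α * K ^ 2) + m * (K * T) ^ 2) / 2 := by
    rw [abs_div, abs_mul, abs_two]; gcongr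
    refine (abs_add_le _ _).trans ?_
    rw [abs_mul, abs_mul, abs_of_nonneg hm, abs_of_nonneg (sq_nonneg ψ),
      abs_of_nonneg (sq_nonneg r)]
    gcongr
    · exact pow_le_one₀ hr.le hr1
    · have := mul_le_mul_of_nonneg_left hψt hα
      have := mul_nonneg hα (sq_nonneg (ψ / t))
      have := sq_nonneg P
      rw [abs_le]; constructor <;> linarith
  have b4 : |r * (m * ((a + h) / 2) * P * ψ)| ≤ 1 * (m * L * K * (K * T)) := by
    rw [abs_mul, abs_mul, abs_mul, abs_mul, abs_of_pos hr, abs_of_nonneg hm]; gcongr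
  calc _ = |r * (xg * ((a + h) / 2) * P) + (h - a) / 2 * (xg * (xg + m * ψ))
        + ((h - a) / 2 * (r ^ 2 * (P ^ 2 - gg - α * (ψ / t) ^ 2) + m * ψ ^ 2)) / 2
        + r * (m * ((a + h) / 2) * P * ψ)| := by
        rw [← e, abs_mul, abs_of_pos hr]
    _ ≤ 1 * (K * L * K) + L / 2 * (K * (K + m * (K * T)))
        + L / 2 * (1 * (K ^ 2 + α * K ^ 2) + m * (K * T) ^ 2) / 2
        + 1 * (m * L * K * (K * T)) := by
        refine (abs_add_le _ _).trans (add_le_add ((abs_add_le _ _).trans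
          (add_le_add ((abs_add_le _ _).trans (add_le_add b1 b2)) b3)) b4)
    _ ≤ _ := by
        have h1 : 0 ≤ L * K ^ 2 := by positivity
        have h2 : 0 ≤ L * K ^ 2 * (m * T) := by positivity
        have h3 : 0 ≤ L * K ^ 2 * (m * T ^ 2) := by positivity
        have h4 : 0 ≤ L * K ^ 2 * α := by positivity
        linarith

end DampedWave

/-! ### The trace and the divergence theorem for compactly supported fields. -/

namespace DampedWave

/-- The trace of an endomorphism of `ℝⁿ`. -/
noncomputable def tr {n : ℕ} (L : EuclideanSpace ℝ (Fin n) →L[ℝ] EuclideanSpace ℝ (Fin n)) : ℝ :=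
  ∑ i, L (EuclideanSpace.single i 1) i

lemma continuous_tr {n : ℕ} : Continuous (tr (n := n)) := by
  unfold tr
  fun_prop

lemma tr_id {n : ℕ} : tr (ContinuousLinearMap.id ℝ (EuclideanSpace ℝ (Fin n))) = n := by
  simp [tr]

/-- The divergence of a compactly supported field `f Y` integrates to zero. -/
lemma integral_divergence_eq_zero {n : ℕ} {f : EuclideanSpace ℝ (Fin n) → ℝ}
    {Y : EuclideanSpace ℝ (Fin n) → EuclideanSpace ℝ (Fin n)} (hf : ContDiff ℝ 1 f)
    (hfc : HasCompactSupport f) (hY : ContDiff ℝ 1 Y) :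
    Integrable (fun x => fderiv ℝ f x (Y x) + f x * tr (fderiv ℝ Y x)) ∧
    ∫ x, (fderiv ℝ f x (Y x) + f x * tr (fderiv ℝ Y x)) = 0 := by
  have hYi : ∀ i, ContDiff ℝ 1 fun x => Y x i := fun i => by fun_prop
  have hfd : Continuous (fderiv ℝ f) := hf.continuous_fderiv one_ne_zero
  have hYd : ∀ i, Continuous (fderiv ℝ fun x => Y x i) := fun i =>
    (hYi i).continuous_fderiv one_ne_zero
  have e1 : ∀ x i, fderiv ℝ (fun x => Y x i) x (EuclideanSpace.single i 1)
      = fderiv ℝ Y x (EuclideanSpace.single i 1) i := fun x i => by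
    have h := ((hY.differentiable one_ne_zero) x).hasFDerivAt
    have := (EuclideanSpace.proj (𝕜 := ℝ) i).hasFDerivAt.comp x h
    rw [show (fun x => Y x i) = (EuclideanSpace.proj (𝕜 := ℝ) i) ∘ Y from rfl, this.fderiv]
    rfl
  have hfcd := hfc.fderiv (𝕜 := ℝ)
  have int1 : ∀ i, Integrable
      (fun x => fderiv ℝ f x (EuclideanSpace.single i 1) * Y x i) := fun i => by
    refine Continuous.integrable_of_hasCompactSupport ?_ ?_
    · exact (hfd.clm_apply continuous_const).mul (hYi i).continuous
    · refine (hfcd.comp_left (g := fun L => L (EuclideanSpace.single i 1)) (by simp)).mul_right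
  have int2 : ∀ i, Integrable
      (fun x => f x * fderiv ℝ (fun x => Y x i) x (EuclideanSpace.single i 1)) := fun i =>
    Continuous.integrable_of_hasCompactSupport
      (hf.continuous.mul ((hYd i).clm_apply continuous_const)) hfc.mul_right
  have int3 : ∀ i, Integrable (fun x => f x * Y x i) := fun i =>
    Continuous.integrable_of_hasCompactSupport (hf.continuous.mul (hYi i).continuous) hfc.mul_right
  have key : ∀ x, fderiv ℝ f x (Y x) + f x * tr (fderiv ℝ Y x)
      = ∑ i, (fderiv ℝ f x (EuclideanSpace.single i 1) * Y x i
        + f x * fderiv ℝ (fun x => Y x i) x (EuclideanSpace.single i 1)) := fun x => by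
    rw [Finset.sum_add_distrib, tr, Finset.mul_sum]
    congr 1
    · conv_lhs => rw [← (EuclideanSpace.basisFun (Fin n) ℝ).sum_repr (Y x)]
      simp [mul_comm]
    · simp only [e1]
  have int12 := fun i => (int1 i).add (int2 i)
  simp only [Pi.add_def] at int12
  simp only [key]
  refine ⟨integrable_finsetSum _ fun i _ => int12 i, ?_⟩
  rw [integral_finsetSum _ fun i _ => int12 i]
  refine Finset.sum_eq_zero fun i _ => ?_
  rw [integral_add (int1 i) (int2 i), integral_mul_fderiv_eq_neg_fderiv_mul_of_integrable
    (int1 i) (int2 i) (int3 i) (fun x _ => hf.differentiable one_ne_zero x)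
    (fun x _ => (hYi i).differentiable one_ne_zero x), add_neg_cancel]

end DampedWave

/-! ### Cutoffs and null weights, with their derivatives along curves. -/

namespace DampedWave

/-- A smooth cutoff equal to `1` on `s ≤ R` and to `0` on `R + 1 ≤ s`. -/
noncomputable def cutoff (R s : ℝ) : ℝ := Real.smoothTransition (R + 1 - s)

lemma cutoff_nonneg (R s : ℝ) : 0 ≤ cutoff R s := Real.smoothTransition.nonneg _
lemma cutoff_le_one (R s : ℝ) : cutoff R s ≤ 1 := Real.smoothTransition.le_one _

lemma cutoff_eq_zero {R s : ℝ} (h : R + 1 ≤ s) : cutoff R s = 0 :=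
  Real.smoothTransition.zero_of_nonpos (by linarith)

lemma cutoff_eq_one {R s : ℝ} (h : s ≤ R) : cutoff R s = 1 :=
  Real.smoothTransition.one_of_one_le (by linarith)

lemma contDiff_cutoff {R : ℝ} : ContDiff ℝ 1 (cutoff R) := by
  have : ContDiff ℝ 1 Real.smoothTransition := Real.smoothTransition.contDiff (n := 1)
  unfold cutoff
  fun_prop

lemma hasDerivAt_cutoff (R s : ℝ) : HasDerivAt (cutoff R) (deriv (cutoff R) s) s :=
  (contDiff_cutoff.differentiable one_ne_zero s).hasDerivAt

lemma deriv_cutoff_nonpos (R s : ℝ) : deriv (cutoff R) s ≤ 0 :=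
  Antitone.deriv_nonpos fun x y h => Real.smoothTransition.monotone (by linarith)

/-- Weight of the incoming null derivative. -/
noncomputable def wIn (p : ℝ → ℝ) (R t r : ℝ) : ℝ :=
  bracket (t - r) * p (t + r) * cutoff R (t + r)

/-- Weight of the outgoing null derivative. -/
noncomputable def wOut (p : ℝ → ℝ) (R t r : ℝ) : ℝ :=
  bracket (t + r) * cutoff R (t + r) * p (t - r)

noncomputable def wInU (p : ℝ → ℝ) (R t r : ℝ) : ℝ :=
  (t - r) / bracket (t - r) * (p (t + r) * cutoff R (t + r))

noncomputable def wInW (p q : ℝ → ℝ) (R t r : ℝ) : ℝ :=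
  bracket (t - r) * (-q (t + r) * cutoff R (t + r) + p (t + r) * deriv (cutoff R) (t + r))

noncomputable def wOutU (q : ℝ → ℝ) (R t r : ℝ) : ℝ :=
  bracket (t + r) * cutoff R (t + r) * -q (t - r)

noncomputable def wOutW (p : ℝ → ℝ) (R t r : ℝ) : ℝ :=
  ((t + r) / bracket (t + r) * cutoff R (t + r) + bracket (t + r) * deriv (cutoff R) (t + r))
    * p (t - r)

section Curves

variable {p q : ℝ → ℝ} {R : ℝ} {τ r : ℝ → ℝ} {τ' r' s : ℝ}

lemma hasDerivAt_wIn (hp : ∀ s, HasDerivAt p (-q s) s) (hτ : HasDerivAt τ τ' s)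
    (hr : HasDerivAt r r' s) :
    HasDerivAt (fun s => wIn p R (τ s) (r s))
      (wInU p R (τ s) (r s) * (τ' - r') + wInW p q R (τ s) (r s) * (τ' + r')) s := by
  have h1 := (hasDerivAt_bracket (τ s - r s)).comp s (hτ.sub hr)
  have h2 := (hp (τ s + r s)).comp s (hτ.add hr)
  have h3 := (hasDerivAt_cutoff R (τ s + r s)).comp s (hτ.add hr)
  refine ((h1.mul h2).mul h3).congr_deriv ?_
  simp only [Function.comp_apply, wInU, wInW, Pi.add_apply, Pi.sub_apply, Pi.mul_apply]
  ring

lemma hasDerivAt_wOut (hp : ∀ s, HasDerivAt p (-q s) s) (hτ : HasDerivAt τ τ' s)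
    (hr : HasDerivAt r r' s) :
    HasDerivAt (fun s => wOut p R (τ s) (r s))
      (wOutU q R (τ s) (r s) * (τ' - r') + wOutW p R (τ s) (r s) * (τ' + r')) s := by
  have h1 := (hasDerivAt_bracket (τ s + r s)).comp s (hτ.add hr)
  have h2 := (hp (τ s - r s)).comp s (hτ.sub hr)
  have h3 := (hasDerivAt_cutoff R (τ s + r s)).comp s (hτ.add hr)
  refine ((h1.mul h3).mul h2).congr_deriv ?_
  simp only [Function.comp_apply, wOutU, wOutW, Pi.add_apply, Pi.sub_apply, Pi.mul_apply]
  ring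

variable {m α t : ℝ} {a h P ψ xg gg : ℝ → ℝ} {a' h' P' ψ' xg' gg' : ℝ}

lemma hasDerivAt_fluxGrad (ha : HasDerivAt a a' s) (hh : HasDerivAt h h' s)
    (hr : HasDerivAt r r' s) (hP : HasDerivAt P P' s) (hψ : HasDerivAt ψ ψ' s)
    (hx : HasDerivAt xg xg' s) (hr0 : r s ≠ 0) :
    HasDerivAt (fun s => fluxGrad m (a s) (h s) (r s) (P s) (ψ s) (xg s))
      (fluxGradRate m (a s) (h s) (r s) (P s) (ψ s) (xg s) a' h' r' P' ψ' xg') s := by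
  have h1 := ((ha.add hh).div_const 2).mul hP
  have h2 := ((hh.sub ha).div (hr.const_mul 2) (by simpa using hr0)).mul (hx.add (hψ.const_mul m))
  refine (h1.add h2).congr_deriv ?_
  simp only [fluxGradRate, Pi.add_apply, Pi.sub_apply, Pi.div_apply]
  field_simp
  ring

lemma hasDerivAt_fluxRadial (ha : HasDerivAt a a' s) (hh : HasDerivAt h h' s)
    (hr : HasDerivAt r r' s) (hP : HasDerivAt P P' s) (hψ : HasDerivAt ψ ψ' s)
    (hg : HasDerivAt gg gg' s) (hr0 : r s ≠ 0) (ht : t ≠ 0) :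
    HasDerivAt (fun s => fluxRadial m α (a s) (h s) t (r s) (P s) (ψ s) (gg s))
      (fluxRadialRate m α (a s) (h s) t (r s) (P s) (ψ s) (gg s) a' h' r' P' ψ' gg') s := by
  have hr2 : r s ^ 2 ≠ 0 := pow_ne_zero 2 hr0
  have h1 := (((hP.pow 2).sub hg).add (((hψ.pow 2).const_mul m).div (hr.pow 2) hr2)).sub
    (((hψ.pow 2).const_mul α).div_const (t ^ 2))
  have h2 := ((hh.sub ha).div (hr.const_mul 4) (by simpa using hr0)).mul h1
  have h3 := ((((((ha.add hh).div_const 2).const_mul m).mul hP).mul hψ).div (hr.pow 2) hr2)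
  refine (h2.add h3).congr_deriv ?_
  simp only [fluxRadialRate, Pi.add_apply, Pi.sub_apply, Pi.mul_apply, Pi.div_apply, Pi.pow_apply]
  field_simp
  ring

lemma hasDerivAt_energyDensity {ρ : ℝ} (ha : HasDerivAt a a' s) (hh : HasDerivAt h h' s)
    (hP : HasDerivAt P P' s) (hψ : HasDerivAt ψ (P s) s) (hx : HasDerivAt xg xg' s)
    (hg : HasDerivAt gg (2 * gg') s) (hr0 : ρ ≠ 0) (hs : s ≠ 0) :
    HasDerivAt (fun s => energyDensity m α (a s) (h s) s ρ (P s) (ψ s) (xg s) (gg s))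
      (energyRate m α (a s) (h s) s ρ (P s) (ψ s) (xg s) (gg s) a' h' P' xg' gg') s := by
  have hs2 : s ^ 2 ≠ 0 := pow_ne_zero 2 hs
  have h1 := ((((hP.pow 2).add hg).add (((hψ.const_mul (2 * m)).mul hx).div_const (ρ ^ 2))).add
    (((hψ.pow 2).const_mul (m ^ 2 + m * (m - 1))).div_const (ρ ^ 2))).add
    (((hψ.pow 2).const_mul α).div ((hasDerivAt_id s).pow 2) hs2)
  have h2 := ((ha.add hh).div_const 4).mul h1
  have h3 := ((((hh.sub ha).div_const (2 * ρ)).mul hP).mul (hx.add (hψ.const_mul m)))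
  refine ((h2.add h3).congr_deriv ?_)
  simp only [energyRate, Pi.add_apply, Pi.sub_apply, Pi.mul_apply, Pi.div_apply, Pi.pow_apply, id]
  field_simp
  ring

end Curves

/-- Euclidean space `ℝⁿ`. -/
abbrev Space (n : ℕ) := EuclideanSpace ℝ (Fin n)

variable {n : ℕ}

lemma hasDerivAt_norm_line {x : Space n} (hx : x ≠ 0) (v : Space n) :
    HasDerivAt (fun s : ℝ => ‖x + s • v‖) (inner ℝ x v / ‖x‖) 0 := by
  have h1 : HasDerivAt (fun s : ℝ => x + s • v) v 0 := by
    simpa using ((hasDerivAt_id (0 : ℝ)).smul_const v).const_add x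
  have h2 := (h1.norm_sq).sqrt (by simpa using hx)
  simp only [Real.sqrt_sq (norm_nonneg _), zero_smul, add_zero] at h2
  refine h2.congr_deriv ?_
  rw [mul_div_mul_left _ _ two_ne_zero]

lemma hasDerivAt_line {f : Space n → ℝ} {x v : Space n} (hf : DifferentiableAt ℝ f x) :
    HasDerivAt (fun s : ℝ => f (x + s • v)) (fderiv ℝ f x v) 0 := by
  have h1 : HasDerivAt (fun s : ℝ => x + s • v) v 0 := by
    simpa using ((hasDerivAt_id (0 : ℝ)).smul_const v).const_add x
  exact HasFDerivAt.comp_hasDerivAt (0 : ℝ) (by simpa using hf.hasFDerivAt) h1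

/-- A cutoff vanishing near the axis `x = 0`. -/
noncomputable def axisCut (δ : ℝ) (x : Space n) : ℝ :=
  Real.smoothTransition (‖x‖ ^ 2 / δ ^ 2 - 1)

lemma axisCut_nonneg (δ : ℝ) (x : Space n) : 0 ≤ axisCut δ x := Real.smoothTransition.nonneg _
lemma axisCut_le_one (δ : ℝ) (x : Space n) : axisCut δ x ≤ 1 := Real.smoothTransition.le_one _

lemma axisCut_eq_zero {δ : ℝ} (hδ : 0 < δ) {x : Space n} (hx : ‖x‖ ≤ δ) : axisCut δ x = 0 := by
  refine Real.smoothTransition.zero_of_nonpos ?_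
  rw [sub_nonpos, div_le_one (by positivity)]
  gcongr

lemma axisCut_eq_one {δ : ℝ} (hδ : 0 < δ) {x : Space n} (hx : 2 * δ ≤ ‖x‖) :
    axisCut δ x = 1 := by
  refine Real.smoothTransition.one_of_one_le ?_
  rw [le_sub_iff_add_le, le_div_iff₀ (by positivity)]
  nlinarith [norm_nonneg x]

lemma contDiff_axisCut {δ : ℝ} : ContDiff ℝ 1 (axisCut (n := n) δ) := by
  have : ContDiff ℝ 1 Real.smoothTransition := Real.smoothTransition.contDiff (n := 1)
  have h2 : ContDiff ℝ 1 fun x : Space n => ‖x‖ ^ 2 / δ ^ 2 - 1 :=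
    ((contDiff_norm_sq ℝ).div_const _).sub contDiff_const
  exact this.comp h2

/-- Radial derivative of `axisCut`, divided by the radius. -/
noncomputable def axisCutRate (δ : ℝ) (x : Space n) : ℝ :=
  deriv Real.smoothTransition (‖x‖ ^ 2 / δ ^ 2 - 1) * (2 / δ ^ 2)

lemma fderiv_axisCut {δ : ℝ} (x v : Space n) :
    fderiv ℝ (axisCut δ) x v = axisCutRate δ x * inner ℝ x v := by
  have hd : ContDiff ℝ 1 Real.smoothTransition := Real.smoothTransition.contDiff (n := 1)
  have h1 : HasDerivAt (fun s : ℝ => x + s • v) v 0 := by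
    simpa using ((hasDerivAt_id (0 : ℝ)).smul_const v).const_add x
  have h2 := ((h1.norm_sq).div_const (δ ^ 2)).sub_const 1
  have h3 := ((hd.differentiable one_ne_zero (‖x + (0 : ℝ) • v‖ ^ 2 / δ ^ 2 - 1)).hasDerivAt).comp
    (0 : ℝ) h2
  have h4 := hasDerivAt_line (v := v)
    (contDiff_axisCut (δ := δ).differentiable one_ne_zero x)
  rw [h4.unique h3, axisCutRate]
  simp only [zero_smul, add_zero]
  ring

end DampedWave

/-! ### Regular waves and the divergence form of their energy flux. -/

namespace DampedWave

variable {n : ℕ}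

/-- A solution of `∂ₜ²ψ - Δψ + (α / t²) ψ = G` with vanishing data at `t₀`, smooth in space and with
absolutely continuous time derivative `P`; `g` is the spatial gradient of `ψ` and `pg` that of
`P`. -/
structure RegularWave (α t₀ T : ℝ) (ψ P : ℝ → Space n → ℝ) (g pg : ℝ → Space n → Space n)
    (G : ℝ → Space n → ℝ) : Prop where
  continuousOn_val : ContinuousOn (fun z : ℝ × Space n => ψ z.1 z.2) (Ioc t₀ T ×ˢ univ)
  continuousOn_vel : ContinuousOn (fun z : ℝ × Space n => P z.1 z.2) (Ioc t₀ T ×ˢ univ)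
  continuousOn_grad : ContinuousOn (fun z : ℝ × Space n => g z.1 z.2) (Ioc t₀ T ×ˢ univ)
  continuousOn_gradVel : ContinuousOn (fun z : ℝ × Space n => pg z.1 z.2) (Ioc t₀ T ×ˢ univ)
  continuousOn_hess :
    ContinuousOn (fun z : ℝ × Space n => fderiv ℝ (g z.1) z.2) (Ioc t₀ T ×ˢ univ)
  contDiff_val : ∀ t ∈ Ioc t₀ T, ContDiff ℝ 1 (ψ t)
  contDiff_vel : ∀ t ∈ Ioc t₀ T, ContDiff ℝ 1 (P t)
  contDiff_grad : ∀ t ∈ Ioc t₀ T, ContDiff ℝ 1 (g t)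
  fderiv_val : ∀ t ∈ Ioc t₀ T, ∀ x v, fderiv ℝ (ψ t) x v = inner ℝ (g t x) v
  fderiv_vel : ∀ t ∈ Ioc t₀ T, ∀ x v, fderiv ℝ (P t) x v = inner ℝ (pg t x) v
  symm : ∀ t ∈ Ioc t₀ T, ∀ x v w,
    inner ℝ (fderiv ℝ (g t) x v) w = inner ℝ v (fderiv ℝ (g t) x w)
  deriv_val : ∀ x, ∀ t ∈ Ioc t₀ T, HasDerivWithinAt (fun t => ψ t x) (P t x) (Ioc t₀ T) t
  deriv_grad : ∀ x, ∀ t ∈ Ioc t₀ T, HasDerivWithinAt (fun t => g t x) (pg t x) (Ioc t₀ T) t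
  absolutelyContinuous : ∀ x, ∀ s ∈ Ioo t₀ T,
    AbsolutelyContinuousOnInterval (fun t => P t x) s T
  equation : ∀ x, ∀ᵐ t, t ∈ Ioo t₀ T → HasDerivAt (fun t => P t x)
    (tr (fderiv ℝ (g t) x) - α / t ^ 2 * ψ t x + G t x) t
  -- The factor `t` matters when `t₀ = 0`: it keeps `ψ / t`, and with it the potential energy,
  -- bounded near the initial time.
  bound : ∀ R, ∃ K, ∀ t ∈ Ioc t₀ T, ∀ x, ‖x‖ ≤ R →
    |ψ t x| ≤ K * t ∧ |P t x| ≤ K ∧ ‖g t x‖ ≤ K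
  tendsto_val : ∀ x, Tendsto (fun t => ψ t x / t) (𝓝[>] t₀) (𝓝 0)
  tendsto_vel : ∀ x, Tendsto (fun t => P t x) (𝓝[>] t₀) (𝓝 0)
  tendsto_grad : ∀ x, Tendsto (fun t => g t x) (𝓝[>] t₀) (𝓝 0)

section Density

variable (p q : ℝ → ℝ) (R m α δ : ℝ) (ψ P : ℝ → Space n → ℝ) (g pg : ℝ → Space n → Space n)

/-- The weighted energy density of a wave. -/
noncomputable def waveEnergy (t : ℝ) (x : Space n) : ℝ :=
  energyDensity m α (wIn p R t ‖x‖) (wOut p R t ‖x‖) t ‖x‖ (P t x) (ψ t x) (inner ℝ x (g t x))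
    (‖g t x‖ ^ 2)

noncomputable def waveFluxGrad (t : ℝ) (x : Space n) : ℝ :=
  fluxGrad m (wIn p R t ‖x‖) (wOut p R t ‖x‖) ‖x‖ (P t x) (ψ t x) (inner ℝ x (g t x))

noncomputable def waveFluxRadial (t : ℝ) (x : Space n) : ℝ :=
  fluxRadial m α (wIn p R t ‖x‖) (wOut p R t ‖x‖) t ‖x‖ (P t x) (ψ t x) (‖g t x‖ ^ 2)

/-- The divergence of the energy flux, away from the axis. -/
noncomputable def waveFluxDiv (t : ℝ) (x : Space n) : ℝ :=
  waveFluxGrad p R m ψ P g t x * tr (fderiv ℝ (g t) x)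
    + fluxGradRate m (wIn p R t ‖x‖) (wOut p R t ‖x‖) ‖x‖ (P t x) (ψ t x) (inner ℝ x (g t x))
        ((wInW p q R t ‖x‖ - wInU p R t ‖x‖) * (inner ℝ x (g t x) / ‖x‖))
        ((wOutW p R t ‖x‖ - wOutU q R t ‖x‖) * (inner ℝ x (g t x) / ‖x‖))
        (inner ℝ x (g t x) / ‖x‖) (inner ℝ (g t x) (pg t x)) (‖g t x‖ ^ 2)
        (‖g t x‖ ^ 2 + inner ℝ x (fderiv ℝ (g t) x (g t x)))
    + (2 * m + 1) * waveFluxRadial p R m α ψ P g t x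
    + fluxRadialRate m α (wIn p R t ‖x‖) (wOut p R t ‖x‖) t ‖x‖ (P t x) (ψ t x) (‖g t x‖ ^ 2)
        ((wInW p q R t ‖x‖ - wInU p R t ‖x‖) * ‖x‖)
        ((wOutW p R t ‖x‖ - wOutU q R t ‖x‖) * ‖x‖) ‖x‖ (inner ℝ x (pg t x)) (inner ℝ x (g t x))
        (2 * inner ℝ x (fderiv ℝ (g t) x (g t x)))

/-- The flux through the axis cutoff. -/
noncomputable def waveAxisFlux (t : ℝ) (x : Space n) : ℝ :=
  axisCutRate δ x * (inner ℝ x (g t x) * waveFluxGrad p R m ψ P g t x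
    + ‖x‖ ^ 2 * waveFluxRadial p R m α ψ P g t x)

end Density

section Identities

variable {p q : ℝ → ℝ} {R m α δ t₀ T : ℝ} {ψ P G : ℝ → Space n → ℝ} {g pg : ℝ → Space n → Space n}

lemma contDiff_one_of_ghost (hp : ∀ s, HasDerivAt p (-q s) s) (hq : Continuous q) :
    ContDiff ℝ 1 p := by
  rw [contDiff_one_iff_deriv]
  refine ⟨fun s => (hp s).differentiableAt, ?_⟩
  rw [show deriv p = fun s => -q s from funext fun s => (hp s).deriv]
  exact hq.neg

lemma wIn_eq_zero {t r : ℝ} (h : R + 1 ≤ t + r) : wIn p R t r = 0 := by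
  simp [wIn, cutoff_eq_zero h]

lemma wOut_eq_zero {t r : ℝ} (h : R + 1 ≤ t + r) : wOut p R t r = 0 := by
  simp [wOut, cutoff_eq_zero h]

lemma contDiffAt_wIn (hp : ContDiff ℝ 1 p) {t : ℝ} {x : Space n} (hx : x ≠ 0) :
    ContDiffAt ℝ 1 (fun x : Space n => wIn p R t ‖x‖) x := by
  have hn : ContDiffAt ℝ 1 (fun x : Space n => ‖x‖) x := contDiffAt_norm ℝ hx
  have hb : ContDiff ℝ 1 bracket := contDiff_bracket
  have hc : ContDiff ℝ 1 (cutoff R) := contDiff_cutoff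
  exact ((hb.contDiffAt.comp x (contDiffAt_const.sub hn)).mul
    (hp.contDiffAt.comp x (contDiffAt_const.add hn))).mul
    (hc.contDiffAt.comp x (contDiffAt_const.add hn))

lemma contDiffAt_wOut (hp : ContDiff ℝ 1 p) {t : ℝ} {x : Space n} (hx : x ≠ 0) :
    ContDiffAt ℝ 1 (fun x : Space n => wOut p R t ‖x‖) x := by
  have hn : ContDiffAt ℝ 1 (fun x : Space n => ‖x‖) x := contDiffAt_norm ℝ hx
  have hb : ContDiff ℝ 1 bracket := contDiff_bracket
  have hc : ContDiff ℝ 1 (cutoff R) := contDiff_cutoff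
  exact ((hb.contDiffAt.comp x (contDiffAt_const.add hn)).mul
    (hc.contDiffAt.comp x (contDiffAt_const.add hn))).mul
    (hp.contDiffAt.comp x (contDiffAt_const.sub hn))

lemma contDiffAt_waveFluxGrad (hp : ContDiff ℝ 1 p) (hw : RegularWave α t₀ T ψ P g pg G)
    {t : ℝ} (ht : t ∈ Ioc t₀ T) {x : Space n} (hx : x ≠ 0) :
    ContDiffAt ℝ 1 (waveFluxGrad p R m ψ P g t) x := by
  have hn : ContDiffAt ℝ 1 (fun x : Space n => ‖x‖) x := contDiffAt_norm ℝ hx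
  have ha := contDiffAt_wIn (R := R) (t := t) hp hx
  have hh := contDiffAt_wOut (R := R) (t := t) hp hx
  have hψ := (hw.contDiff_val t ht).contDiffAt (x := x)
  have hP := (hw.contDiff_vel t ht).contDiffAt (x := x)
  have hg := (hw.contDiff_grad t ht).contDiffAt (x := x)
  have hx' : (2 * ‖x‖) ≠ 0 := by simpa using hx
  have hxg : ContDiffAt ℝ 1 (fun x => inner ℝ x (g t x)) x := contDiffAt_id.inner ℝ hg
  exact ((((ha.add hh).div_const 2).mul hP)).add
    (((hh.sub ha).div (contDiffAt_const.mul hn) hx').mul (hxg.add (contDiffAt_const.mul hψ)))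

lemma contDiffAt_waveFluxRadial (hp : ContDiff ℝ 1 p) (hw : RegularWave α t₀ T ψ P g pg G)
    {t : ℝ} (ht : t ∈ Ioc t₀ T) {x : Space n} (hx : x ≠ 0) :
    ContDiffAt ℝ 1 (waveFluxRadial p R m α ψ P g t) x := by
  have hn : ContDiffAt ℝ 1 (fun x : Space n => ‖x‖) x := contDiffAt_norm ℝ hx
  have ha := contDiffAt_wIn (R := R) (t := t) hp hx
  have hh := contDiffAt_wOut (R := R) (t := t) hp hx
  have hψ := (hw.contDiff_val t ht).contDiffAt (x := x)
  have hP := (hw.contDiff_vel t ht).contDiffAt (x := x)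
  have hg := (hw.contDiff_grad t ht).contDiffAt (x := x)
  have hx' : (4 * ‖x‖) ≠ 0 := by simpa using hx
  have hx2 : ‖x‖ ^ 2 ≠ 0 := by simpa using hx
  exact (((hh.sub ha).div (contDiffAt_const.mul hn) hx').mul
    ((((hP.pow 2).sub (hg.norm_sq ℝ)).add ((contDiffAt_const.mul (hψ.pow 2)).div (hn.pow 2) hx2)).sub
      ((contDiffAt_const.mul (hψ.pow 2)).div_const _))).add
    ((((contDiffAt_const.mul ((ha.add hh).div_const 2)).mul hP).mul hψ).div (hn.pow 2) hx2)

/-- The flux coefficients are singular only on the axis, near which the cutoff vanishes identically.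
-/
lemma contDiff_axisCut_mul {f : Space n → ℝ} (hδ : 0 < δ)
    (hf : ∀ x, x ≠ 0 → ContDiffAt ℝ 1 f x) : ContDiff ℝ 1 fun x => axisCut δ x * f x := by
  rw [contDiff_iff_contDiffAt]
  intro x
  by_cases hx : x = 0
  · refine (contDiffAt_const (c := (0 : ℝ))).congr_of_eventuallyEq ?_
    filter_upwards [Metric.ball_mem_nhds x hδ] with y hy
    rw [hx, mem_ball_zero_iff] at hy
    rw [axisCut_eq_zero hδ hy.le, zero_mul]
  · exact contDiff_axisCut.contDiffAt.mul (hf x hx)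

lemma hasCompactSupport_of_eq_zero {E : Type*} [Zero E] {f : Space n → E} (ρ : ℝ)
    (h : ∀ x, ρ ≤ ‖x‖ → f x = 0) : HasCompactSupport f :=
  HasCompactSupport.intro (isCompact_closedBall 0 ρ) fun x hx => h x (by
    rw [mem_closedBall_zero_iff, not_le] at hx; exact hx.le)

lemma waveFluxGrad_eq_zero {t : ℝ} {x : Space n} (h : R + 1 ≤ t + ‖x‖) :
    waveFluxGrad p R m ψ P g t x = 0 := by
  simp [waveFluxGrad, fluxGrad, wIn_eq_zero h, wOut_eq_zero h]

lemma waveFluxRadial_eq_zero {t : ℝ} {x : Space n} (h : R + 1 ≤ t + ‖x‖) :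
    waveFluxRadial p R m α ψ P g t x = 0 := by
  simp [waveFluxRadial, fluxRadial, wIn_eq_zero h, wOut_eq_zero h]

/-- Both spatial derivatives are read off along lines, in direction `∇ψ` for the first coefficient
and `x` for the second. Symmetry of the Hessian then identifies the two ways in which it enters. -/
lemma fderiv_waveFlux (hp : ∀ s, HasDerivAt p (-q s) s) (hq : Continuous q)
    (hw : RegularWave α t₀ T ψ P g pg G) {t : ℝ} (ht : t ∈ Ioc t₀ T) (ht0 : 0 < t)
    {x : Space n} (hx : x ≠ 0) :
    waveFluxDiv p q R m α ψ P g pg t x =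
      (fderiv ℝ (waveFluxGrad p R m ψ P g t) x (g t x)
        + waveFluxGrad p R m ψ P g t x * tr (fderiv ℝ (g t) x))
      + (fderiv ℝ (waveFluxRadial p R m α ψ P g t) x x
        + (2 * m + 1) * waveFluxRadial p R m α ψ P g t x) := by
  have hpc := contDiff_one_of_ghost hp hq
  have hr0 : ‖x‖ ≠ 0 := by simpa using hx
  have hline : ∀ v : Space n, HasDerivAt (fun s : ℝ => x + s • v) v 0 := fun v => by
    simpa using ((hasDerivAt_id (0 : ℝ)).smul_const v).const_add x
  have hgline : ∀ v, HasDerivAt (fun s : ℝ => g t (x + s • v)) (fderiv ℝ (g t) x v) 0 := fun v =>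
    HasFDerivAt.comp_hasDerivAt (0 : ℝ)
      (by simpa using ((hw.contDiff_grad t ht).differentiable one_ne_zero x).hasFDerivAt) (hline v)
  have hψ : ∀ v, HasDerivAt (fun s : ℝ => ψ t (x + s • v)) (inner ℝ (g t x) v) 0 := fun v => by
    rw [← hw.fderiv_val t ht]
    exact hasDerivAt_line ((hw.contDiff_val t ht).differentiable one_ne_zero x)
  have hP : ∀ v, HasDerivAt (fun s : ℝ => P t (x + s • v)) (inner ℝ (pg t x) v) 0 := fun v => by
    rw [← hw.fderiv_vel t ht]
    exact hasDerivAt_line ((hw.contDiff_vel t ht).differentiable one_ne_zero x)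
  have hr := fun v => hasDerivAt_norm_line hx v
  have ha := fun v => hasDerivAt_wIn (R := R) hp (hasDerivAt_const (0 : ℝ) t) (hr v)
  have hh := fun v => hasDerivAt_wOut (R := R) hp (hasDerivAt_const (0 : ℝ) t) (hr v)
  have e1 : fderiv ℝ (waveFluxGrad p R m ψ P g t) x (g t x) = _ :=
    (hasDerivAt_line ((contDiffAt_waveFluxGrad (R := R) (m := m) hpc hw ht hx).differentiableAt
      one_ne_zero)).unique
      (hasDerivAt_fluxGrad (m := m) (ha (g t x)) (hh (g t x)) (hr (g t x)) (hP (g t x))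
        (hψ (g t x)) ((hline (g t x)).inner ℝ (hgline (g t x))) (by simpa using hr0))
  have e2 : fderiv ℝ (waveFluxRadial p R m α ψ P g t) x x = _ :=
    (hasDerivAt_line ((contDiffAt_waveFluxRadial (R := R) (m := m) hpc hw ht hx).differentiableAt
      one_ne_zero)).unique
      (hasDerivAt_fluxRadial (m := m) (α := α) (ha x) (hh x) (hr x) (hP x) (hψ x)
        ((hgline x).norm_sq) (by simpa using hr0) ht0.ne')
  rw [e1, e2, waveFluxDiv]
  have s1 : inner ℝ (g t x) (fderiv ℝ (g t) x x) = inner ℝ x (fderiv ℝ (g t) x (g t x)) := by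
    rw [← hw.symm t ht, real_inner_comm]
  have s2 : ‖x‖ ^ 2 / ‖x‖ = ‖x‖ := by field_simp
  simp only [zero_smul, add_zero, s1, s2, real_inner_self_eq_norm_sq,
    real_inner_comm x (g t x), real_inner_comm (g t x) (pg t x), real_inner_comm x (pg t x)]
  have c1 : ∀ a b c : ℝ, a * (0 - c) + b * (0 + c) = (b - a) * c := fun a b c => by ring
  simp only [c1]
  rw [add_comm (inner ℝ x (fderiv ℝ (g t) x (g t x)))]
  ring

/-- By the product rule the integrand is the divergence of the cut-off flux, which is `C¹` and
compactly supported; the hypothesis `n = 2 m + 1` enters as the divergence of `x`. -/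
lemma integral_waveFluxDiv (hp : ∀ s, HasDerivAt p (-q s) s) (hq : Continuous q)
    (hw : RegularWave α t₀ T ψ P g pg G) (hm : (n : ℝ) = 2 * m + 1) (hδ : 0 < δ)
    {t : ℝ} (ht : t ∈ Ioc t₀ T) (ht0 : 0 < t) :
    ∫ x, (axisCut δ x * waveFluxDiv p q R m α ψ P g pg t x
      + waveAxisFlux p R m α δ ψ P g t x) = 0 := by
  have hpc := contDiff_one_of_ghost hp hq
  have c1 := contDiff_axisCut_mul (f := waveFluxGrad p R m ψ P g t) hδ
    fun x hx => contDiffAt_waveFluxGrad hpc hw ht hx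
  have c2 := contDiff_axisCut_mul (f := waveFluxRadial p R m α ψ P g t) hδ
    fun x hx => contDiffAt_waveFluxRadial hpc hw ht hx
  obtain ⟨i1, h1⟩ := integral_divergence_eq_zero c1
    (hasCompactSupport_of_eq_zero (R + 1) fun x hx => by
      rw [waveFluxGrad_eq_zero (by linarith), mul_zero]) (hw.contDiff_grad t ht)
  obtain ⟨i2, h2⟩ := integral_divergence_eq_zero (Y := fun x => x) c2
    (hasCompactSupport_of_eq_zero (R + 1) fun x hx => by
      rw [waveFluxRadial_eq_zero (by linarith), mul_zero]) contDiff_id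
  have h12 := integral_add i1 i2
  rw [h1, h2, add_zero] at h12
  rw [← h12]
  refine integral_congr_ae (Eventually.of_forall fun x => ?_)
  simp only
  by_cases hx : ‖x‖ < δ
  · have hz : ∀ f : Space n → ℝ, fderiv ℝ (fun x => axisCut δ x * f x) x = 0 := fun f => by
      have : (fun x => axisCut δ x * f x) =ᶠ[𝓝 x] fun _ => 0 := by
        filter_upwards [(isOpen_lt continuous_norm continuous_const).mem_nhds hx] with y hy
        rw [axisCut_eq_zero hδ (le_of_lt hy), zero_mul]
      rw [this.fderiv_eq, fderiv_const_apply]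
    -- Testing the vanishing derivative of the cutoff in direction `x` only yields `axisCutRate δ x
    -- * ‖x‖ ^ 2 = 0`, hence the alternative.
    have hz' : axisCutRate δ x = 0 ∨ x = 0 := by
      by_cases hx0 : x = 0
      · exact Or.inr hx0
      · refine Or.inl ?_
        have h3 := fderiv_axisCut (δ := δ) x x
        have : axisCut δ =ᶠ[𝓝 x] fun _ => 0 := by
          filter_upwards [(isOpen_lt continuous_norm continuous_const).mem_nhds hx] with y hy
          exact axisCut_eq_zero hδ (le_of_lt hy)
        rw [this.fderiv_eq, fderiv_const_apply] at h3
        simpa [hx0] using h3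
    rw [hz, hz, waveAxisFlux, axisCut_eq_zero hδ hx.le]
    rcases hz' with h | h <;> simp [h]
  · have hx0 : x ≠ 0 := by
      rintro rfl; simp at hx; linarith
    rw [fderiv_waveFlux hp hq hw ht ht0 hx0, waveAxisFlux,
      fderiv_fun_mul (contDiff_axisCut.differentiable one_ne_zero x)
        ((contDiffAt_waveFluxGrad hpc hw ht hx0).differentiableAt one_ne_zero),
      fderiv_fun_mul (contDiff_axisCut.differentiable one_ne_zero x)
        ((contDiffAt_waveFluxRadial hpc hw ht hx0).differentiableAt one_ne_zero)]
    have hid : tr (fderiv ℝ (fun x : Space n => x) x) = 2 * m + 1 := by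
      rw [fderiv_fun_id, tr_id, hm]
    rw [hid]
    simp only [add_apply, smul_apply, smul_eq_mul,
      fderiv_axisCut, real_inner_self_eq_norm_sq]
    ring

end Identities

end DampedWave

/-! ### The energy density as a function of time at a fixed point, and its bounds. -/

namespace DampedWave

lemma absolutelyContinuousOnInterval_of_hasDerivWithinAt {f f' : ℝ → ℝ} {a b : ℝ} (hab : a ≤ b)
    (hf : ∀ t ∈ Icc a b, HasDerivWithinAt f (f' t) (Icc a b) t) (hf' : ContinuousOn f' (Icc a b)) :
    AbsolutelyContinuousOnInterval f a b := by
  obtain ⟨C, hC⟩ := isCompact_Icc.exists_bound_of_continuousOn hf'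
  have h := (convex_Icc a b).lipschitzOnWith_of_nnnorm_hasDerivWithin_le (C := C.toNNReal) hf
    (fun t ht => by
      rw [← NNReal.coe_le_coe, coe_nnnorm]
      exact (hC t ht).trans (Real.le_coe_toNNReal C))
  rw [← uIcc_of_le hab] at h
  exact h.absolutelyContinuousOnInterval

variable {n : ℕ} {p q : ℝ → ℝ} {R m α δ t₀ T M : ℝ} {ψ P G : ℝ → Space n → ℝ}
  {g pg : ℝ → Space n → Space n}

/-- The source density that bounds the production of weighted energy. -/
noncomputable def sourceDensity (γ M : ℝ) (G : ℝ → Space n → ℝ) (t : ℝ) (x : Space n) : ℝ :=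
  M ^ 2 / 8 * (bracket (t - ‖x‖) * bracket (t + ‖x‖) ^ γ + bracket (t + ‖x‖) * bracket (t - ‖x‖) ^ γ)
    * G t x ^ 2

lemma sourceDensity_nonneg (γ M : ℝ) (G : ℝ → Space n → ℝ) (t : ℝ) (x : Space n) :
    0 ≤ sourceDensity γ M G t x := by
  have h1 := bracket_pos (t - ‖x‖)
  have h2 := bracket_pos (t + ‖x‖)
  unfold sourceDensity
  positivity

lemma inner_sq_le (x y : Space n) : inner ℝ x y ^ 2 ≤ ‖x‖ ^ 2 * ‖y‖ ^ 2 := by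
  rw [← mul_pow, ← sq_abs]
  gcongr
  exact abs_real_inner_le_norm x y

lemma hasDerivAt_waveEnergy (hp : ∀ s, HasDerivAt p (-q s) s)
    (hw : RegularWave α t₀ T ψ P g pg G) (ht₀ : 0 ≤ t₀) {t : ℝ} (ht : t ∈ Ioo t₀ T)
    {x : Space n} (hx : x ≠ 0) {P' : ℝ} (hP : HasDerivAt (fun t => P t x) P' t) :
    HasDerivAt (fun t => waveEnergy p R m α ψ P g t x)
      (energyRate m α (wIn p R t ‖x‖) (wOut p R t ‖x‖) t ‖x‖ (P t x) (ψ t x) (inner ℝ x (g t x))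
        (‖g t x‖ ^ 2) (wInU p R t ‖x‖ + wInW p q R t ‖x‖) (wOutU q R t ‖x‖ + wOutW p R t ‖x‖) P'
        (inner ℝ x (pg t x)) (inner ℝ (g t x) (pg t x))) t := by
  have hn : Ioc t₀ T ∈ 𝓝 t := Ioc_mem_nhds ht.1 ht.2
  have hψ := (hw.deriv_val x t (Ioo_subset_Ioc_self ht)).hasDerivAt hn
  have hg := (hw.deriv_grad x t (Ioo_subset_Ioc_self ht)).hasDerivAt hn
  have ha := hasDerivAt_wIn (R := R) hp (hasDerivAt_id t) (hasDerivAt_const t ‖x‖)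
  have hh := hasDerivAt_wOut (R := R) hp (hasDerivAt_id t) (hasDerivAt_const t ‖x‖)
  have hxg := (hasDerivAt_const t x).inner ℝ hg
  have := hasDerivAt_energyDensity (m := m) (α := α) (ρ := ‖x‖) ha hh hP hψ hxg hg.norm_sq
    (by simpa using hx) (ht₀.trans_lt ht.1).ne'
  simp only [id, sub_zero, add_zero, mul_one, inner_zero_left] at this
  exact this

lemma energyRate_le (hp : ∀ s, HasDerivAt p (-q s) s) {γ : ℝ} (hq : ∀ s, q s = bracket s ^ (-γ))
    (hp1 : ∀ s, 1 ≤ p s) (hpM : ∀ s, p s ≤ M) (hm : 1 ≤ m) (hα : 0 ≤ α) {t : ℝ} (ht : 0 < t)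
    {x : Space n} (hx : x ≠ 0) :
    energyRate m α (wIn p R t ‖x‖) (wOut p R t ‖x‖) t ‖x‖ (P t x) (ψ t x) (inner ℝ x (g t x))
        (‖g t x‖ ^ 2) (wInU p R t ‖x‖ + wInW p q R t ‖x‖) (wOutU q R t ‖x‖ + wOutW p R t ‖x‖)
        (tr (fderiv ℝ (g t) x) - α / t ^ 2 * ψ t x + G t x)
        (inner ℝ x (pg t x)) (inner ℝ (g t x) (pg t x))
      ≤ waveFluxDiv p q R m α ψ P g pg t x + sourceDensity γ M G t x := by
  have hr : 0 < ‖x‖ := norm_pos_iff.2 hx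
  have hqpos : ∀ s, 0 < q s := fun s => by rw [hq]; exact Real.rpow_pos_of_pos (bracket_pos s) _
  have hqi : ∀ s, q s * bracket s ^ γ = 1 := fun s => by
    rw [hq, ← Real.rpow_add (bracket_pos s), neg_add_cancel, Real.rpow_zero]
  -- Since `p` decreases and `t - ‖x‖ ≤ t + ‖x‖`, the outgoing weight carries the larger value of
  -- `p`, as `bulk_le` requires.
  have hanti : Antitone p := antitone_of_deriv_nonpos (fun s => (hp s).differentiableAt)
    fun s => by rw [(hp s).deriv]; linarith [hqpos s]
  rw [energyRate_eq (xHg := inner ℝ x (fderiv ℝ (g t) x (g t x))) hr.ne' ht.ne', waveFluxDiv]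
  refine add_le_add (le_of_eq ?_) ?_
  · simp only [waveFluxGrad, waveFluxRadial]
  · exact bulk_le (ψ := ψ t x) (G := G t x) (P := P t x) hm hα hr ht rfl rfl (hp1 (t - ‖x‖))
      (hp1 (t + ‖x‖)) (hpM _) (hpM _)
      (hanti (by linarith)) (cutoff_nonneg R _) (cutoff_le_one R _) (deriv_cutoff_nonpos R _)
      (hqpos _) (hqpos _) (hqi _) (hqi _) (inner_sq_le x (g t x))

/-- The velocity `P` is only absolutely continuous in time, so the energy is not `C¹`; absolute
continuity is what the fundamental theorem of calculus needs. All other ingredients are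
differentiable in time with continuous derivative on `[s, T]`, hence Lipschitz. -/
lemma absolutelyContinuous_waveEnergy (hp : ∀ s, HasDerivAt p (-q s) s) (hq : Continuous q)
    (hw : RegularWave α t₀ T ψ P g pg G) (ht₀ : 0 ≤ t₀) {s : ℝ} (hs : s ∈ Ioo t₀ T) (x : Space n) :
    AbsolutelyContinuousOnInterval (fun t => waveEnergy p R m α ψ P g t x) s T := by
  have hpc := contDiff_one_of_ghost hp hq
  have hsub : Icc s T ⊆ Ioc t₀ T := fun t ht => ⟨hs.1.trans_le ht.1, ht.2⟩
  have hs0 : 0 < s := ht₀.trans_lt hs.1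
  have hline : ContinuousOn (fun t : ℝ => (t, x)) (Icc s T) := by fun_prop
  have hmaps : MapsTo (fun t : ℝ => (t, x)) (Icc s T) (Ioc t₀ T ×ˢ univ) := fun t ht =>
    ⟨hsub ht, mem_univ _⟩
  have cP : ContinuousOn (fun t => P t x) (Icc s T) := hw.continuousOn_vel.comp hline hmaps
  have cg : ContinuousOn (fun t => g t x) (Icc s T) := hw.continuousOn_grad.comp hline hmaps
  have cpg : ContinuousOn (fun t => pg t x) (Icc s T) := hw.continuousOn_gradVel.comp hline hmaps
  have hψ : AbsolutelyContinuousOnInterval (fun t => ψ t x) s T :=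
    absolutelyContinuousOnInterval_of_hasDerivWithinAt hs.2.le
      (fun t ht => (hw.deriv_val x t (hsub ht)).mono hsub) cP
  have hxg : AbsolutelyContinuousOnInterval (fun t => inner ℝ x (g t x)) s T := by
    refine absolutelyContinuousOnInterval_of_hasDerivWithinAt
      (f' := fun t => inner ℝ x (pg t x)) hs.2.le
      (fun t ht => ?_) (continuousOn_const.inner cpg)
    simpa using (hasDerivWithinAt_const t (Icc s T) x).inner ℝ
      ((hw.deriv_grad x t (hsub ht)).mono hsub)
  have hgg : AbsolutelyContinuousOnInterval (fun t => ‖g t x‖ ^ 2) s T :=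
    absolutelyContinuousOnInterval_of_hasDerivWithinAt hs.2.le
      (fun t ht => ((hw.deriv_grad x t (hsub ht)).mono hsub).norm_sq)
      (continuousOn_const.mul (cg.inner cpg))
  have hPac := hw.absolutelyContinuous x s hs
  have hb : ContDiff ℝ 1 bracket := contDiff_bracket
  have hc : ContDiff ℝ 1 (cutoff R) := contDiff_cutoff
  have ha : AbsolutelyContinuousOnInterval (fun t => wIn p R t ‖x‖) s T := by
    refine ContDiffOn.absolutelyContinuousOnInterval (ContDiff.contDiffOn ?_)
    unfold wIn; fun_prop
  have hh : AbsolutelyContinuousOnInterval (fun t => wOut p R t ‖x‖) s T := by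
    refine ContDiffOn.absolutelyContinuousOnInterval (ContDiff.contDiffOn ?_)
    unfold wOut; fun_prop
  have hi : AbsolutelyContinuousOnInterval (fun t : ℝ => α / t ^ 2) s T := by
    refine ContDiffOn.absolutelyContinuousOnInterval (contDiffOn_const.div (by fun_prop) ?_)
    intro t ht
    rw [uIcc_of_le hs.2.le] at ht
    exact pow_ne_zero 2 (hs0.trans_le ht.1).ne'
  have hψψ := hψ.fun_mul hψ
  have h1 := ((((hPac.fun_mul hPac).fun_add hgg).fun_add ((hψ.fun_mul hxg).const_mul
    (2 * m / ‖x‖ ^ 2))).fun_add (hψψ.const_mul ((m ^ 2 + m * (m - 1)) / ‖x‖ ^ 2))).fun_add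
    (hi.fun_mul hψψ)
  have h2 := ((ha.fun_add hh).const_mul (1 / 4)).fun_mul h1
  have h3 := (((hh.fun_sub ha).const_mul (1 / (2 * ‖x‖))).fun_mul hPac).fun_mul
    (hxg.fun_add (hψ.const_mul m))
  have h4 := h2.fun_add h3
  refine (congrArg (fun f => AbsolutelyContinuousOnInterval f s T) (funext fun t => ?_)).mp h4
  unfold waveEnergy energyDensity
  ring

section Bounds

lemma wIn_nonneg (hp1 : ∀ s, 1 ≤ p s) (t r : ℝ) : 0 ≤ wIn p R t r :=
  mul_nonneg (mul_nonneg (bracket_pos _).le (zero_le_one.trans (hp1 _))) (cutoff_nonneg _ _)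

lemma wOut_nonneg (hp1 : ∀ s, 1 ≤ p s) (t r : ℝ) : 0 ≤ wOut p R t r :=
  mul_nonneg (mul_nonneg (bracket_pos _).le (cutoff_nonneg _ _)) (zero_le_one.trans (hp1 _))

lemma bracket_sub_le_bracket_add {t r : ℝ} (ht : 0 ≤ t) (hr : 0 ≤ r) :
    bracket (t - r) ≤ bracket (t + r) :=
  bracket_le_bracket (by rw [abs_of_nonneg (add_nonneg ht hr), abs_le]; constructor <;> linarith)

/-- The cutoff confines the weight to `t + r < R + 1`, where the bracket is at most `R + 2`. -/
lemma wOut_le (hp1 : ∀ s, 1 ≤ p s) (hpM : ∀ s, p s ≤ M) {t r : ℝ} (ht : 0 ≤ t) (hr : 0 ≤ r)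
    (hR : 0 ≤ R) : wOut p R t r ≤ (R + 2) * M := by
  have hM : 0 ≤ M := zero_le_one.trans ((hp1 0).trans (hpM 0))
  by_cases h : R + 1 ≤ t + r
  · rw [wOut_eq_zero h]; positivity
  · have h1 : bracket (t + r) ≤ R + 2 := (bracket_le _).trans (by
      rw [abs_of_nonneg (by positivity)]; linarith)
    unfold wOut
    have := hpM (t - r)
    have := hp1 (t - r)
    calc _ ≤ (R + 2) * 1 * M := by
          gcongr
          · exact cutoff_nonneg _ _
          · exact cutoff_le_one _ _
      _ = _ := by ring

lemma wIn_le (hp1 : ∀ s, 1 ≤ p s) (hpM : ∀ s, p s ≤ M) {t r : ℝ} (ht : 0 ≤ t) (hr : 0 ≤ r)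
    (hR : 0 ≤ R) : wIn p R t r ≤ (R + 2) * M := by
  have hM : 0 ≤ M := zero_le_one.trans ((hp1 0).trans (hpM 0))
  by_cases h : R + 1 ≤ t + r
  · rw [wIn_eq_zero h]; positivity
  · have h1 : bracket (t - r) ≤ R + 2 := (bracket_sub_le_bracket_add ht hr).trans ((bracket_le _).trans (by
      rw [abs_of_nonneg (by positivity)]; linarith))
    unfold wIn
    have := hpM (t + r)
    have := hp1 (t + r)
    calc _ ≤ (R + 2) * M * 1 := by
          gcongr
          · exact cutoff_nonneg _ _
          · exact cutoff_le_one _ _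
      _ = _ := by ring

lemma le_wIn (hp1 : ∀ s, 1 ≤ p s) (t r : ℝ) : bracket (t - r) * cutoff R (t + r) ≤ wIn p R t r := by
  have h := mul_nonneg (bracket_pos (t - r)).le (cutoff_nonneg R (t + r))
  unfold wIn
  nlinarith [hp1 (t + r)]

lemma le_wOut (hp1 : ∀ s, 1 ≤ p s) {t r : ℝ} (ht : 0 ≤ t) (hr : 0 ≤ r) :
    bracket (t - r) * cutoff R (t + r) ≤ wOut p R t r := by
  have h := mul_nonneg (bracket_pos (t + r)).le (cutoff_nonneg R (t + r))
  have h2 := mul_le_mul_of_nonneg_right (bracket_sub_le_bracket_add ht hr) (cutoff_nonneg R (t + r))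
  unfold wOut
  nlinarith [hp1 (t - r)]

/-- A crude bound away from the axis, degenerating as `δ → 0`; it only serves to dominate the
energies as the time tends to `t₀`. -/
lemma energyDensity_le {a h t r P ψ xg gg L K : ℝ} (hm : 1 ≤ m) (hα : 0 ≤ α)
    (hδ : 0 < δ) (hr : δ ≤ r) (ht : 0 < t) (htT : t ≤ T) (ha : 0 ≤ a) (haL : a ≤ L) (hh : 0 ≤ h)
    (hhL : h ≤ L) (hP : |P| ≤ K) (hψ : |ψ| ≤ K * t) (hxg : |xg| ≤ r * K) (hgg : gg ≤ K ^ 2) :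
    energyDensity m α a h t r P ψ xg gg ≤
      L * (2 * K + m * (K * T) / δ) ^ 2
        + L * (K ^ 2 + m * (m - 1) * (K * T) ^ 2 / δ ^ 2 + α * K ^ 2) := by
  have hr0 : 0 < r := hδ.trans_le hr
  have hL : 0 ≤ L := ha.trans haL
  have hK : 0 ≤ K := (abs_nonneg _).trans hP
  have hT : 0 ≤ T := ht.le.trans htT
  have hψT : |ψ| ≤ K * T := hψ.trans (by gcongr)
  have hm1 : 0 ≤ m - 1 := by linarith
  rw [energyDensity_eq hr0.ne']
  have hD : |(xg + m * ψ) / r| ≤ K + m * (K * T) / δ := by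
    rw [add_div]
    refine (abs_add_le _ _).trans (add_le_add ?_ ?_)
    · rw [abs_div, abs_of_pos hr0, div_le_iff₀ hr0]; linarith
    · rw [abs_div, abs_of_pos hr0, abs_mul, abs_of_nonneg (by linarith : 0 ≤ m)]
      gcongr
  have h1 : (P - (xg + m * ψ) / r) ^ 2 ≤ (2 * K + m * (K * T) / δ) ^ 2 := by
    rw [← sq_abs]; gcongr; exact (abs_sub _ _).trans (by linarith)
  have h2 : (P + (xg + m * ψ) / r) ^ 2 ≤ (2 * K + m * (K * T) / δ) ^ 2 := by
    rw [← sq_abs]; gcongr; exact (abs_add_le _ _).trans (by linarith)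
  have h3 : m * (m - 1) * ψ ^ 2 / r ^ 2 ≤ m * (m - 1) * (K * T) ^ 2 / δ ^ 2 := by
    rw [← sq_abs ψ]; gcongr
  have h4 : α * ψ ^ 2 / t ^ 2 ≤ α * K ^ 2 := by
    rw [div_le_iff₀ (by positivity), mul_assoc, ← mul_pow, ← sq_abs ψ]; gcongr
  have h5 : 0 ≤ xg ^ 2 / r ^ 2 := by positivity
  have h6 : a / 4 * (P - (xg + m * ψ) / r) ^ 2 ≤ L / 4 * (2 * K + m * (K * T) / δ) ^ 2 := by gcongr
  have h7 : h / 4 * (P + (xg + m * ψ) / r) ^ 2 ≤ L / 4 * (2 * K + m * (K * T) / δ) ^ 2 := by gcongr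
  have h8 : gg - xg ^ 2 / r ^ 2 + m * (m - 1) * ψ ^ 2 / r ^ 2 + α * ψ ^ 2 / t ^ 2
      ≤ K ^ 2 + m * (m - 1) * (K * T) ^ 2 / δ ^ 2 + α * K ^ 2 := by linarith
  have h9 : 0 ≤ K ^ 2 + m * (m - 1) * (K * T) ^ 2 / δ ^ 2 + α * K ^ 2 := by positivity
  have h10 := (mul_le_mul_of_nonneg_left h8 (by positivity : 0 ≤ (a + h) / 4)).trans
    (mul_le_mul_of_nonneg_right (by linarith : (a + h) / 4 ≤ L / 2) h9)
  have h11 : 0 ≤ L * (2 * K + m * (K * T) / δ) ^ 2 := by positivity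
  have h12 := mul_nonneg hL h9
  linarith

end Bounds

end DampedWave

/-! ### Joint continuity of energy and flux off the axis. -/

namespace DampedWave

variable {n : ℕ} {p q : ℝ → ℝ} {R m α δ t₀ T M : ℝ} {ψ P G : ℝ → Space n → ℝ}
  {g pg : ℝ → Space n → Space n}

section Continuity

lemma continuous_wIn (hp : Continuous p) : Continuous fun z : ℝ × ℝ => wIn p R z.1 z.2 := by
  have hb : Continuous bracket := (contDiff_bracket (k := 1)).continuous
  have hc : Continuous (cutoff R) := contDiff_cutoff.continuous
  unfold wIn
  fun_prop

lemma continuous_wOut (hp : Continuous p) : Continuous fun z : ℝ × ℝ => wOut p R z.1 z.2 := by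
  have hb : Continuous bracket := (contDiff_bracket (k := 1)).continuous
  have hc : Continuous (cutoff R) := contDiff_cutoff.continuous
  unfold wOut
  fun_prop

lemma continuous_div_bracket : Continuous fun s => s / bracket s :=
  continuous_id.div (contDiff_bracket (k := 1)).continuous fun s => (bracket_pos s).ne'

lemma continuous_wInU (hp : Continuous p) : Continuous fun z : ℝ × ℝ => wInU p R z.1 z.2 := by
  have hb := continuous_div_bracket.comp (continuous_fst.sub continuous_snd : Continuous fun z : ℝ × ℝ => z.1 - z.2)
  have hc : Continuous (cutoff R) := contDiff_cutoff.continuous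
  unfold wInU
  exact hb.mul (by fun_prop)

lemma continuous_wOutW (hp : Continuous p) : Continuous fun z : ℝ × ℝ => wOutW p R z.1 z.2 := by
  have hb := continuous_div_bracket.comp (continuous_fst.add continuous_snd : Continuous fun z : ℝ × ℝ => z.1 + z.2)
  have hb' : Continuous bracket := (contDiff_bracket (k := 1)).continuous
  have hc : Continuous (cutoff R) := contDiff_cutoff.continuous
  have hc' : Continuous (deriv (cutoff R)) := contDiff_cutoff.continuous_deriv le_rfl
  unfold wOutW
  exact ((hb.mul (by fun_prop)).add (by fun_prop)).mul (by fun_prop)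

lemma continuous_wInW (hp : Continuous p) (hq : Continuous q) :
    Continuous fun z : ℝ × ℝ => wInW p q R z.1 z.2 := by
  have hb' : Continuous bracket := (contDiff_bracket (k := 1)).continuous
  have hc : Continuous (cutoff R) := contDiff_cutoff.continuous
  have hc' : Continuous (deriv (cutoff R)) := contDiff_cutoff.continuous_deriv le_rfl
  unfold wInW
  fun_prop

lemma continuous_wOutU (hq : Continuous q) : Continuous fun z : ℝ × ℝ => wOutU q R z.1 z.2 := by
  have hb' : Continuous bracket := (contDiff_bracket (k := 1)).continuous
  have hc : Continuous (cutoff R) := contDiff_cutoff.continuous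
  unfold wOutU
  fun_prop

lemma continuous_axisCutRate : Continuous (axisCutRate (n := n) δ) := by
  have hd : Continuous (deriv Real.smoothTransition) :=
    (Real.smoothTransition.contDiff (n := 1)).continuous_deriv le_rfl
  unfold axisCutRate
  fun_prop

lemma continuousOn_waveEnergy (hp : Continuous p) (hw : RegularWave α t₀ T ψ P g pg G)
    (ht₀ : 0 ≤ t₀) :
    ContinuousOn (fun z : ℝ × Space n => waveEnergy p R m α ψ P g z.1 z.2)
      (Ioc t₀ T ×ˢ {x | x ≠ 0}) := by
  have hsub : Ioc t₀ T ×ˢ {x : Space n | x ≠ 0} ⊆ Ioc t₀ T ×ˢ univ :=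
    prod_mono subset_rfl (subset_univ _)
  have hψ := hw.continuousOn_val.mono hsub
  have hP := hw.continuousOn_vel.mono hsub
  have hg := hw.continuousOn_grad.mono hsub
  have hz : Continuous fun z : ℝ × Space n => (z.1, ‖z.2‖) :=
    continuous_fst.prodMk continuous_snd.norm
  have ha := ((continuous_wIn (R := R) hp).comp hz).continuousOn (s := Ioc t₀ T ×ˢ {x | x ≠ 0})
  have hh := ((continuous_wOut (R := R) hp).comp hz).continuousOn (s := Ioc t₀ T ×ˢ {x | x ≠ 0})
  simp only [Function.comp_def] at ha hh
  have ht1 : ∀ z ∈ Ioc t₀ T ×ˢ {x : Space n | x ≠ 0}, z.1 ^ 2 ≠ 0 := fun z hz =>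
    pow_ne_zero 2 (ht₀.trans_lt hz.1.1).ne'
  have hr1 : ∀ z ∈ Ioc t₀ T ×ˢ {x : Space n | x ≠ 0}, ‖z.2‖ ≠ 0 := fun z hz =>
    norm_ne_zero_iff.2 hz.2
  have hr2 : ∀ z ∈ Ioc t₀ T ×ˢ {x : Space n | x ≠ 0}, 2 * ‖z.2‖ ≠ 0 := fun z hz =>
    mul_ne_zero two_ne_zero (hr1 z hz)
  have hr4 : ∀ z ∈ Ioc t₀ T ×ˢ {x : Space n | x ≠ 0}, ‖z.2‖ ^ 2 ≠ 0 := fun z hz =>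
    pow_ne_zero 2 (hr1 z hz)
  unfold waveEnergy energyDensity
  fun_prop (disch := first | exact ht1 | exact hr2 | exact hr4)

lemma continuousOn_waveFluxDiv (hp : Continuous p) (hq : Continuous q)
    (hw : RegularWave α t₀ T ψ P g pg G) (ht₀ : 0 ≤ t₀) :
    ContinuousOn (fun z : ℝ × Space n => axisCut δ z.2 * waveFluxDiv p q R m α ψ P g pg z.1 z.2
      + waveAxisFlux p R m α δ ψ P g z.1 z.2)
      (Ioc t₀ T ×ˢ {x | x ≠ 0}) := by
  have hsub : Ioc t₀ T ×ˢ {x : Space n | x ≠ 0} ⊆ Ioc t₀ T ×ˢ univ :=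
    prod_mono subset_rfl (subset_univ _)
  have hψ := hw.continuousOn_val.mono hsub
  have hP := hw.continuousOn_vel.mono hsub
  have hg := hw.continuousOn_grad.mono hsub
  have hpg := hw.continuousOn_gradVel.mono hsub
  have hH := hw.continuousOn_hess.mono hsub
  have htr : ContinuousOn (fun z : ℝ × Space n => tr (fderiv ℝ (g z.1) z.2))
      (Ioc t₀ T ×ˢ {x | x ≠ 0}) := continuous_tr.comp_continuousOn hH
  have hc1 : Continuous (axisCut (n := n) δ) := contDiff_axisCut.continuous
  have hc2 : Continuous (axisCutRate (n := n) δ) := continuous_axisCutRate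
  have hz : Continuous fun z : ℝ × Space n => (z.1, ‖z.2‖) :=
    continuous_fst.prodMk continuous_snd.norm
  have w1 := ((continuous_wIn (R := R) hp).comp hz).continuousOn (s := Ioc t₀ T ×ˢ {x | x ≠ 0})
  have w2 := ((continuous_wOut (R := R) hp).comp hz).continuousOn (s := Ioc t₀ T ×ˢ {x | x ≠ 0})
  have w3 := ((continuous_wInU (R := R) hp).comp hz).continuousOn (s := Ioc t₀ T ×ˢ {x | x ≠ 0})
  have w4 := ((continuous_wOutU (R := R) hq).comp hz).continuousOn (s := Ioc t₀ T ×ˢ {x | x ≠ 0})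
  have w5 := ((continuous_wInW (R := R) hp hq).comp hz).continuousOn (s := Ioc t₀ T ×ˢ {x | x ≠ 0})
  have w6 := ((continuous_wOutW (R := R) hp).comp hz).continuousOn (s := Ioc t₀ T ×ˢ {x | x ≠ 0})
  simp only [Function.comp_def] at w1 w2 w3 w4 w5 w6
  have ht1 : ∀ z ∈ Ioc t₀ T ×ˢ {x : Space n | x ≠ 0}, z.1 ^ 2 ≠ 0 := fun z hz =>
    pow_ne_zero 2 (ht₀.trans_lt hz.1.1).ne'
  have hr1 : ∀ z ∈ Ioc t₀ T ×ˢ {x : Space n | x ≠ 0}, ‖z.2‖ ≠ 0 := fun z hz =>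
    norm_ne_zero_iff.2 hz.2
  have hr2 : ∀ z ∈ Ioc t₀ T ×ˢ {x : Space n | x ≠ 0}, 2 * ‖z.2‖ ≠ 0 := fun z hz =>
    mul_ne_zero two_ne_zero (hr1 z hz)
  have hr3 : ∀ z ∈ Ioc t₀ T ×ˢ {x : Space n | x ≠ 0}, 4 * ‖z.2‖ ≠ 0 := fun z hz =>
    mul_ne_zero four_ne_zero (hr1 z hz)
  have hr4 : ∀ z ∈ Ioc t₀ T ×ˢ {x : Space n | x ≠ 0}, ‖z.2‖ ^ 2 ≠ 0 := fun z hz =>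
    pow_ne_zero 2 (hr1 z hz)
  have hr5 : ∀ z ∈ Ioc t₀ T ×ˢ {x : Space n | x ≠ 0}, ‖z.2‖ ^ 3 ≠ 0 := fun z hz =>
    pow_ne_zero 3 (hr1 z hz)
  have hr6 : ∀ z ∈ Ioc t₀ T ×ˢ {x : Space n | x ≠ 0}, 2 * ‖z.2‖ ^ 2 ≠ 0 := fun z hz =>
    mul_ne_zero two_ne_zero (hr4 z hz)
  have hr7 : ∀ z ∈ Ioc t₀ T ×ˢ {x : Space n | x ≠ 0}, 4 * ‖z.2‖ ^ 2 ≠ 0 := fun z hz =>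
    mul_ne_zero four_ne_zero (hr4 z hz)
  unfold waveAxisFlux waveFluxDiv waveFluxGrad waveFluxRadial fluxGrad fluxRadial fluxGradRate
    fluxRadialRate
  fun_prop (disch := first
    | exact ht1 | exact hr1 | exact hr2 | exact hr3 | exact hr4 | exact hr5 | exact hr6 | exact hr7)

end Continuity

end DampedWave

/-! ### The integrated energy inequality, with a cutoff at the axis. -/

namespace DampedWave

variable {n : ℕ} {p q : ℝ → ℝ} {R m α δ t₀ T M : ℝ} {ψ P G : ℝ → Space n → ℝ}
  {g pg : ℝ → Space n → Space n}

lemma isCompact_shell (a b : ℝ) : IsCompact {x : Space n | a ≤ ‖x‖ ∧ ‖x‖ ≤ b} :=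
  (isCompact_closedBall (0 : Space n) b).of_isClosed_subset
    ((isClosed_le continuous_const continuous_norm).inter
      (isClosed_le continuous_norm continuous_const)) fun x hx => by simpa using hx.2

/-- A function on a time slab that is continuous off the axis and supported in a shell is
integrable. -/
lemma integrable_of_shell {f : ℝ × Space n → ℝ} {s t ρ : ℝ} (hδ : 0 < δ)
    (hf : ContinuousOn f (Icc s t ×ˢ {x | x ≠ 0}))
    (h0 : ∀ τ ∈ Ioc s t, ∀ x, ‖x‖ < δ → f (τ, x) = 0)
    (h1 : ∀ τ ∈ Ioc s t, ∀ x, ρ < ‖x‖ → f (τ, x) = 0) :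
    Integrable f ((volume.restrict (Ioc s t)).prod volume) := by
  have hK : IsCompact (Icc s t ×ˢ {x : Space n | δ ≤ ‖x‖ ∧ ‖x‖ ≤ ρ}) :=
    isCompact_Icc.prod (isCompact_shell δ ρ)
  have hi : IntegrableOn f (Icc s t ×ˢ {x : Space n | δ ≤ ‖x‖ ∧ ‖x‖ ≤ ρ}) (volume.prod volume) :=
    (hf.mono (prod_mono subset_rfl fun x hx => norm_pos_iff.1 (hδ.trans_le hx.1))).integrableOn_compact hK
  have h2 : IntegrableOn f (Ioc s t ×ˢ univ) (volume.prod volume) := by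
    refine hi.of_forall_sdiff_eq_zero (measurableSet_Ioc.prod MeasurableSet.univ) ?_
    rintro ⟨τ, x⟩ ⟨⟨hτ, -⟩, hx⟩
    by_cases hd : ‖x‖ < δ
    · exact h0 τ hτ x hd
    · by_cases hd' : ρ < ‖x‖
      · exact h1 τ hτ x hd'
      · exact absurd ⟨Ioc_subset_Icc_self hτ, not_lt.1 hd, not_lt.1 hd'⟩ hx
  have h3 : (volume.restrict (Ioc s t)).prod (volume : Measure (Space n))
      = (volume.prod volume).restrict (Ioc s t ×ˢ univ) := by
    rw [← Measure.prod_restrict, Measure.restrict_univ]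
  rw [h3]
  exact h2

lemma integrable_slice_of_shell {f : Space n → ℝ} {ρ : ℝ} (hδ : 0 < δ)
    (hf : ContinuousOn f {x | x ≠ 0}) (h0 : ∀ x, ‖x‖ < δ → f x = 0)
    (h1 : ∀ x, ρ < ‖x‖ → f x = 0) : Integrable f := by
  have hi : IntegrableOn f {x : Space n | δ ≤ ‖x‖ ∧ ‖x‖ ≤ ρ} :=
    (hf.mono fun x hx => norm_pos_iff.1 (hδ.trans_le hx.1)).integrableOn_compact (isCompact_shell δ ρ)
  rw [← integrableOn_univ]
  refine hi.of_forall_sdiff_eq_zero MeasurableSet.univ fun x hx => ?_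
  by_cases hd : ‖x‖ < δ
  · exact h0 x hd
  · by_cases hd' : ρ < ‖x‖
    · exact h1 x hd'
    · exact absurd ⟨not_lt.1 hd, not_lt.1 hd'⟩ hx.2

lemma axisCutRate_eq_zero_of_lt (hδ : 0 < δ) {x : Space n} (hx : ‖x‖ < δ) :
    axisCutRate δ x = 0 := by
  have h : ‖x‖ ^ 2 / δ ^ 2 - 1 < 0 := by
    rw [sub_neg, div_lt_one (by positivity)]; gcongr
  have : Real.smoothTransition =ᶠ[𝓝 (‖x‖ ^ 2 / δ ^ 2 - 1)] fun _ => 0 := by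
    filter_upwards [Iio_mem_nhds h] with y hy
    exact Real.smoothTransition.zero_of_nonpos (le_of_lt hy)
  rw [axisCutRate, this.deriv_eq, deriv_const, zero_mul]

lemma axisCutRate_eq_zero_of_gt (hδ : 0 < δ) {x : Space n} (hx : 2 * δ < ‖x‖) :
    axisCutRate δ x = 0 := by
  have h : 1 < ‖x‖ ^ 2 / δ ^ 2 - 1 := by
    rw [lt_sub_iff_add_lt, lt_div_iff₀ (by positivity)]; nlinarith
  have : Real.smoothTransition =ᶠ[𝓝 (‖x‖ ^ 2 / δ ^ 2 - 1)] fun _ => 1 := by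
    filter_upwards [Ioi_mem_nhds h] with y hy
    exact Real.smoothTransition.one_of_one_le (le_of_lt hy)
  rw [axisCutRate, this.deriv_eq, deriv_const, zero_mul]

/-- Scaling: the transition only acts for `‖x‖ ≤ 2 δ`, where its argument stays in `[-1, 3]`, so one
bound serves every `δ`. The power `δ ^ (-2)` is the explicit chain-rule factor. -/
lemma exists_axisCutRate_bound : ∃ B, 0 ≤ B ∧ ∀ δ > 0, ∀ x : Space n,
    |axisCutRate δ x| ≤ B / δ ^ 2 := by
  have hd : Continuous (deriv Real.smoothTransition) :=
    (Real.smoothTransition.contDiff (n := 1)).continuous_deriv le_rfl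
  obtain ⟨C, hC⟩ := (isCompact_Icc (a := (-1 : ℝ)) (b := 3)).exists_bound_of_continuousOn
    hd.continuousOn
  have hC0 : 0 ≤ C := (norm_nonneg _).trans (hC 0 (by norm_num))
  refine ⟨2 * C, by positivity, fun δ hδ x => ?_⟩
  by_cases h : 2 * δ < ‖x‖
  · rw [axisCutRate_eq_zero_of_gt hδ h, abs_zero]; positivity
  · have h1 : 0 ≤ ‖x‖ ^ 2 / δ ^ 2 := by positivity
    have h2 : ‖x‖ ^ 2 / δ ^ 2 ≤ 4 := by
      rw [div_le_iff₀ (by positivity)]; nlinarith [norm_nonneg x]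
    have := hC (‖x‖ ^ 2 / δ ^ 2 - 1) ⟨by linarith, by linarith⟩
    rw [Real.norm_eq_abs] at this
    rw [axisCutRate, abs_mul, abs_of_pos (by positivity : 0 < 2 / δ ^ 2)]
    calc _ ≤ C * (2 / δ ^ 2) := by gcongr
      _ = _ := by ring

lemma deriv_cutoff_eq_zero {s : ℝ} (h : R + 1 < s) : deriv (cutoff R) s = 0 := by
  have : cutoff R =ᶠ[𝓝 s] fun _ => 0 := by
    filter_upwards [Ioi_mem_nhds h] with y hy
    exact cutoff_eq_zero (le_of_lt hy)
  rw [this.deriv_eq, deriv_const]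

lemma waveEnergy_eq_zero {t : ℝ} {x : Space n} (h : R + 1 ≤ t + ‖x‖) :
    waveEnergy p R m α ψ P g t x = 0 := by
  simp [waveEnergy, energyDensity, wIn_eq_zero h, wOut_eq_zero h]

lemma waveFluxDiv_eq_zero {t : ℝ} {x : Space n} (h : R + 1 < t + ‖x‖) :
    waveFluxDiv p q R m α ψ P g pg t x = 0 := by
  simp [waveFluxDiv, waveFluxGrad_eq_zero h.le, waveFluxRadial_eq_zero h.le, fluxGradRate,
    fluxRadialRate, wIn_eq_zero h.le, wOut_eq_zero h.le, wInU, wInW, wOutU, wOutW,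
    cutoff_eq_zero h.le, deriv_cutoff_eq_zero h]

lemma waveAxisFlux_eq_zero (hδ : 0 < δ) {t : ℝ} {x : Space n}
    (h : ‖x‖ < δ ∨ 2 * δ < ‖x‖) : waveAxisFlux p R m α δ ψ P g t x = 0 := by
  rw [waveAxisFlux]
  rcases h with h | h
  · rw [axisCutRate_eq_zero_of_lt hδ h, zero_mul]
  · rw [axisCutRate_eq_zero_of_gt hδ h, zero_mul]

lemma integrable_axisCut_mul_waveEnergy (hp : Continuous p) (hw : RegularWave α t₀ T ψ P g pg G)
    (ht₀ : 0 ≤ t₀) (hδ : 0 < δ) {t : ℝ} (ht : t ∈ Ioc t₀ T) :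
    Integrable fun x => axisCut δ x * waveEnergy p R m α ψ P g t x := by
  have h : ContinuousOn (fun x => waveEnergy p R m α ψ P g t x) {x | x ≠ 0} :=
    ContinuousOn.comp (g := fun z : ℝ × Space n => waveEnergy p R m α ψ P g z.1 z.2)
      (f := fun x => (t, x)) (continuousOn_waveEnergy hp hw ht₀) (by fun_prop)
      fun x hx => ⟨ht, hx⟩
  refine integrable_slice_of_shell (ρ := R + 1) hδ
    (contDiff_axisCut.continuous.continuousOn.mul h) (fun x hx => ?_) fun x hx => ?_
  · rw [axisCut_eq_zero hδ hx.le, zero_mul]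
  · rw [waveEnergy_eq_zero (by linarith [ht₀.trans_lt ht.1]), mul_zero]

/-- The pointwise energy inequality on `[s, t]`, in integrated form. -/
lemma waveEnergy_le_of_ne_zero (hp : ∀ s, HasDerivAt p (-q s) s) {γ : ℝ}
    (hq : ∀ s, q s = bracket s ^ (-γ)) (hp1 : ∀ s, 1 ≤ p s) (hpM : ∀ s, p s ≤ M)
    (hw : RegularWave α t₀ T ψ P g pg G) (hm : 1 ≤ m) (hα : 0 ≤ α)
    (ht₀ : 0 ≤ t₀) {s t : ℝ} (hs : s ∈ Ioo t₀ T) (hst : s ≤ t) (htT : t ≤ T)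
    {x : Space n} (hx0 : x ≠ 0)
    (hDx : IntegrableOn (fun τ => axisCut δ x * waveFluxDiv p q R m α ψ P g pg τ x
      + waveAxisFlux p R m α δ ψ P g τ x) (Ioc s t))
    (hNx : IntegrableOn (fun τ => sourceDensity γ M G τ x) (Ioc s t)) {e : ℝ} (he : 0 ≤ e)
    (hE : ∀ τ ∈ Ioc t₀ T, |waveAxisFlux p R m α δ ψ P g τ x| ≤ e) :
    axisCut δ x * waveEnergy p R m α ψ P g t x ≤ axisCut δ x * waveEnergy p R m α ψ P g s x
      + (∫ τ in Ioc s t, (axisCut δ x * waveFluxDiv p q R m α ψ P g pg τ x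
      + waveAxisFlux p R m α δ ψ P g τ x)) + T * e + ∫ τ in Ioc s t, sourceDensity γ M G τ x := by
  -- At fixed `x` the energy is integrated along the time line by the fundamental theorem for
  -- absolutely continuous functions; no divergence structure is used yet, and the flux terms stay
  -- on the right.
  have hqc : Continuous q := by
    rw [funext hq]
    exact (contDiff_bracket (k := 0)).continuous.rpow_const fun s => Or.inl (bracket_pos s).ne'
  have hsubI : Ioc s t ⊆ Ioc t₀ T := Ioc_subset_Ioc hs.1.le htT
  have hac := (absolutelyContinuous_waveEnergy (R := R) (m := m) hp hqc hw ht₀ hs x).mono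
    (c := s) (d := t) (by
      rw [uIcc_of_le hst, uIcc_of_le hs.2.le]; exact Icc_subset_Icc le_rfl htT)
  have hac' := hac.const_mul (axisCut δ x)
  have hfund := hac'.integral_deriv_eq_sub
  have hint := hac'.intervalIntegrable_deriv
  have hc : IntegrableOn (fun _ : ℝ => e) (Ioc s t) :=
    integrableOn_const (measure_Ioc_lt_top).ne
  have hrhs := (hDx.add hc).add hNx
  have hle : ∫ τ in s..t, deriv (fun t => axisCut δ x * waveEnergy p R m α ψ P g t x) τ
      ≤ ∫ τ in Ioc s t, ((axisCut δ x * waveFluxDiv p q R m α ψ P g pg τ x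
      + waveAxisFlux p R m α δ ψ P g τ x) + e + sourceDensity γ M G τ x) := by
    rw [intervalIntegral.integral_of_le hst]
    refine integral_mono_ae ((intervalIntegrable_iff_integrableOn_Ioc_of_le hst).1 hint) hrhs ?_
    -- The equation is available only in the open interval, so the possible end point `T` is
    -- discarded as a null set.
    have hT : ∀ᵐ τ : ℝ, τ ≠ T := by simp [ae_iff]
    filter_upwards [ae_restrict_of_ae (hw.equation x), ae_restrict_of_ae hT,
      ae_restrict_mem measurableSet_Ioc] with τ hτ hτT hτm
    have hτI : τ ∈ Ioo t₀ T :=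
      ⟨(hsubI hτm).1, lt_of_le_of_ne (hsubI hτm).2 hτT⟩
    have hd := (hasDerivAt_waveEnergy (R := R) (m := m) hp hw ht₀ hτI hx0 (hτ hτI)).const_mul
      (axisCut δ x)
    rw [hd.deriv]
    have hrate := energyRate_le (R := R) (P := P) (ψ := ψ) (g := g) (pg := pg) (G := G) hp hq hp1
      hpM hm hα (ht₀.trans_lt hτI.1) hx0
    have hk0 := axisCut_nonneg δ x
    have hk1 := axisCut_le_one δ x
    have hN : 0 ≤ sourceDensity γ M G τ x := sourceDensity_nonneg _ _ _ _ _
    have h1 := mul_le_mul_of_nonneg_left hrate hk0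
    have h2 := mul_le_of_le_one_left hN hk1
    -- The axis flux is not part of the energy rate. It is added to complete the divergence, and `e`
    -- compensates for it.
    have h3 := (neg_le_abs _).trans (hE τ (hsubI hτm))
    linarith
  have hDc := hDx.add hc
  simp only [Pi.add_def] at hDc
  rw [hfund, integral_add hDc hNx, integral_add hDx hc, setIntegral_const, smul_eq_mul] at hle
  have hvol : volume.real (Ioc s t) ≤ T := by
    rw [Real.volume_real_Ioc_of_le hst]
    linarith [ht₀.trans_lt hs.1]
  have := mul_le_mul_of_nonneg_right hvol he
  linarith

/-- The energy inequality on `[s, t]` with a cutoff at the axis. -/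
lemma integral_waveEnergy_le (hp : ∀ s, HasDerivAt p (-q s) s) {γ : ℝ}
    (hq : ∀ s, q s = bracket s ^ (-γ)) (hp1 : ∀ s, 1 ≤ p s) (hpM : ∀ s, p s ≤ M)
    (hw : RegularWave α t₀ T ψ P g pg G) (hn : (n : ℝ) = 2 * m + 1) (hm : 1 ≤ m) (hα : 0 ≤ α)
    (ht₀ : 0 ≤ t₀) (hδ : 0 < δ) {s t : ℝ} (hs : s ∈ Ioo t₀ T) (hst : s ≤ t) (htT : t ≤ T)
    (hG : Integrable (fun z : ℝ × Space n => sourceDensity γ M G z.1 z.2)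
      ((volume.restrict (Ioc t₀ T)).prod volume))
    {E : ℝ} (hE : ∀ τ ∈ Ioc t₀ T, ∀ x, |waveAxisFlux p R m α δ ψ P g τ x| ≤ E) :
    ∫ x, axisCut δ x * waveEnergy p R m α ψ P g t x
      ≤ (∫ x, axisCut δ x * waveEnergy p R m α ψ P g s x)
        + T * (volume (Metric.closedBall (0 : Space n) (2 * δ))).toReal * E
        + ∫ z, sourceDensity γ M G z.1 z.2 ∂((volume.restrict (Ioc t₀ T)).prod volume) := by
  have hqc : Continuous q := by
    rw [funext hq]
    exact (contDiff_bracket (k := 0)).continuous.rpow_const fun s => Or.inl (bracket_pos s).ne'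
  have hpc := contDiff_one_of_ghost hp hqc
  have hs0 : 0 < s := ht₀.trans_lt hs.1
  have hsubI : Ioc s t ⊆ Ioc t₀ T := Ioc_subset_Ioc hs.1.le htT
  have hsubI' : Icc s t ⊆ Ioc t₀ T := fun τ hτ => ⟨hs.1.trans_le hτ.1, hτ.2.trans htT⟩
  set ν := volume.restrict (Ioc s t)
  set D : ℝ × Space n → ℝ := fun z => axisCut δ z.2 * waveFluxDiv p q R m α ψ P g pg z.1 z.2
      + waveAxisFlux p R m α δ ψ P g z.1 z.2 with hD
  set e : ℝ → Space n → ℝ := fun t x => axisCut δ x * waveEnergy p R m α ψ P g t x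
  set N : ℝ × Space n → ℝ := fun z => sourceDensity γ M G z.1 z.2
  -- The error is charged only on the ball of radius `2 δ`, outside which the axis flux vanishes;
  -- its small volume is what makes the error disappear later.
  set Er : Space n → ℝ := (Metric.closedBall (0 : Space n) (2 * δ)).indicator fun _ => E
  have hE0 : 0 ≤ E := (abs_nonneg _).trans (hE s ⟨hs.1, hs.2.le⟩ 0)
  have hD0 : ∀ τ ∈ Ioc s t, ∀ x, ‖x‖ < δ → D (τ, x) = 0 := fun τ _ x hx => by
    simp [hD, axisCut_eq_zero hδ hx.le, waveAxisFlux_eq_zero hδ (Or.inl hx)]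
  have hDint : Integrable D (ν.prod volume) := by
    refine integrable_of_shell (ρ := max (2 * δ) (R + 1)) hδ
      ((continuousOn_waveFluxDiv hpc.continuous hqc hw ht₀).mono (prod_mono hsubI' subset_rfl)) hD0
      fun τ hτ x hx => ?_
    have h1 : R + 1 < τ + ‖x‖ := by linarith [hs0.trans hτ.1, (le_max_right _ _).trans_lt hx]
    simp [hD, waveFluxDiv_eq_zero h1, waveAxisFlux_eq_zero hδ (Or.inr ((le_max_left _ _).trans_lt hx))]
  have hNint : Integrable N (ν.prod volume) :=
    hG.mono_measure (Measure.prod_mono (Measure.restrict_mono hsubI le_rfl) le_rfl)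
  have hDx : Integrable fun x => ∫ τ, D (τ, x) ∂ν := hDint.integral_prod_right
  have hNx : Integrable fun x => ∫ τ, N (τ, x) ∂ν := hNint.integral_prod_right
  have heint : ∀ τ ∈ Ioc t₀ T, Integrable (e τ) := fun τ hτ =>
    integrable_axisCut_mul_waveEnergy hpc.continuous hw ht₀ hδ hτ
  have hEr : Integrable Er := (integrable_indicator_iff measurableSet_closedBall).2
    (integrableOn_const (hs := measure_closedBall_lt_top.ne))
  have hErI : ∫ x, Er x = (volume (Metric.closedBall (0 : Space n) (2 * δ))).toReal * E := by
    rw [integral_indicator measurableSet_closedBall, setIntegral_const, smul_eq_mul, Measure.real]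
  have hpt : ∀ᵐ x, e t x ≤ e s x + (∫ τ, D (τ, x) ∂ν) + T * Er x + ∫ τ, N (τ, x) ∂ν := by
    filter_upwards [hDint.prod_left_ae, hNint.prod_left_ae] with x hDx hNx
    have hN0 : 0 ≤ ∫ τ, N (τ, x) ∂ν := integral_nonneg fun τ => sourceDensity_nonneg _ _ _ _ _
    have hEr0 : 0 ≤ Er x := indicator_nonneg (fun _ _ => hE0) x
    have hT0 : 0 ≤ T := hs0.le.trans (hst.trans htT)
    by_cases hx : ‖x‖ < δ
    · have h1 : ∫ τ, D (τ, x) ∂ν = 0 := by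
        rw [← integral_zero ℝ ℝ (μ := ν)]
        exact setIntegral_congr_fun measurableSet_Ioc fun τ hτ => hD0 τ hτ x hx
      simp only [e, axisCut_eq_zero hδ hx.le, zero_mul, h1]
      positivity
    have hx0 : x ≠ 0 := by
      rintro rfl; simp at hx; linarith
    refine waveEnergy_le_of_ne_zero hp hq hp1 hpM hw hm hα ht₀ hs hst htT hx0 hDx hNx hEr0
      fun τ hτ => ?_
    by_cases hxb : x ∈ Metric.closedBall (0 : Space n) (2 * δ)
    · simp only [Er, indicator_of_mem hxb]
      exact hE τ hτ x
    · rw [waveAxisFlux_eq_zero hδ (Or.inr (by simpa using hxb)), abs_zero]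
      exact hEr0
  -- After exchanging the integrals, the total divergence vanishes at each fixed time.
  have hDzero : ∫ x, ∫ τ, D (τ, x) ∂ν = 0 := by
    rw [integral_integral_swap (f := fun x τ => D (τ, x)) hDint.swap]
    rw [← integral_zero ℝ ℝ (μ := ν)]
    refine setIntegral_congr_fun measurableSet_Ioc fun τ hτ => ?_
    exact integral_waveFluxDiv hp hqc hw hn hδ (hsubI hτ) (hs0.trans hτ.1)
  have hNle : ∫ x, ∫ τ, N (τ, x) ∂ν ≤
      ∫ z, N z ∂((volume.restrict (Ioc t₀ T)).prod volume) := by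
    rw [integral_integral_swap (f := fun x τ => N (τ, x)) hNint.swap, ← integral_prod _ hNint]
    exact integral_mono_measure (Measure.prod_mono (Measure.restrict_mono hsubI le_rfl) le_rfl)
      (Eventually.of_forall fun z => sourceDensity_nonneg _ _ _ _ _) hG
  have hes := heint s ⟨hs.1, hs.2.le⟩
  have het := heint t ⟨hs.1.trans_le hst, htT⟩
  have hfin := integral_mono_ae het (((hes.add hDx).add (hEr.const_mul T)).add hNx) hpt
  rw [integral_add' ((hes.add hDx).add (hEr.const_mul T)) hNx,
    integral_add' (hes.add hDx) (hEr.const_mul T), integral_add' hes hDx, hDzero,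
    integral_const_mul, hErI] at hfin
  linarith

end DampedWave

/-! ### Vanishing initial energy and removal of the two cutoffs. -/

namespace DampedWave

variable {n : ℕ} {p q : ℝ → ℝ} {R m α δ t₀ T M : ℝ} {ψ P G : ℝ → Space n → ℝ}
  {g pg : ℝ → Space n → Space n}

lemma waveEnergy_nonneg (hp1 : ∀ s, 1 ≤ p s) (hm : 1 ≤ m) (hα : 0 ≤ α) {t : ℝ} {x : Space n}
    (hx : x ≠ 0) : 0 ≤ waveEnergy p R m α ψ P g t x :=
  energyDensity_nonneg hm hα (norm_pos_iff.2 hx) (wIn_nonneg hp1 _ _) (wOut_nonneg hp1 _ _)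
    (inner_sq_le _ _)

lemma axisCut_mul_waveEnergy_nonneg (hp1 : ∀ s, 1 ≤ p s) (hm : 1 ≤ m) (hα : 0 ≤ α) (hδ : 0 < δ)
    (t : ℝ) (x : Space n) : 0 ≤ axisCut δ x * waveEnergy p R m α ψ P g t x := by
  by_cases hx : x = 0
  · rw [axisCut_eq_zero hδ (by simp [hx, hδ.le]), zero_mul]
  · exact mul_nonneg (axisCut_nonneg _ _) (waveEnergy_nonneg hp1 hm hα hx)

/-- Every term carries a factor that vanishes initially. For the potential term this must be `ψ / t`
rather than `ψ`, since `t₀` may be `0`. -/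
lemma tendsto_waveEnergy_initial (hp : Continuous p) (hw : RegularWave α t₀ T ψ P g pg G)
    (ht₀ : 0 ≤ t₀) (x : Space n) :
    Tendsto (fun s => waveEnergy p R m α ψ P g s x) (𝓝[>] t₀) (𝓝 0) := by
  have hid : Tendsto (fun s : ℝ => s) (𝓝[>] t₀) (𝓝 t₀) := nhdsWithin_le_nhds
  have hv := hw.tendsto_val x
  have hP := hw.tendsto_vel x
  have hg := hw.tendsto_grad x
  have hψ : Tendsto (fun s => ψ s x) (𝓝[>] t₀) (𝓝 0) := by
    have h := hv.mul hid
    rw [zero_mul] at h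
    refine h.congr' ?_
    filter_upwards [self_mem_nhdsWithin] with s hs
    exact div_mul_cancel₀ _ (ht₀.trans_lt hs).ne'
  have hxg : Tendsto (fun s => inner ℝ x (g s x)) (𝓝[>] t₀) (𝓝 0) := by
    simpa using (tendsto_const_nhds (x := x)).inner hg
  have hgg : Tendsto (fun s => ‖g s x‖ ^ 2) (𝓝[>] t₀) (𝓝 0) := by
    simpa using hg.norm.pow 2
  have hpair : Tendsto (fun s : ℝ => (s, ‖x‖)) (𝓝[>] t₀) (𝓝 (t₀, ‖x‖)) :=
    hid.prodMk_nhds tendsto_const_nhds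
  have ha := ((continuous_wIn (R := R) hp).tendsto (t₀, ‖x‖)).comp hpair
  have hh := ((continuous_wOut (R := R) hp).tendsto (t₀, ‖x‖)).comp hpair
  have key := (((ha.add hh).div_const 4).mul (((((hP.pow 2).add hgg).add
    (((hψ.const_mul (2 * m)).mul hxg).div_const (‖x‖ ^ 2))).add
    (((hψ.pow 2).const_mul (m ^ 2 + m * (m - 1))).div_const (‖x‖ ^ 2))).add
    ((hv.pow 2).const_mul α))).add
    ((((hh.sub ha).div_const (2 * ‖x‖)).mul hP).mul (hxg.add (hψ.const_mul m)))
  simp only [ne_eq, OfNat.ofNat_ne_zero, not_false_eq_true, zero_pow, mul_zero, zero_div,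
    add_zero] at key
  refine key.congr fun s => ?_
  simp only [waveEnergy, energyDensity, Function.comp_apply, div_pow]
  ring

/-- Dominated convergence for a fixed axis cutoff: the cutoffs in `‖x‖` and in `t + ‖x‖` confine the
energies to a bounded region away from the axis. -/
lemma tendsto_integral_waveEnergy_initial (hp : Continuous p) (hp1 : ∀ s, 1 ≤ p s)
    (hpM : ∀ s, p s ≤ M) (hw : RegularWave α t₀ T ψ P g pg G) (ht₀ : 0 ≤ t₀) (hT : t₀ < T)
    (hm : 1 ≤ m) (hα : 0 ≤ α) (hδ : 0 < δ) (hR : 0 ≤ R) :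
    Tendsto (fun s => ∫ x, axisCut δ x * waveEnergy p R m α ψ P g s x) (𝓝[>] t₀) (𝓝 0) := by
  obtain ⟨K, hK⟩ := hw.bound (R + 1)
  have hmem : ∀ᶠ s in 𝓝[>] t₀, s ∈ Ioo t₀ T := Ioo_mem_nhdsGT hT
  set L := (R + 2) * M
  set B := L * (2 * K + m * (K * T) / δ) ^ 2
        + L * (K ^ 2 + m * (m - 1) * (K * T) ^ 2 / δ ^ 2 + α * K ^ 2)
  rw [← integral_zero (Space n) ℝ (μ := volume)]
  refine tendsto_integral_filter_of_dominated_convergence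
    ((Metric.closedBall (0 : Space n) (R + 1)).indicator fun _ => B) ?_ ?_ ?_ ?_
  · filter_upwards [hmem] with s hs
    exact (integrable_axisCut_mul_waveEnergy hp hw ht₀ hδ ⟨hs.1, hs.2.le⟩).aestronglyMeasurable
  · filter_upwards [hmem] with s hs
    refine Eventually.of_forall fun x => ?_
    have hs0 : 0 < s := ht₀.trans_lt hs.1
    rw [Real.norm_of_nonneg (axisCut_mul_waveEnergy_nonneg hp1 hm hα hδ s x)]
    by_cases hx : x ∈ Metric.closedBall (0 : Space n) (R + 1)
    · rw [indicator_of_mem hx]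
      rw [mem_closedBall_zero_iff] at hx
      obtain ⟨h1, h2, h3⟩ := hK s ⟨hs.1, hs.2.le⟩ x hx
      have hM : 0 ≤ M := zero_le_one.trans ((hp1 0).trans (hpM 0))
      have hK0 : 0 ≤ K := (abs_nonneg _).trans h2
      by_cases hxδ : ‖x‖ ≤ δ
      · rw [axisCut_eq_zero hδ hxδ, zero_mul]
        have hT0 : 0 ≤ T := ht₀.trans hT.le
        have : 0 ≤ m - 1 := by linarith
        positivity
      · have hle := energyDensity_le (L := L) (K := K) (T := T) (a := wIn p R s ‖x‖)
          (h := wOut p R s ‖x‖) (xg := inner ℝ x (g s x)) (gg := ‖g s x‖ ^ 2)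
          hm hα hδ (not_le.1 hxδ).le hs0 hs.2.le
          (wIn_nonneg hp1 _ _) (wIn_le hp1 hpM hs0.le (norm_nonneg _) hR)
          (wOut_nonneg hp1 _ _) (wOut_le hp1 hpM hs0.le (norm_nonneg _) hR) h2 h1
          ((abs_real_inner_le_norm x (g s x)).trans (by gcongr)) (by gcongr)
        have hx0 : x ≠ 0 := norm_pos_iff.1 (hδ.trans (not_le.1 hxδ))
        exact (mul_le_of_le_one_left (waveEnergy_nonneg hp1 hm hα hx0) (axisCut_le_one δ x)).trans
          hle
    · rw [indicator_of_notMem hx]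
      rw [mem_closedBall_zero_iff, not_le] at hx
      rw [waveEnergy_eq_zero (by linarith), mul_zero]
  · exact (integrable_indicator_iff measurableSet_closedBall).2
      (integrableOn_const (hs := measure_closedBall_lt_top.ne))
  · refine Eventually.of_forall fun x => ?_
    simpa using (tendsto_waveEnergy_initial (R := R) (m := m) hp hw ht₀ x).const_mul (axisCut δ x)

/-- The dimension enters here: the axis contributes at most a constant times `δ ^ (-2) * δ ^ (-1) *
δ ^ 4 = δ`. The constant may depend on the wave and on `R`, because `δ` is sent to `0` first. -/
lemma exists_integral_waveEnergy_le (hp : ∀ s, HasDerivAt p (-q s) s) {γ : ℝ}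
    (hq : ∀ s, q s = bracket s ^ (-γ)) (hp1 : ∀ s, 1 ≤ p s) (hpM : ∀ s, p s ≤ M)
    (hw : RegularWave α t₀ T ψ P g pg G) (hn4 : 4 ≤ n) (hn : (n : ℝ) = 2 * m + 1) (hm : 1 ≤ m)
    (hα : 0 ≤ α) (ht₀ : 0 ≤ t₀) (hR : 0 ≤ R) {t : ℝ} (ht : t ∈ Ioc t₀ T)
    (hG : Integrable (fun z : ℝ × Space n => sourceDensity γ M G z.1 z.2)
      ((volume.restrict (Ioc t₀ T)).prod volume)) :
    ∃ C, ∀ δ > 0, 2 * δ ≤ 1 → ∫ x, axisCut δ x * waveEnergy p R m α ψ P g t x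
      ≤ C * δ + ∫ z, sourceDensity γ M G z.1 z.2 ∂((volume.restrict (Ioc t₀ T)).prod volume) := by
  obtain ⟨K, hK⟩ := hw.bound 1
  obtain ⟨B, hB0, hB⟩ := exists_axisCutRate_bound (n := n)
  have hM : 0 ≤ M := zero_le_one.trans ((hp1 0).trans (hpM 0))
  have hqc : Continuous q := by
    rw [funext hq]
    exact (contDiff_bracket (k := 0)).continuous.rpow_const fun s => Or.inl (bracket_pos s).ne'
  have hpc := contDiff_one_of_ghost hp hqc
  have hT : 0 < T := ht₀.trans_lt (ht.1.trans_le ht.2)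
  set L := (R + 2) * M
  set A := L * K ^ 2 * (2 + 2 * m * T + m * T ^ 2 + α)
  have hA : 0 ≤ A := by positivity
  set V := (volume (Metric.ball (0 : Space n) 1)).toReal
  refine ⟨T * (16 * V) * (B * A), fun δ hδ hδ1 => ?_⟩
  have hE : ∀ τ ∈ Ioc t₀ T, ∀ x, |waveAxisFlux p R m α δ ψ P g τ x| ≤ B / δ ^ 2 * (A / δ) := by
    intro τ hτ x
    by_cases hx : ‖x‖ < δ ∨ 2 * δ < ‖x‖
    · rw [waveAxisFlux_eq_zero hδ hx, abs_zero]; positivity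
    · push Not at hx
      have hτ0 : 0 < τ := ht₀.trans_lt hτ.1
      obtain ⟨h1, h2, h3⟩ := hK τ hτ x (hx.2.trans hδ1)
      have hK0 : 0 ≤ K := (abs_nonneg _).trans h2
      have hr := hδ.trans_le hx.1
      have := abs_flux_le (L := L) (K := K) (T := T) (a := wIn p R τ ‖x‖) (h := wOut p R τ ‖x‖)
        (xg := inner ℝ x (g τ x)) (gg := ‖g τ x‖ ^ 2) (by linarith : 0 ≤ m) hα hr
        (hx.2.trans hδ1) hτ0 hτ.2
        (wIn_nonneg hp1 _ _) (wIn_le hp1 hpM hτ0.le (norm_nonneg _) hR)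
        (wOut_nonneg hp1 _ _) (wOut_le hp1 hpM hτ0.le (norm_nonneg _) hR) h2 h1
        ((abs_real_inner_le_norm x (g τ x)).trans (by gcongr)) (by positivity) (by gcongr)
      rw [waveAxisFlux, abs_mul]
      exact mul_le_mul (hB δ hδ x) (this.trans (div_le_div_of_nonneg_left hA hδ hx.1))
        (abs_nonneg _) (by positivity)
  -- Since `2 δ ≤ 1` and `n ≥ 4`, the `n`-th power of the radius may be replaced by the fourth; `16`
  -- is `2 ^ 4`.
  have hvol : (volume (Metric.closedBall (0 : Space n) (2 * δ))).toReal ≤ 16 * V * δ ^ 4 := by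
    rw [Measure.addHaar_closedBall _ _ (by positivity), finrank_euclideanSpace_fin,
      ENNReal.toReal_mul, ENNReal.toReal_ofReal (by positivity)]
    have h1 : (2 * δ) ^ n ≤ (2 * δ) ^ 4 := pow_le_pow_of_le_one (by positivity) hδ1 hn4
    calc _ ≤ (2 * δ) ^ 4 * V := by gcongr
      _ = _ := by ring
  have hlim := tendsto_integral_waveEnergy_initial (R := R) (m := m) hpc.continuous hp1 hpM hw ht₀
    (ht.1.trans_le ht.2) hm hα hδ hR
  have hlim' := (hlim.add_const
    (T * (volume (Metric.closedBall (0 : Space n) (2 * δ))).toReal * (B / δ ^ 2 * (A / δ)))).add_const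
    (∫ z, sourceDensity γ M G z.1 z.2 ∂((volume.restrict (Ioc t₀ T)).prod volume))
  -- The initial time `s` decreases to `t₀`, which removes the initial energy.
  have hfin := ge_of_tendsto hlim' (b := ∫ x, axisCut δ x * waveEnergy p R m α ψ P g t x) (by
    filter_upwards [Ioo_mem_nhdsGT ht.1] with s hs
    exact integral_waveEnergy_le hp hq hp1 hpM hw hn hm hα ht₀ hδ ⟨hs.1, hs.2.trans_le ht.2⟩
      hs.2.le ht.2 hG hE)
  refine hfin.trans ?_
  rw [zero_add]
  refine add_le_add ?_ le_rfl
  calc _ ≤ T * (16 * V * δ ^ 4) * (B / δ ^ 2 * (A / δ)) := by gcongr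
    _ = _ := by field_simp

/-- The coercive quadratic form controlled by the weighted energy. -/
noncomputable def coerciveForm (m α : ℝ) (ψ P : ℝ → Space n → ℝ) (g : ℝ → Space n → Space n)
    (t : ℝ) (x : Space n) : ℝ :=
  P t x ^ 2 + ((inner ℝ x (g t x) + m * ψ t x) / ‖x‖) ^ 2
    + (‖g t x‖ ^ 2 - inner ℝ x (g t x) ^ 2 / ‖x‖ ^ 2) + m * (m - 1) * (ψ t x / ‖x‖) ^ 2
    + α * (ψ t x / t) ^ 2

lemma cutoff_mul_coerciveForm_le (hp1 : ∀ s, 1 ≤ p s) (hm : 1 ≤ m) (hα : 0 ≤ α) {t : ℝ}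
    (ht : 0 ≤ t) {x : Space n} (hx : x ≠ 0) :
    bracket (t - ‖x‖) * cutoff R (t + ‖x‖) / 2 * coerciveForm m α ψ P g t x
      ≤ waveEnergy p R m α ψ P g t x :=
  energyDensity_ge hm hα (norm_pos_iff.2 hx) (le_wIn hp1 _ _) (le_wOut hp1 ht (norm_nonneg _))
    (inner_sq_le _ _)

/-- The weighted energy estimate for spatially regular waves. -/
theorem lintegral_coerciveForm_le (hp : ∀ s, HasDerivAt p (-q s) s) {γ : ℝ}
    (hq : ∀ s, q s = bracket s ^ (-γ)) (hp1 : ∀ s, 1 ≤ p s) (hpM : ∀ s, p s ≤ M)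
    (hw : RegularWave α t₀ T ψ P g pg G) (hn4 : 4 ≤ n) (hn : (n : ℝ) = 2 * m + 1) (hm : 1 ≤ m)
    (hα : 0 ≤ α) (ht₀ : 0 ≤ t₀) {t : ℝ} (ht : t ∈ Ioc t₀ T)
    (hG : Integrable (fun z : ℝ × Space n => sourceDensity γ M G z.1 z.2)
      ((volume.restrict (Ioc t₀ T)).prod volume)) :
    ∫⁻ x, ENNReal.ofReal (bracket (t - ‖x‖) / 2 * coerciveForm m α ψ P g t x) ≤
      ENNReal.ofReal
        (∫ z, sourceDensity γ M G z.1 z.2 ∂((volume.restrict (Ioc t₀ T)).prod volume)) := by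
  have hqc : Continuous q := by
    rw [funext hq]
    exact (contDiff_bracket (k := 0)).continuous.rpow_const fun s => Or.inl (bracket_pos s).ne'
  have hpc := (contDiff_one_of_ghost hp hqc).continuous
  set S := ∫ z, sourceDensity γ M G z.1 z.2 ∂((volume.restrict (Ioc t₀ T)).prod volume)
  have ht0 : 0 ≤ t := ht₀.trans ht.1.le
  -- Positive dimension makes the axis a null set.
  have : Nontrivial (Space n) := by
    have : Nonempty (Fin n) := ⟨⟨0, by omega⟩⟩
    infer_instance
  have hne : ∀ᵐ x : Space n, x ≠ 0 := by simp [ae_iff]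
  -- First limit, with the cutoff in `t + ‖x‖` at level `k` fixed: the axis cutoffs `axisCut (d j)`
  -- tend to `1` off the axis, and Fatou's lemma applies. The shift by `2` in `d` ensures `2 * d j ≤
  -- 1`.
  have hcut : ∀ k : ℕ, ∫⁻ x, ENNReal.ofReal (waveEnergy p k m α ψ P g t x) ≤ ENNReal.ofReal S := by
    intro k
    obtain ⟨C, hC⟩ := exists_integral_waveEnergy_le (R := (k : ℝ)) hp hq hp1 hpM hw hn4 hn hm hα ht₀
      (by positivity) ht hG
    set d : ℕ → ℝ := fun j => 1 / ((j : ℝ) + 2)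
    have hd : ∀ j, 0 < d j := fun j => by positivity
    have hd1 : ∀ j, 2 * d j ≤ 1 := fun j => by
      simp only [d]
      rw [mul_one_div, div_le_one (by positivity)]
      linarith [(Nat.cast_nonneg j : (0 : ℝ) ≤ j)]
    have hd0 : Tendsto d atTop (𝓝 0) := by
      have := (tendsto_const_div_atTop_nhds_zero_nat (1 : ℝ)).comp (tendsto_add_atTop_nat 2)
      refine this.congr fun j => ?_
      simp [d]
    have hle : ∀ j, ∫⁻ x, ENNReal.ofReal (axisCut (d j) x * waveEnergy p k m α ψ P g t x)
        ≤ ENNReal.ofReal (C * d j + S) := fun j => by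
      rw [← ofReal_integral_eq_lintegral_ofReal
        (integrable_axisCut_mul_waveEnergy hpc hw ht₀ (hd j) ht)
        (Eventually.of_forall fun x => axisCut_mul_waveEnergy_nonneg hp1 hm hα (hd j) t x)]
      exact ENNReal.ofReal_le_ofReal (hC _ (hd j) (hd1 j))
    have hlim : Tendsto (fun j => ENNReal.ofReal (C * d j + S)) atTop (𝓝 (ENNReal.ofReal S)) := by
      refine ENNReal.tendsto_ofReal ?_
      simpa using (hd0.const_mul C).add_const S
    have hpt : ∀ᵐ x : Space n, ENNReal.ofReal (waveEnergy p k m α ψ P g t x) ≤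
        liminf (fun j => ENNReal.ofReal (axisCut (d j) x * waveEnergy p k m α ψ P g t x)) atTop := by
      filter_upwards [hne] with x hx
      refine le_of_eq (Tendsto.liminf_eq ?_).symm
      refine tendsto_const_nhds.congr' ?_
      have h2 : Tendsto (fun j => 2 * d j) atTop (𝓝 0) := by simpa using hd0.const_mul 2
      filter_upwards [h2.eventually_le_const (norm_pos_iff.2 hx)] with j hj
      rw [axisCut_eq_one (hd j) hj, one_mul]
    calc _ ≤ ∫⁻ x, liminf
          (fun j => ENNReal.ofReal (axisCut (d j) x * waveEnergy p k m α ψ P g t x)) atTop :=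
          lintegral_mono_ae hpt
      _ ≤ liminf (fun j => ∫⁻ x, ENNReal.ofReal (axisCut (d j) x * waveEnergy p k m α ψ P g t x))
          atTop := lintegral_liminf_le' fun j =>
            (integrable_axisCut_mul_waveEnergy hpc hw ht₀ (hd j) ht).aestronglyMeasurable.aemeasurable.ennreal_ofReal
      _ ≤ liminf (fun j => ENNReal.ofReal (C * d j + S)) atTop :=
          liminf_le_liminf (Eventually.of_forall hle)
      _ = _ := hlim.liminf_eq
  have hmeas : Measurable fun x : Space n => coerciveForm m α ψ P g t x := by
    have h1 := (hw.contDiff_val t ht).continuous.measurable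
    have h2 := (hw.contDiff_vel t ht).continuous.measurable
    have h3 := (hw.contDiff_grad t ht).continuous.measurable
    unfold coerciveForm
    fun_prop
  have hb : Continuous bracket := (contDiff_bracket (k := 1)).continuous
  -- Second limit: at each point the cutoff in `t + ‖x‖` is eventually `1`, and the bound does not
  -- depend on `k`, so Fatou's lemma applies again.
  have hpt : ∀ x : Space n,
      ENNReal.ofReal (bracket (t - ‖x‖) / 2 * coerciveForm m α ψ P g t x) =
      liminf (fun k : ℕ => ENNReal.ofReal
        (bracket (t - ‖x‖) * cutoff k (t + ‖x‖) / 2 * coerciveForm m α ψ P g t x)) atTop := by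
    intro x
    refine (Tendsto.liminf_eq (tendsto_const_nhds.congr' ?_)).symm
    filter_upwards [tendsto_natCast_atTop_atTop.eventually_ge_atTop (t + ‖x‖)] with k hk
    rw [cutoff_eq_one hk, mul_one]
  calc _ = ∫⁻ x, liminf (fun k : ℕ => ENNReal.ofReal
        (bracket (t - ‖x‖) * cutoff k (t + ‖x‖) / 2 * coerciveForm m α ψ P g t x)) atTop :=
        lintegral_congr hpt
    _ ≤ liminf (fun k : ℕ => ∫⁻ x, ENNReal.ofReal
        (bracket (t - ‖x‖) * cutoff k (t + ‖x‖) / 2 * coerciveForm m α ψ P g t x)) atTop := by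
        refine lintegral_liminf_le fun k => Measurable.ennreal_ofReal ?_
        have hc : Continuous (cutoff (k : ℝ)) := contDiff_cutoff.continuous
        exact (by fun_prop : Measurable fun x : Space n =>
          bracket (t - ‖x‖) * cutoff k (t + ‖x‖) / 2).mul hmeas
    _ ≤ ENNReal.ofReal S := by
        refine liminf_le_of_le (by isBoundedDefault) fun b hb => ?_
        obtain ⟨k, hk⟩ := hb.exists
        refine hk.trans ((lintegral_mono_ae ?_).trans (hcut k))
        filter_upwards [hne] with x hx
        exact ENNReal.ofReal_le_ofReal (cutoff_mul_coerciveForm_le hp1 hm hα ht0 hx)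

end DampedWave

/-! ### Mollification in space: regularity, time dependence, weak gradients. -/

namespace DampedWave

variable {n : ℕ} {V : Type*} [NormedAddCommGroup V] [NormedSpace ℝ V]

/-- Convolution of a function on `ℝⁿ` with a kernel. -/
noncomputable def mollify (w : Space n → ℝ) (ζ : Space n → V) (x : Space n) : V :=
  ∫ y, w y • ζ (x - y)

lemma mollify_eq_convolution (w : Space n → ℝ) (ζ : Space n → V) :
    mollify w ζ = convolution w ζ (ContinuousLinearMap.lsmul ℝ ℝ) volume := rfl

lemma locallyIntegrable_of_memLp_ball {E : Type*} [NormedAddCommGroup E] {w : Space n → E}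
    (hw : ∀ R : ℝ, MemLp w 2 (volume.restrict (Metric.ball 0 R))) : LocallyIntegrable w := by
  intro x
  refine ⟨Metric.ball 0 (‖x‖ + 1), Metric.isOpen_ball.mem_nhds (by simp), ?_⟩
  have : IsFiniteMeasure (volume.restrict (Metric.ball (0 : Space n) (‖x‖ + 1))) :=
    ⟨by simpa using measure_ball_lt_top⟩
  exact (hw _).integrable one_le_two

lemma integrable_mollify {w : Space n → ℝ} {ζ : Space n → V} (hw : LocallyIntegrable w)
    (hζ : Continuous ζ) (hc : HasCompactSupport ζ) (x : Space n) :
    Integrable fun y => w y • ζ (x - y) :=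
  hc.convolutionExists_right (ContinuousLinearMap.lsmul ℝ ℝ) hw hζ x

lemma hasFDerivAt_mollify {w : Space n → ℝ} {ζ : Space n → V} (hw : LocallyIntegrable w)
    (hζ : ContDiff ℝ 1 ζ) (hc : HasCompactSupport ζ) (x : Space n) :
    HasFDerivAt (mollify w ζ) (mollify w (fderiv ℝ ζ) x) x := by
  have h := hc.hasFDerivAt_convolution_right (ContinuousLinearMap.lsmul ℝ ℝ) hw hζ x
  rw [← mollify_eq_convolution] at h
  refine h.congr_fderiv ?_
  rw [mollify, convolution_def]
  refine integral_congr_ae (Eventually.of_forall fun y => ?_)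
  ext v
  simp [ContinuousLinearMap.precompR_apply]

lemma contDiff_mollify {w : Space n → ℝ} {ζ : Space n → V} {k : ℕ∞} (hw : LocallyIntegrable w)
    (hζ : ContDiff ℝ k ζ) (hc : HasCompactSupport ζ) : ContDiff ℝ k (mollify w ζ) :=
  hc.contDiff_convolution_right (ContinuousLinearMap.lsmul ℝ ℝ) hw hζ

lemma mollify_sub {w w' : Space n → ℝ} {ζ : Space n → V} (hw : LocallyIntegrable w)
    (hw' : LocallyIntegrable w') (hζ : Continuous ζ) (hc : HasCompactSupport ζ) (x : Space n) :
    mollify (w - w') ζ x = mollify w ζ x - mollify w' ζ x := by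
  rw [mollify, mollify, mollify,
    ← integral_sub (integrable_mollify hw hζ hc x) (integrable_mollify hw' hζ hc x)]
  simp [sub_smul]

lemma mollify_smul (c : ℝ) (w : Space n → ℝ) (ζ : Space n → V) (x : Space n) :
    mollify (c • w) ζ x = c • mollify w ζ x := by
  rw [mollify, mollify, ← integral_smul]
  simp [smul_smul]

/-- Mollification is bounded from `L²` of a ball to `L∞` of a smaller ball. -/
lemma exists_enorm_mollify_le {ζ : Space n → V} (hζ : Continuous ζ)
    (hs : ∀ z, 1 ≤ ‖z‖ → ζ z = 0) (R : ℝ) : ∃ C : ℝ≥0∞, C ≠ ⊤ ∧ ∀ w : Space n → ℝ,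
      AEStronglyMeasurable w (volume.restrict (Metric.ball 0 R)) → ∀ x, ‖x‖ + 1 ≤ R →
        ‖mollify w ζ x‖ₑ ≤ C * eLpNorm w 2 (volume.restrict (Metric.ball 0 R)) := by
  have hc : HasCompactSupport ζ := hasCompactSupport_of_eq_zero 1 hs
  obtain ⟨B, hB⟩ := hc.exists_bound_of_continuous hζ
  set v := volume (Metric.ball (0 : Space n) R)
  refine ⟨ENNReal.ofReal B * v ^ ((1 : ℝ) - 1 / 2), ENNReal.mul_ne_top ENNReal.ofReal_ne_top
    (ENNReal.rpow_ne_top_of_nonneg (by norm_num) measure_ball_lt_top.ne), fun w hw x hx => ?_⟩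
  have h1 : ‖mollify w ζ x‖ₑ ≤ ∫⁻ y in Metric.ball 0 R, ENNReal.ofReal B * ‖w y‖ₑ := by
    rw [← lintegral_indicator measurableSet_ball]
    refine (enorm_integral_le_lintegral_enorm _).trans (lintegral_mono fun y => ?_)
    by_cases hy : y ∈ Metric.ball (0 : Space n) R
    · rw [indicator_of_mem hy, enorm_smul, mul_comm]
      gcongr
      rw [← ofReal_norm]
      exact ENNReal.ofReal_le_ofReal (hB _)
    · rw [hs (x - y), smul_zero, enorm_zero]
      · exact zero_le
      · rw [mem_ball_zero_iff, not_lt] at hy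
        have := norm_sub_norm_le y x
        rw [norm_sub_rev] at this
        linarith
  rw [lintegral_const_mul' _ _ ENNReal.ofReal_ne_top] at h1
  -- Hölder's inequality on a ball of finite measure passes from `L¹` to `L²`.
  have h2 := eLpNorm_le_eLpNorm_mul_rpow_measure_univ (p := 1) (q := 2) one_le_two hw
  rw [eLpNorm_one_eq_lintegral_enorm, Measure.restrict_apply_univ] at h2
  calc _ ≤ ENNReal.ofReal B * (eLpNorm w 2 (volume.restrict (Metric.ball 0 R)) *
        v ^ ((1 : ℝ) - 1 / 2)) := by
        refine h1.trans ?_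
        gcongr
        simpa using h2
    _ = _ := by ring

section Time

variable {I : Set ℝ} {w w' : ℝ → Space n → ℝ} {ζ : Space n → V}

lemma _root_.ContinuousOnL2Loc.locallyIntegrable {E : Type*} [NormedAddCommGroup E]
    {w : ℝ → Space n → E} (hw : ContinuousOnL2Loc I w) {t : ℝ} (ht : t ∈ I) :
    LocallyIntegrable (w t) := locallyIntegrable_of_memLp_ball (hw.memLp t ht)

/-- Convergence in `L²` of balls becomes locally uniform after mollification, which gives joint
continuity in time and space. -/
lemma continuousOn_mollify (hw : ContinuousOnL2Loc I w) (hζ : Continuous ζ)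
    (hs : ∀ z, 1 ≤ ‖z‖ → ζ z = 0) :
    ContinuousOn (fun z : ℝ × Space n => mollify (w z.1) ζ z.2) (I ×ˢ univ) := by
  have hc : HasCompactSupport ζ := hasCompactSupport_of_eq_zero 1 hs
  rintro ⟨s, x⟩ ⟨hsI, -⟩
  -- One unit of the radius allows the space variable to move near `x`, the other is the support
  -- radius of the kernel.
  obtain ⟨C, hC, hb⟩ := exists_enorm_mollify_le hζ hs (‖x‖ + 2)
  have hcont : Continuous (mollify (w s) ζ) :=
    (contDiff_mollify (k := 0) (hw.locallyIntegrable hsI) (contDiff_zero.2 hζ) hc).continuous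
  have h1 : Tendsto (fun t => C * eLpNorm (w t - w s) 2 (volume.restrict (Metric.ball 0 (‖x‖ + 2))))
      (𝓝[I] s) (𝓝 0) := by
    simpa using ENNReal.Tendsto.const_mul (hw.tendsto s hsI (‖x‖ + 2)) (Or.inr hC)
  have hfst : Tendsto (fun z : ℝ × Space n => z.1) (𝓝[I ×ˢ univ] (s, x)) (𝓝[I] s) :=
    tendsto_nhdsWithin_iff.2 ⟨continuous_fst.continuousAt.tendsto.mono_left nhdsWithin_le_nhds,
      eventually_nhdsWithin_of_forall fun z hz => hz.1⟩
  have hsnd : Tendsto (fun z : ℝ × Space n => z.2) (𝓝[I ×ˢ univ] (s, x)) (𝓝 x) :=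
    continuous_snd.continuousAt.tendsto.mono_left nhdsWithin_le_nhds
  have h2 : Tendsto (fun z : ℝ × Space n => mollify (w z.1) ζ z.2 - mollify (w s) ζ z.2)
      (𝓝[I ×ˢ univ] (s, x)) (𝓝 0) := by
    rw [tendsto_zero_iff_enorm_tendsto_zero]
    refine tendsto_of_tendsto_of_tendsto_of_le_of_le' tendsto_const_nhds (h1.comp hfst)
      (Eventually.of_forall fun _ => zero_le) ?_
    have hx : ∀ᶠ z in 𝓝[I ×ˢ univ] (s, x), ‖z.2‖ < ‖x‖ + 1 :=
      (hsnd.norm).eventually_lt_const (by linarith)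
    filter_upwards [hx, self_mem_nhdsWithin] with z hz hzI
    rw [← mollify_sub (hw.locallyIntegrable hzI.1) (hw.locallyIntegrable hsI) hζ hc]
    exact hb _ ((hw.memLp _ hzI.1 _).aestronglyMeasurable.sub
      (hw.memLp _ hsI _).aestronglyMeasurable) _ (by linarith)
  have h3 := h2.add ((hcont.tendsto x).comp hsnd)
  rw [zero_add] at h3
  refine h3.congr fun z => ?_
  simp

/-- The error of the difference quotient commutes with mollification, so its `L²` smallness on a
ball becomes pointwise smallness. -/
lemma hasDerivWithinAt_mollify (hw : ContinuousOnL2Loc I w) (hw' : ContinuousOnL2Loc I w')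
    (hd : HasTimeDerivL2Loc I w w') (hζ : Continuous ζ) (hs : ∀ z, 1 ≤ ‖z‖ → ζ z = 0)
    {s : ℝ} (hsI : s ∈ I) (x : Space n) :
    HasDerivWithinAt (fun t => mollify (w t) ζ x) (mollify (w' s) ζ x) I s := by
  have hc : HasCompactSupport ζ := hasCompactSupport_of_eq_zero 1 hs
  obtain ⟨C, hC, hb⟩ := exists_enorm_mollify_le hζ hs (‖x‖ + 1)
  rw [hasDerivWithinAt_iff_tendsto_slope, ← tendsto_sub_nhds_zero_iff,
    tendsto_zero_iff_enorm_tendsto_zero]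
  have h1 : Tendsto (fun t => C * eLpNorm ((t - s)⁻¹ • (w t - w s) - w' s) 2
      (volume.restrict (Metric.ball 0 (‖x‖ + 1)))) (𝓝[I \ {s}] s) (𝓝 0) := by
    simpa using ENNReal.Tendsto.const_mul (hd s hsI (‖x‖ + 1)) (Or.inr hC)
  refine tendsto_of_tendsto_of_tendsto_of_le_of_le' tendsto_const_nhds h1
    (Eventually.of_forall fun _ => zero_le) ?_
  filter_upwards [self_mem_nhdsWithin] with t ht
  have ht' := hw.locallyIntegrable ht.1
  have hs' := hw.locallyIntegrable hsI
  have e : slope (fun t => mollify (w t) ζ x) s t - mollify (w' s) ζ x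
      = mollify ((t - s)⁻¹ • (w t - w s) - w' s) ζ x := by
    rw [mollify_sub ((ht'.sub hs').smul _) (hw'.locallyIntegrable hsI) hζ hc, mollify_smul,
      mollify_sub ht' hs' hζ hc, slope_def_module]
  rw [e]
  exact hb _ ((((hw.memLp _ ht.1 _).aestronglyMeasurable.sub
    (hw.memLp _ hsI _).aestronglyMeasurable).const_smul _).sub
    (hw'.memLp _ hsI _).aestronglyMeasurable) _ le_rfl

end Time

section Gradient

variable {ρ : Space n → ℝ} {w : Space n → ℝ}

lemma inner_gradient (ρ : Space n → ℝ) (z v : Space n) :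
    inner ℝ (gradient ρ z) v = fderiv ℝ ρ z v := by
  rw [gradient, InnerProductSpace.toDual_symm_apply]

lemma contDiff_gradient (hρ : ContDiff ℝ ∞ ρ) : ContDiff ℝ ∞ (gradient ρ) :=
  ((InnerProductSpace.toDual ℝ (Space n)).symm.toContinuousLinearEquiv.contDiff).comp
    (hρ.fderiv_right (m := ∞) (by simp))

lemma fderiv_eq_zero_of_norm_gt {f : Space n → V} {a : ℝ} (hs : ∀ z, a < ‖z‖ → f z = 0)
    {z : Space n} (hz : a < ‖z‖) : fderiv ℝ f z = 0 := by
  have : f =ᶠ[𝓝 z] fun _ => 0 := by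
    filter_upwards [(isOpen_lt continuous_const continuous_norm).mem_nhds hz] with y hy
    exact hs y hy
  rw [this.fderiv_eq, fderiv_const_apply]

lemma gradient_eq_zero_of_norm_gt {a : ℝ} (hs : ∀ z, a < ‖z‖ → ρ z = 0) {z : Space n}
    (hz : a < ‖z‖) : gradient ρ z = 0 := by
  rw [gradient, fderiv_eq_zero_of_norm_gt hs hz, map_zero]

lemma inner_mollify_gradient (hw : LocallyIntegrable w) (hρ : ContDiff ℝ ∞ ρ)
    (hc : HasCompactSupport ρ) (x v : Space n) :
    fderiv ℝ (mollify w ρ) x v = inner ℝ (mollify w (gradient ρ) x) v := by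
  have h1 : ContDiff ℝ 1 ρ := hρ.of_le (by simp)
  have hgc : HasCompactSupport (gradient ρ) :=
    (hc.fderiv (𝕜 := ℝ)).comp_left (g := (InnerProductSpace.toDual ℝ (Space n)).symm) (by simp)
  rw [(hasFDerivAt_mollify hw h1 hc x).fderiv, mollify, mollify, real_inner_comm,
    ← integral_inner (integrable_mollify hw (contDiff_gradient hρ).continuous hgc x),
    ContinuousLinearMap.integral_apply (integrable_mollify hw
      (h1.continuous_fderiv one_ne_zero) (hc.fderiv (𝕜 := ℝ)) x)]
  refine integral_congr_ae (Eventually.of_forall fun y => ?_)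
  simp only [_root_.smul_apply, ← inner_gradient, inner_smul_right, smul_eq_mul]
  rw [real_inner_comm]

/-- Symmetry of second derivatives, transported through the identification of a covector with its
gradient. -/
lemma inner_fderiv_symm {Φ : Space n → ℝ} {g : Space n → Space n} (hΦ : ContDiff ℝ 2 Φ)
    (hg : ContDiff ℝ 1 g) (h : ∀ x v, fderiv ℝ Φ x v = inner ℝ (g x) v) (x v u : Space n) :
    inner ℝ (fderiv ℝ g x v) u = inner ℝ v (fderiv ℝ g x u) := by
  have hsymm : IsSymmSndFDerivAt ℝ Φ x := hΦ.contDiffAt.isSymmSndFDerivAt (by simp)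
  have e : fderiv ℝ Φ = fun x => innerSL ℝ (g x) := by
    ext x v; simpa using h x v
  have hd : ∀ v u, fderiv ℝ (fderiv ℝ Φ) x v u = inner ℝ (fderiv ℝ g x v) u := fun v u => by
    rw [e]
    have := ((innerSL ℝ (E := Space n)).hasFDerivAt (x := g x)).comp x
      ((hg.differentiable one_ne_zero x).hasFDerivAt)
    have h2 := this.fderiv
    simp only [Function.comp_def] at h2
    rw [h2]
    rfl
  rw [← hd, hsymm.eq, hd, real_inner_comm]

/-- The mollified weak gradient is the gradient of the mollified function. -/
lemma integral_smul_weakGradient {f : Space n → ℝ} {g : Space n → Space n}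
    (h : HasWeakGradient f g) (hρ : ContDiff ℝ ∞ ρ) (hc : HasCompactSupport ρ) (x : Space n) :
    ∫ y, ρ (x - y) • g y = mollify f (gradient ρ) x := by
  have hgc : HasCompactSupport (gradient ρ) :=
    (hc.fderiv (𝕜 := ℝ)).comp_left (g := (InnerProductSpace.toDual ℝ (Space n)).symm) (by simp)
  have hi : Integrable fun y => ρ (x - y) • g y := by
    have := hc.convolutionExists_left (ContinuousLinearMap.lsmul ℝ ℝ) hρ.continuous
      h.locallyIntegrable_grad x
    have := this.comp_sub_left x
    refine this.congr (Eventually.of_forall fun y => ?_)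
    simp
  refine ext_inner_left ℝ fun v => ?_
  rw [mollify, ← integral_inner hi, ← integral_inner (integrable_mollify h.locallyIntegrable
    (contDiff_gradient hρ).continuous hgc x)]
  have hcomp : ContDiff ℝ ∞ fun y => ρ (x - y) := hρ.comp (contDiff_const.sub contDiff_id)
  have hcs : HasCompactSupport fun y => ρ (x - y) := hc.comp_homeomorph (Homeomorph.subLeft x)
  have key := h.integral_eq _ hcomp hcs v
  have hd : ∀ y, fderiv ℝ (fun y => ρ (x - y)) y v = -inner ℝ v (gradient ρ (x - y)) := fun y => by
    have := ((hρ.differentiable (by simp) (x - y)).hasFDerivAt).comp y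
      ((hasFDerivAt_id y).const_sub x)
    rw [show (fun y => ρ (x - y)) = ρ ∘ fun y => x - y from rfl, this.fderiv, real_inner_comm,
      inner_gradient]
    simp
  simp only [hd, mul_neg, integral_neg, neg_inj] at key
  simp only [inner_smul_right]
  rw [key]
  refine integral_congr_ae (Eventually.of_forall fun y => ?_)
  simp only
  rw [real_inner_comm, mul_comm]

end Gradient

/-- The mollifiers: smooth, nonnegative, of integral one, supported in a ball of radius `ε`. -/
structure IsMollifier (ε : ℝ) (ρ : Space n → ℝ) : Prop where
  contDiff : ContDiff ℝ ∞ ρ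
  nonneg : ∀ x, 0 ≤ ρ x
  integral_eq : ∫ x, ρ x = 1
  eq_zero : ∀ x, ε < ‖x‖ → ρ x = 0

lemma IsMollifier.hasCompactSupport {ε : ℝ} {ρ : Space n → ℝ} (h : IsMollifier ε ρ) :
    HasCompactSupport ρ :=
  hasCompactSupport_of_eq_zero (ε + 1) fun x hx => h.eq_zero x (by linarith)

/-- Normalized bumps with shrinking supports. The ratio of outer to inner radius is kept equal to
`2`; such a bound gives almost everywhere convergence for locally integrable functions by Lebesgue
differentiation. The outer radius never exceeds `1 / 2`. -/
lemma exists_mollifier : ∃ ρ : ℕ → Space n → ℝ, (∀ k, IsMollifier (1 / 2) (ρ k)) ∧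
    ∀ {E : Type} [NormedAddCommGroup E] [NormedSpace ℝ E] [CompleteSpace E] (f : Space n → E),
      LocallyIntegrable f →
      ∀ᵐ x, Tendsto (fun k => ∫ y, ρ k (x - y) • f y) atTop (𝓝 (f x)) := by
  let b : ℕ → ContDiffBump (0 : Space n) := fun k =>
    ⟨1 / (4 * ((k : ℝ) + 1)), 1 / (2 * ((k : ℝ) + 1)), by positivity, by
      apply one_div_lt_one_div_of_lt (by positivity)
      have : (0 : ℝ) < (k : ℝ) + 1 := by positivity
      linarith⟩
  refine ⟨fun k => (b k).normed volume, fun k => ⟨(b k).contDiff_normed, (b k).nonneg_normed,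
    (b k).integral_normed, fun x hx => ?_⟩, ?_⟩
  · have h1 : (b k).rOut ≤ 1 / 2 := by
      apply one_div_le_one_div_of_le (by norm_num)
      linarith [(Nat.cast_nonneg k : (0 : ℝ) ≤ k)]
    have : x ∉ Function.support ((b k).normed volume) := by
      rw [(b k).support_normed_eq, mem_ball_zero_iff]
      linarith
    simpa using this
  · intro E _ _ _ f hf
    have hlim : Tendsto (fun k => (b k).rOut) atTop (𝓝 0) := by
      have := ((tendsto_one_div_add_atTop_nhds_zero_nat (𝕜 := ℝ)).const_mul (1 / 2))
      rw [mul_zero] at this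
      refine this.congr fun k => ?_
      simp [b, mul_comm]
    have := ContDiffBump.ae_convolution_tendsto_right_of_locallyIntegrable (K := 2) (μ := volume)
      hlim (Eventually.of_forall fun k => by
        simp only [b]
        apply le_of_eq
        field_simp
        norm_num) hf
    filter_upwards [this] with x hx
    refine hx.congr fun k => ?_
    rw [convolution_def, ← integral_sub_left_eq_self _ volume x]
    simp

end DampedWave

/-! ### Weak derivatives in one variable. -/

namespace DampedWave

lemma intervalIntegral_eq_integral_of_tsupport {f : ℝ → ℝ} {a b : ℝ} (hab : a ≤ b)
    (hf : ∀ t, t ∉ Ioo a b → f t = 0) : ∫ t in a..b, f t = ∫ t, f t := by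
  rw [intervalIntegral.integral_of_le hab]
  exact setIntegral_eq_integral_of_forall_compl_eq_zero fun t ht => hf t fun h =>
    ht (Ioo_subset_Ioc_self h)

/-- The fundamental lemma of du Bois-Reymond on an interval. -/
lemma exists_eq_const_of_integral_deriv_mul {z : ℝ → ℝ} {a b : ℝ} (hab : a < b)
    (hz : ContinuousOn z (Icc a b))
    (h : ∀ θ : ℝ → ℝ, ContDiff ℝ ∞ θ → HasCompactSupport θ → tsupport θ ⊆ Ioo a b →
      ∫ t in a..b, deriv θ t * z t = 0) : ∃ c, ∀ t ∈ Icc a b, z t = c := by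
  let bump : ContDiffBump ((a + b) / 2) := ⟨(b - a) / 8, (b - a) / 4, by linarith, by linarith⟩
  set θ₀ := bump.normed volume
  have hθ₀ : ContDiff ℝ ∞ θ₀ := bump.contDiff_normed
  have hθ₀c : HasCompactSupport θ₀ := bump.hasCompactSupport_normed
  have hts : tsupport θ₀ = Metric.closedBall ((a + b) / 2) ((b - a) / 4) := bump.tsupport_normed_eq
  have hθ₀s : tsupport θ₀ ⊆ Ioo a b := by
    rw [hts, Real.closedBall_eq_Icc]
    intro t ht
    constructor <;> linarith [ht.1, ht.2]
  have hθ₀i : ∫ t, θ₀ t = 1 := bump.integral_normed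
  have hzint : ∀ f : ℝ → ℝ, Continuous f → IntervalIntegrable (fun t => f t * z t) volume a b :=
    fun f hf => by
      refine ContinuousOn.intervalIntegrable ?_
      rw [uIcc_of_le hab.le]
      exact hf.continuousOn.mul hz
  set c := ∫ t in a..b, θ₀ t * z t
  refine ⟨c, ?_⟩
  -- Subtracting from `f` a multiple of the bump `θ₀` with the same integral leaves a function of
  -- mean zero. Its primitive is compactly supported, hence an admissible test function.
  have key : ∀ f : ℝ → ℝ, ContDiff ℝ ∞ f → HasCompactSupport f → tsupport f ⊆ Ioo a b →
      ∫ t, f t • (z t - c) = 0 := by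
    intro f hf hfc hfs
    set I := ∫ t, f t
    set D : ℝ → ℝ := fun t => f t - I * θ₀ t
    have hD : ContDiff ℝ ∞ D := hf.sub (contDiff_const.mul hθ₀)
    set K := tsupport f ∪ tsupport θ₀
    have hK : IsCompact K := hfc.isCompact.union hθ₀c.isCompact
    have hKs : K ⊆ Ioo a b := union_subset hfs hθ₀s
    have hKne : K.Nonempty := ⟨(a + b) / 2, Or.inr (by
      rw [hts]; exact Metric.mem_closedBall_self (by linarith))⟩
    have hDK : ∀ t, t ∉ K → D t = 0 := fun t ht => by
      have h1 : f t = 0 := image_eq_zero_of_notMem_tsupport fun h => ht (Or.inl h)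
      have h2 : θ₀ t = 0 := image_eq_zero_of_notMem_tsupport fun h => ht (Or.inr h)
      simp [D, h1, h2]
    -- Compactness puts the extreme points of the support strictly inside the interval, which leaves
    -- room for the support of the primitive.
    have hlo := hKs (hK.sInf_mem hKne)
    have hhi := hKs (hK.sSup_mem hKne)
    have hout : ∀ t, t ∉ Icc (sInf K) (sSup K) → D t = 0 := fun t ht =>
      hDK t fun h => ht ⟨csInf_le hK.bddBelow h, le_csSup hK.bddAbove h⟩
    have hDint : ∫ t, D t = 0 := by
      rw [integral_sub (hf.continuous.integrable_of_hasCompactSupport hfc)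
        ((hθ₀.continuous.integrable_of_hasCompactSupport hθ₀c).const_mul I), integral_const_mul,
        hθ₀i, mul_one, sub_self]
    set Θ : ℝ → ℝ := fun t => ∫ s in a..t, D s
    have hΘd : ∀ t, HasDerivAt Θ (D t) t := fun t =>
      intervalIntegral.integral_hasDerivAt_right (hD.continuous.intervalIntegrable _ _)
        (hD.continuous.stronglyMeasurableAtFilter _ _) hD.continuous.continuousAt
    have hΘ' : deriv Θ = D := funext fun t => (hΘd t).deriv
    have hΘ : ContDiff ℝ ∞ Θ := by
      rw [contDiff_infty_iff_deriv, hΘ']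
      exact ⟨fun t => (hΘd t).differentiableAt, hD⟩
    have hΘ0 : ∀ t, t ∉ Icc (sInf K) (sSup K) → Θ t = 0 := by
      intro t ht
      by_cases h1 : t < sInf K
      · refine intervalIntegral.integral_zero_ae (Eventually.of_forall fun s hs => hout s fun h => ?_)
        rcases mem_uIoc.1 hs with h2 | h2
        · linarith [h.1, h2.2]
        · linarith [h.1, h2.2, hlo.1]
      · have h2 : sSup K < t := by
          by_contra h3; exact ht ⟨not_lt.1 h1, not_lt.1 h3⟩
        have h3 : a ≤ t := (hhi.1.trans h2).le
        simp only [Θ]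
        rw [intervalIntegral_eq_integral_of_tsupport h3, hDint]
        intro s hs
        refine hout s fun h => hs ⟨hlo.1.trans_le h.1, h.2.trans_lt h2⟩
    have hΘs : tsupport Θ ⊆ Icc (sInf K) (sSup K) :=
      closure_minimal (fun t ht => by_contra fun h => ht (hΘ0 t h)) isClosed_Icc
    have h0 := h Θ hΘ (isCompact_Icc.of_isClosed_subset (isClosed_tsupport _) hΘs)
      (hΘs.trans (Icc_subset_Ioo hlo.1 hhi.2))
    rw [hΘ'] at h0
    have h1 : ∫ t in a..b, D t * z t = (∫ t in a..b, f t * z t) - I * c := by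
      rw [← intervalIntegral.integral_const_mul, ← intervalIntegral.integral_sub
        (hzint f hf.continuous) ((hzint θ₀ hθ₀.continuous).const_mul I)]
      exact intervalIntegral.integral_congr fun t _ => by simp only [D]; ring
    have hfout : ∀ t, t ∉ Ioo a b → f t = 0 := fun t ht =>
      image_eq_zero_of_notMem_tsupport fun h => ht (hfs h)
    have h2 : I = ∫ t in a..b, f t :=
      (intervalIntegral_eq_integral_of_tsupport hab.le hfout).symm
    rw [← intervalIntegral_eq_integral_of_tsupport hab.le (fun t ht => by simp [hfout t ht])]
    simp only [smul_eq_mul, mul_sub]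
    have i2 : IntervalIntegrable (fun t => f t * c) volume a b :=
      (hf.continuous.mul continuous_const).intervalIntegrable _ _
    rw [intervalIntegral.integral_sub (hzint f hf.continuous) i2,
      intervalIntegral.integral_mul_const, ← h2, ← h1, h0]
  have hloc : LocallyIntegrableOn (fun t => z t - c) (Ioo a b) :=
    ((hz.sub continuousOn_const).mono Ioo_subset_Icc_self).locallyIntegrableOn measurableSet_Ioo
  have hae := isOpen_Ioo.ae_eq_zero_of_integral_contDiff_smul_eq_zero hloc key
  have hae' : z =ᵐ[volume.restrict (Icc a b)] fun _ => c := by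
    rw [← restrict_Ioo_eq_restrict_Icc]
    filter_upwards [ae_restrict_of_ae hae, ae_restrict_mem measurableSet_Ioo] with t ht htm
    linarith [ht htm]
  exact Measure.eqOn_Icc_of_ae_eq volume hab.ne hae' hz continuousOn_const

lemma absolutelyContinuousOnInterval_congr {f g : ℝ → ℝ} {a b : ℝ}
    (hf : AbsolutelyContinuousOnInterval f a b) (h : ∀ t ∈ uIcc a b, g t = f t) :
    AbsolutelyContinuousOnInterval g a b := by
  rw [absolutelyContinuousOnInterval_iff] at hf ⊢
  intro ε hε
  obtain ⟨d, hd, H⟩ := hf ε hε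
  refine ⟨d, hd, fun E hE hlt => ?_⟩
  convert H E hE hlt using 1
  refine Finset.sum_congr rfl fun i hi => ?_
  rw [h _ (hE.1 i hi).1, h _ (hE.1 i hi).2]

/-- A continuous function with an integrable weak derivative is absolutely continuous. -/
lemma absolutelyContinuous_of_weakDeriv {y k : ℝ → ℝ} {a b : ℝ} (hab : a < b)
    (hy : ContinuousOn y (Icc a b)) (hk : IntervalIntegrable k volume a b)
    (h : ∀ θ : ℝ → ℝ, ContDiff ℝ ∞ θ → HasCompactSupport θ → tsupport θ ⊆ Ioo a b →
      ∫ t in a..b, deriv θ t * y t = -∫ t in a..b, θ t * k t) :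
    AbsolutelyContinuousOnInterval y a b ∧
      ∀ᵐ t, t ∈ Ioo a b → HasDerivAt y (k t) t := by
  -- The difference of `y` and the primitive of `k` has zero weak derivative, hence is constant, and
  -- the primitive is absolutely continuous.
  set Y : ℝ → ℝ := fun t => ∫ s in a..t, k s
  have hYac : AbsolutelyContinuousOnInterval Y a b :=
    hk.absolutelyContinuousOnInterval_intervalIntegral (by simp)
  have hYd : ∀ᵐ t, t ∈ uIcc a b → HasDerivAt Y (k t) t := by
    filter_upwards [hk.ae_hasDerivAt_integral] with t ht htm
    exact ht htm a (by simp)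
  have hYc : ContinuousOn Y (Icc a b) := by
    rw [← uIcc_of_le hab.le]; exact hYac.continuousOn
  obtain ⟨c, hc⟩ := exists_eq_const_of_integral_deriv_mul hab (hy.sub hYc)
    (fun θ hθ hθc hθs => by
      have hθac : AbsolutelyContinuousOnInterval θ a b :=
        (hθ.of_le (by simp) : ContDiff ℝ 1 θ).contDiffOn.absolutelyContinuousOnInterval
      have hparts := hθac.integral_mul_deriv_eq_deriv_mul hYac
      have h0 : ∀ t, t ∉ Ioo a b → θ t = 0 := fun t ht =>
        image_eq_zero_of_notMem_tsupport fun h => ht (hθs h)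
      rw [h0 b (by simp), h0 a (by simp)] at hparts
      have e : ∫ t in a..b, θ t * deriv Y t = ∫ t in a..b, θ t * k t := by
        refine intervalIntegral.integral_congr_ae ?_
        filter_upwards [hYd] with t ht htm
        rw [(ht (uIoc_subset_uIcc htm)).deriv]
      have hθ' : Continuous (deriv θ) := (hθ.of_le (by simp) : ContDiff ℝ 1 θ).continuous_deriv le_rfl
      have i1 : IntervalIntegrable (fun t => deriv θ t * y t) volume a b := by
        refine ContinuousOn.intervalIntegrable ?_
        rw [uIcc_of_le hab.le]
        exact hθ'.continuousOn.mul hy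
      have i2 : IntervalIntegrable (fun t => deriv θ t * Y t) volume a b := by
        refine ContinuousOn.intervalIntegrable ?_
        rw [uIcc_of_le hab.le]
        exact hθ'.continuousOn.mul hYc
      simp only [Pi.sub_apply, mul_sub]
      rw [intervalIntegral.integral_sub i1 i2, h θ hθ hθc hθs]
      linarith)
  have hyY : ∀ t ∈ Icc a b, y t = Y t + c := fun t ht => by
    have := hc t ht
    simp only [Pi.sub_apply] at this
    linarith
  have hcac : AbsolutelyContinuousOnInterval (fun _ : ℝ => c) a b :=
    contDiffOn_const.absolutelyContinuousOnInterval
  refine ⟨absolutelyContinuousOnInterval_congr (hYac.fun_add hcac) (by rwa [uIcc_of_le hab.le]), ?_⟩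
  filter_upwards [hYd] with t ht htm
  have h1 := (ht (by rw [uIcc_of_le hab.le]; exact Ioo_subset_Icc_self htm)).add_const c
  refine h1.congr_of_eventuallyEq ?_
  filter_upwards [Icc_mem_nhds htm.1 htm.2] with s hs
  exact hyY s hs

end DampedWave

/-! ### The equation satisfied by a mollified solution. -/

namespace DampedWave

variable {n : ℕ} {ρ : Space n → ℝ}

lemma integrable_smul_sub {E : Type*} [NormedAddCommGroup E] [NormedSpace ℝ E] {g : Space n → E}
    (hg : LocallyIntegrable g) (hρ : Continuous ρ) (hc : HasCompactSupport ρ) (x : Space n) :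
    Integrable fun y => ρ (x - y) • g y := by
  have := hc.convolutionExists_left (ContinuousLinearMap.lsmul ℝ ℝ) hρ hg x
  refine (this.comp_sub_left x).congr (Eventually.of_forall fun y => ?_)
  simp

lemma hasCompactSupport_gradient (hc : HasCompactSupport ρ) : HasCompactSupport (gradient ρ) :=
  (hc.fderiv (𝕜 := ℝ)).comp_left (g := (InnerProductSpace.toDual ℝ (Space n)).symm) (by simp)

lemma tr_mollify {w : Space n → ℝ} {H : Space n → Space n →L[ℝ] Space n}
    (hw : LocallyIntegrable w) (hH : Continuous H) (hc : HasCompactSupport H) (x : Space n) :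
    tr (mollify w H x) = ∑ i, ∫ y, w y * H (x - y) (EuclideanSpace.single i 1) i := by
  rw [tr]
  refine Finset.sum_congr rfl fun i _ => ?_
  have h := integrable_mollify hw hH hc x
  rw [mollify, ContinuousLinearMap.integral_apply h]
  have := (EuclideanSpace.proj (𝕜 := ℝ) i : Space n →L[ℝ] ℝ).integral_comp_comm
    (h.apply_continuousLinearMap (EuclideanSpace.single i 1))
  simpa using this.symm

/-- The Laplacian of a mollified function, through its weak gradient. -/
lemma integral_inner_weakGradient {f : Space n → ℝ} {g : Space n → Space n}
    (h : HasWeakGradient f g) (hρ : ContDiff ℝ ∞ ρ) (hc : HasCompactSupport ρ) (x : Space n) :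
    Integrable (fun y => inner ℝ (gradient ρ (x - y)) (g y)) ∧
    ∫ y, inner ℝ (gradient ρ (x - y)) (g y) = tr (mollify f (fderiv ℝ (gradient ρ)) x) := by
  have hgs := contDiff_gradient hρ
  have hgc := hasCompactSupport_gradient hc
  set ρi : Fin n → Space n → ℝ := fun i z => gradient ρ z i
  have hi : ∀ i, ContDiff ℝ ∞ (ρi i) := fun i =>
    (EuclideanSpace.proj (𝕜 := ℝ) i : Space n →L[ℝ] ℝ).contDiff.comp hgs
  have hic : ∀ i, HasCompactSupport (ρi i) := fun i =>
    hgc.comp_left (g := fun v : Space n => v i) (by simp)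
  have hint : ∀ i, Integrable fun y => ρi i (x - y) * g y i := fun i => by
    have h1 := integrable_smul_sub h.locallyIntegrable_grad (hi i).continuous (hic i) x
    have h2 := (EuclideanSpace.proj (𝕜 := ℝ) i : Space n →L[ℝ] ℝ).integrable_comp h1
    simpa using h2
  have e : (fun y => inner ℝ (gradient ρ (x - y)) (g y))
      = fun y => ∑ i, ρi i (x - y) * g y i := by
    ext y
    rw [PiLp.inner_apply]
    exact Finset.sum_congr rfl fun i _ => by simp [ρi, mul_comm]
  rw [e]
  refine ⟨integrable_finsetSum _ fun i _ => hint i, ?_⟩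
  rw [integral_finsetSum _ fun i _ => hint i, tr_mollify h.locallyIntegrable
    (hgs.continuous_fderiv (by simp)) (hgc.fderiv (𝕜 := ℝ))]
  refine Finset.sum_congr rfl fun i _ => ?_
  -- The weak gradient identity is applied with each component of `gradient ρ` as kernel, which
  -- moves the second derivative onto the mollifier.
  have h1 := integral_smul_weakGradient h (hi i) (hic i) x
  have h2 := (EuclideanSpace.proj (𝕜 := ℝ) i : Space n →L[ℝ] ℝ).integral_comp_comm
    (integrable_smul_sub h.locallyIntegrable_grad (hi i).continuous (hic i) x)
  have h3 := (EuclideanSpace.proj (𝕜 := ℝ) i : Space n →L[ℝ] ℝ).integral_comp_comm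
    (integrable_mollify h.locallyIntegrable (contDiff_gradient (hi i)).continuous
      (hasCompactSupport_gradient (hic i)) x)
  rw [h1, mollify, ← h3] at h2
  simp only [PiLp.proj_apply, PiLp.smul_apply, smul_eq_mul] at h2
  rw [h2]
  refine integral_congr_ae (Eventually.of_forall fun y => ?_)
  have h4 : gradient (ρi i) (x - y) i = fderiv ℝ (ρi i) (x - y) (EuclideanSpace.single i 1) := by
    rw [← inner_gradient, EuclideanSpace.inner_single_right]
    simp
  have h5 : fderiv ℝ (ρi i) (x - y)
      = (EuclideanSpace.proj (𝕜 := ℝ) i : Space n →L[ℝ] ℝ).comp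
        (fderiv ℝ (gradient ρ) (x - y)) :=
    ((EuclideanSpace.proj (𝕜 := ℝ) i : Space n →L[ℝ] ℝ).hasFDerivAt.comp (x - y)
      (hgs.differentiable (by simp) (x - y)).hasFDerivAt).fderiv
  simp only [h4, h5]
  simp

/-- The mollified equation, in its weak form in time. -/
lemma integral_deriv_mul_mollify {μ t₀ T s : ℝ} {F φ φt f : ℝ → Space n → ℝ}
    {φx : ℝ → Space n → Space n} (hsol : IsDampedWaveSolution μ t₀ T F φ φt φx)
    (hρ : IsMollifier (1 / 2) ρ) (ht₀ : 0 ≤ t₀) (hs : s ∈ Ioo t₀ T)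
    (hfF : (fun z : ℝ × Space n => f z.1 z.2) =ᵐ[volume.restrict (Ioo t₀ T ×ˢ univ)]
      fun z => F z.1 z.2)
    (hf : ∀ R, IntegrableOn (fun z : ℝ × Space n => f z.1 z.2) (Ioo s T ×ˢ Metric.ball 0 R))
    (x : Space n) :
    IntervalIntegrable (fun t => mollify (f t) ρ x) volume s T ∧
    ∀ θ : ℝ → ℝ, ContDiff ℝ ∞ θ → HasCompactSupport θ → tsupport θ ⊆ Ioo s T →
      ∫ t in s..T, deriv θ t * mollify (φt t) ρ x
        = -∫ t in s..T, θ t * (tr (mollify (φ t) (fderiv ℝ (gradient ρ)) x)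
            - μ / t * mollify (φt t) ρ x + mollify (f t) ρ x) := by
  have hc := hρ.hasCompactSupport
  have hρc := hρ.contDiff.continuous
  have hz1 : ∀ z, 1 ≤ ‖z‖ → ρ z = 0 := fun z hz => hρ.eq_zero z (by linarith)
  have hsI : Icc s T ⊆ Icc t₀ T := Icc_subset_Icc_left hs.1.le
  set B : Set (Space n) := Metric.ball 0 (‖x‖ + 1)
  have hB : ∀ y, y ∉ B → ρ (x - y) = 0 := fun y hy => by
    refine hz1 _ ?_
    rw [mem_ball_zero_iff, not_lt] at hy
    have := norm_sub_norm_le y x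
    rw [norm_sub_rev] at this
    linarith
  obtain ⟨b, hb⟩ := hc.exists_bound_of_continuous hρc
  have hprod : (volume : Measure (ℝ × Space n)).restrict (Ioo s T ×ˢ B)
      = (volume.restrict (Ioo s T)).prod (volume.restrict B) := by
    rw [Measure.prod_restrict, Measure.volume_eq_prod]
  have hfρ : Integrable (fun z : ℝ × Space n => f z.1 z.2 * ρ (x - z.2))
      ((volume.restrict (Ioo s T)).prod (volume.restrict B)) := by
    rw [← hprod]
    exact (hf _).mul_bdd (c := b)
      (hρc.comp (continuous_const.sub continuous_snd)).aestronglyMeasurable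
      (Eventually.of_forall fun z => hb _)
  have hmf : ∀ t, mollify (f t) ρ x = ∫ y in B, f t y * ρ (x - y) := fun t => by
    rw [mollify, setIntegral_eq_integral_of_forall_compl_eq_zero fun y hy => by simp [hB y hy]]
    simp
  have hII : IntervalIntegrable (fun t => mollify (f t) ρ x) volume s T := by
    rw [intervalIntegrable_iff_integrableOn_Ioo_of_le hs.2.le]
    simp only [hmf]
    exact hfρ.integral_prod_left
  refine ⟨hII, fun θ hθ hθc hθs => ?_⟩
  have hθ0 : ∀ t, t ∉ Ioo s T → θ t = 0 := fun t ht =>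
    image_eq_zero_of_notMem_tsupport fun h => ht (hθs h)
  have hdθ0 : ∀ t, t ∉ Ioo s T → deriv θ t = 0 := fun t ht =>
    image_eq_zero_of_notMem_tsupport fun h => ht (hθs (tsupport_deriv_subset h))
  -- The distributional equation is tested with a product of a function of time and the reflected,
  -- translated mollifier.
  set η : ℝ × Space n → ℝ := fun z => θ z.1 * ρ (x - z.2)
  have hη : ContDiff ℝ ∞ η := (hθ.comp contDiff_fst).mul
    (hρ.contDiff.comp (contDiff_const.sub contDiff_snd))
  have hηsub : Function.support η ⊆ tsupport θ ×ˢ Metric.closedBall (0 : Space n) (‖x‖ + 1) := by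
    intro z hz
    refine ⟨subset_tsupport _ fun h => hz (by simp [η, h]), ?_⟩
    by_contra h
    exact hz (by simp [η, hB z.2 fun h' => h (Metric.ball_subset_closedBall h')])
  have hK : IsCompact (tsupport θ ×ˢ Metric.closedBall (0 : Space n) (‖x‖ + 1)) :=
    hθc.isCompact.prod (isCompact_closedBall _ _)
  have hηts : tsupport η ⊆ tsupport θ ×ˢ Metric.closedBall (0 : Space n) (‖x‖ + 1) :=
    closure_minimal hηsub hK.isClosed
  have hηc : HasCompactSupport η := hK.of_isClosed_subset (isClosed_tsupport _) hηts
  have hIoo : Ioo s T ⊆ Ioo t₀ T := Ioo_subset_Ioo_left hs.1.le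
  have key := hsol.equation η hη hηc fun z hz => ⟨hIoo (hθs (hηts hz).1), mem_univ _⟩
  set L : ℝ → ℝ := fun t => tr (mollify (φ t) (fderiv ℝ (gradient ρ)) x)
  set Φt : ℝ → ℝ := fun t => mollify (φt t) ρ x
  have hinner : ∀ t ∈ Icc t₀ T, (∫ y, (-(φt t y * deriv (fun s => η (s, y)) t)
      + fderiv ℝ (fun y => η (t, y)) y (φx t y) + μ / t * φt t y * η (t, y)))
      = -(deriv θ t * Φt t) - θ t * (L t - μ / t * Φt t) := by
    intro t ht
    have h1 := integrable_mollify (hsol.continuousOn_timeDeriv.locallyIntegrable ht) hρc hc x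
    obtain ⟨h2, h3⟩ := integral_inner_weakGradient (hsol.hasWeakGradient t ht) hρ.contDiff hc x
    have e : ∀ y, (-(φt t y * deriv (fun s => η (s, y)) t)
        + fderiv ℝ (fun y => η (t, y)) y (φx t y) + μ / t * φt t y * η (t, y))
        = (μ / t * θ t - deriv θ t) * (φt t y • ρ (x - y))
          - θ t * inner ℝ (gradient ρ (x - y)) (φx t y) := by
      intro y
      have d1 : deriv (fun s => η (s, y)) t = deriv θ t * ρ (x - y) := by
        simp only [η]
        exact deriv_mul_const (hθ.differentiable (by simp) t) _
      have d2 : fderiv ℝ (fun y => η (t, y)) y (φx t y)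
          = -(θ t * inner ℝ (gradient ρ (x - y)) (φx t y)) := by
        have := (((hρ.contDiff.differentiable (by simp) (x - y)).hasFDerivAt).comp y
          ((hasFDerivAt_id y).const_sub x)).const_mul (θ t)
        rw [show (fun y => η (t, y)) = fun y => θ t * (ρ ∘ fun y => x - y) y from rfl,
          this.fderiv, inner_gradient]
        simp
      rw [d1, d2]
      simp only [η, smul_eq_mul]
      ring
    simp only [e]
    rw [integral_sub (h1.const_mul _) (h2.const_mul _), integral_const_mul, integral_const_mul, h3]
    change (μ / t * θ t - deriv θ t) * Φt t - θ t * L t = _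
    ring
  have hleft : (∫ t in t₀..T, ∫ y, (-(φt t y * deriv (fun s => η (s, y)) t)
      + fderiv ℝ (fun y => η (t, y)) y (φx t y) + μ / t * φt t y * η (t, y)))
      = ∫ t in s..T, (-(deriv θ t * Φt t) - θ t * (L t - μ / t * Φt t)) := by
    have ht₀T : t₀ ≤ T := (hs.1.trans hs.2).le
    rw [intervalIntegral.integral_congr (g := fun t => -(deriv θ t * Φt t)
      - θ t * (L t - μ / t * Φt t)) fun t ht => hinner t (by rwa [uIcc_of_le ht₀T] at ht)]
    rw [intervalIntegral_eq_integral_of_tsupport ht₀T fun t ht => ?_,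
      intervalIntegral_eq_integral_of_tsupport hs.2.le fun t ht => ?_]
    · simp [hθ0 t ht, hdθ0 t ht]
    · have := fun h => ht (hIoo h)
      simp [hθ0 t this, hdθ0 t this]
  -- Fubini's theorem needs integrability up to the time `T`, which local integrability of `F` in
  -- the open slab does not provide; it comes from the representative `f`.
  have hright : (∫ z : ℝ × Space n, F z.1 z.2 * η z)
      = ∫ t in s..T, θ t * mollify (f t) ρ x := by
    have hsub : Ioo s T ×ˢ B ⊆ Ioo t₀ T ×ˢ (univ : Set (Space n)) :=
      prod_mono hIoo (subset_univ _)
    have hout : ∀ z : ℝ × Space n, z ∉ Ioo s T ×ˢ B → F z.1 z.2 * η z = 0 := fun z hz => by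
      rw [mem_prod, not_and_or] at hz
      rcases hz with h | h
      · simp [η, hθ0 _ h]
      · simp [η, hB _ h]
    rw [← setIntegral_eq_integral_of_forall_compl_eq_zero hout,
      intervalIntegral.integral_of_le hs.2.le, integral_Ioc_eq_integral_Ioo]
    have hae : ∀ᵐ z ∂(volume.restrict (Ioo s T ×ˢ B)), F z.1 z.2 * η z
        = θ z.1 * (f z.1 z.2 * ρ (x - z.2)) := by
      filter_upwards [hfF.filter_mono (ae_mono (Measure.restrict_mono hsub le_rfl))] with z hz
      rw [← hz]
      simp only [η]
      ring
    obtain ⟨bθ, hbθ⟩ := hθc.exists_bound_of_continuous hθ.continuous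
    have hθf : Integrable (fun z : ℝ × Space n => θ z.1 * (f z.1 z.2 * ρ (x - z.2)))
        ((volume.restrict (Ioo s T)).prod (volume.restrict B)) :=
      hfρ.bdd_mul (c := bθ) (hθ.continuous.comp continuous_fst).aestronglyMeasurable
        (Eventually.of_forall fun z => hbθ _)
    rw [integral_congr_ae hae, hprod, integral_prod _ hθf]
    refine integral_congr_ae (Eventually.of_forall fun t => ?_)
    simp only [hmf]
    rw [integral_const_mul]
  rw [hleft, hright] at key
  have hUcc : uIcc s T = Icc s T := uIcc_of_le hs.2.le
  have cΦt : ContinuousOn Φt (Icc s T) :=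
    ((continuousOn_mollify hsol.continuousOn_timeDeriv hρc hz1).comp
      (continuousOn_id.prodMk continuousOn_const) fun t ht => ⟨ht, mem_univ _⟩).mono hsI
  have hgz : ∀ z, 1 / 2 < ‖z‖ → gradient ρ z = 0 := fun z hz =>
    gradient_eq_zero_of_norm_gt hρ.eq_zero hz
  have cL : ContinuousOn L (Icc s T) := by
    have := (continuousOn_mollify hsol.continuousOn
      ((contDiff_gradient hρ.contDiff).continuous_fderiv (by simp))
      (fun z hz => fderiv_eq_zero_of_norm_gt hgz (by linarith))).comp
      (continuousOn_id.prodMk (continuousOn_const (c := x))) (s := Icc t₀ T)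
        fun t ht => ⟨ht, mem_univ _⟩
    exact (continuous_tr.comp_continuousOn this).mono hsI
  have cm : ContinuousOn (fun t => L t - μ / t * Φt t) (Icc s T) :=
    cL.sub ((continuousOn_const.div continuousOn_id fun t ht =>
      (ht₀.trans_lt (hs.1.trans_le ht.1)).ne').mul cΦt)
  have i1 : IntervalIntegrable (fun t => deriv θ t * Φt t) volume s T :=
    ContinuousOn.intervalIntegrable (by
      rw [hUcc]; exact (hθ.continuous_deriv (by simp)).continuousOn.mul cΦt)
  have i2 : IntervalIntegrable (fun t => θ t * (L t - μ / t * Φt t)) volume s T :=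
    ContinuousOn.intervalIntegrable (by rw [hUcc]; exact hθ.continuous.continuousOn.mul cm)
  have i3 : IntervalIntegrable (fun t => θ t * mollify (f t) ρ x) volume s T :=
    hII.continuousOn_mul hθ.continuous.continuousOn
  have i1' : IntervalIntegrable (fun t => -(deriv θ t * Φt t)) volume s T := i1.neg
  rw [intervalIntegral.integral_sub i1' i2, intervalIntegral.integral_neg] at key
  simp only [mul_add]
  rw [intervalIntegral.integral_add i2 i3, ← key]
  ring

end DampedWave

/-! ### Mollified and rescaled solutions are regular waves. -/

namespace DampedWave

variable {n : ℕ} {ρ : Space n → ℝ} {μ t₀ T : ℝ} {F φ φt f : ℝ → Space n → ℝ}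
  {φx : ℝ → Space n → Space n}

lemma mollify_eq_zero {V : Type*} [NormedAddCommGroup V] [NormedSpace ℝ V] {w : Space n → ℝ}
    (h : w =ᵐ[volume] 0) (ζ : Space n → V) (x : Space n) : mollify w ζ x = 0 := by
  rw [mollify]
  refine integral_eq_zero_of_ae ?_
  filter_upwards [h] with y hy
  simp [hy]

lemma hasDerivAt_rpow_half {t : ℝ} (ht : 0 < t) :
    HasDerivAt (fun t : ℝ => t ^ (μ / 2)) (t ^ (μ / 2) * (μ / (2 * t))) t := by
  refine (Real.hasDerivAt_rpow_const (Or.inl ht.ne')).congr_deriv ?_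
  rw [Real.rpow_sub_one ht.ne']
  field_simp

/-- The mollified time derivative is absolutely continuous, with the derivative given by the
mollified equation. -/
lemma absolutelyContinuous_mollify (hsol : IsDampedWaveSolution μ t₀ T F φ φt φx)
    (hρ : IsMollifier (1 / 2) ρ) (ht₀ : 0 ≤ t₀)
    (hfF : (fun z : ℝ × Space n => f z.1 z.2) =ᵐ[volume.restrict (Ioo t₀ T ×ˢ univ)]
      fun z => F z.1 z.2)
    (hf : ∀ s ∈ Ioo t₀ T, ∀ R,
      IntegrableOn (fun z : ℝ × Space n => f z.1 z.2) (Ioo s T ×ˢ Metric.ball 0 R))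
    (x : Space n) {s : ℝ} (hs : s ∈ Ioo t₀ T) :
    AbsolutelyContinuousOnInterval (fun t => mollify (φt t) ρ x) s T ∧
      ∀ᵐ t, t ∈ Ioo s T → HasDerivAt (fun t => mollify (φt t) ρ x)
        (tr (mollify (φ t) (fderiv ℝ (gradient ρ)) x) - μ / t * mollify (φt t) ρ x
          + mollify (f t) ρ x) t := by
  have hρc := hρ.contDiff.continuous
  have hz1 : ∀ z, 1 ≤ ‖z‖ → ρ z = 0 := fun z hz => hρ.eq_zero z (by linarith)
  have hgz : ∀ z, 1 / 2 < ‖z‖ → gradient ρ z = 0 := fun z hz =>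
    gradient_eq_zero_of_norm_gt hρ.eq_zero hz
  have hsI : Icc s T ⊆ Icc t₀ T := Icc_subset_Icc_left hs.1.le
  have cΦt : ContinuousOn (fun t => mollify (φt t) ρ x) (Icc s T) :=
    ((continuousOn_mollify hsol.continuousOn_timeDeriv hρc hz1).comp
      (continuousOn_id.prodMk continuousOn_const) fun t ht => ⟨ht, mem_univ _⟩).mono hsI
  have cL : ContinuousOn (fun t => tr (mollify (φ t) (fderiv ℝ (gradient ρ)) x)) (Icc s T) := by
    have := (continuousOn_mollify hsol.continuousOn
      ((contDiff_gradient hρ.contDiff).continuous_fderiv (by simp))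
      (fun z hz => fderiv_eq_zero_of_norm_gt hgz (by linarith))).comp
      (continuousOn_id.prodMk (continuousOn_const (c := x))) (s := Icc t₀ T)
        fun t ht => ⟨ht, mem_univ _⟩
    exact (continuous_tr.comp_continuousOn this).mono hsI
  obtain ⟨h1, h2⟩ := integral_deriv_mul_mollify hsol hρ ht₀ hs hfF (hf s hs) x
  refine absolutelyContinuous_of_weakDeriv hs.2 cΦt ?_ h2
  refine IntervalIntegrable.add (ContinuousOn.intervalIntegrable ?_) h1
  rw [uIcc_of_le hs.2.le]
  exact cL.sub ((continuousOn_const.div continuousOn_id fun t ht =>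
    (ht₀.trans_lt (hs.1.trans_le ht.1)).ne').mul cΦt)

/-- The source is known to be integrable only away from the initial time, so almost everywhere
statements are obtained on `(s, b)` and combined along a sequence `s → a`. -/
lemma ae_imp_mem_Ioo {a b : ℝ} {p : ℝ → Prop}
    (h : ∀ s ∈ Ioo a b, ∀ᵐ t, t ∈ Ioo s b → p t) : ∀ᵐ t, t ∈ Ioo a b → p t := by
  by_cases hab : a < b
  · obtain ⟨u, -, hu, hlim⟩ := exists_seq_strictAnti_tendsto' hab
    have := ae_all_iff.2 fun k => h (u k) (hu k)
    filter_upwards [this] with t ht htm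
    obtain ⟨k, hk⟩ := (hlim.eventually_lt_const htm.1).exists
    exact ht k ⟨hk, htm.2⟩
  · exact Eventually.of_forall fun t ht => absurd (ht.1.trans ht.2) hab

/-- Mollification in space and the substitution `ψ = t ^ (μ / 2) φ` turn a weak solution of the
damped wave equation into a regular wave. -/
lemma regularWave_mollify (hsol : IsDampedWaveSolution μ t₀ T F φ φt φx)
    (hρ : IsMollifier (1 / 2) ρ) (hμ : 0 < μ) (ht₀ : 0 ≤ t₀) (hT : t₀ < T)
    (hfF : (fun z : ℝ × Space n => f z.1 z.2) =ᵐ[volume.restrict (Ioo t₀ T ×ˢ univ)]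
      fun z => F z.1 z.2)
    (hf : ∀ s ∈ Ioo t₀ T, ∀ R,
      IntegrableOn (fun z : ℝ × Space n => f z.1 z.2) (Ioo s T ×ˢ Metric.ball 0 R)) :
    RegularWave (μ * (2 - μ) / 4) t₀ T (fun t x => t ^ (μ / 2) * mollify (φ t) ρ x)
      (fun t x => t ^ (μ / 2) * (mollify (φt t) ρ x + μ / (2 * t) * mollify (φ t) ρ x))
      (fun t x => t ^ (μ / 2) • mollify (φ t) (gradient ρ) x)
      (fun t x => t ^ (μ / 2) • (mollify (φt t) (gradient ρ) x
        + (μ / (2 * t)) • mollify (φ t) (gradient ρ) x))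
      (fun t x => t ^ (μ / 2) * mollify (f t) ρ x) := by
  set I := Icc t₀ T
  set J := Ioc t₀ T
  have hJI : J ⊆ I := Ioc_subset_Icc_self
  have hpos : ∀ t ∈ J, 0 < t := fun t ht => ht₀.trans_lt ht.1
  have hρs := hρ.contDiff
  have hρc := hρs.continuous
  have hcs := hρ.hasCompactSupport
  have hgs := contDiff_gradient hρs
  have hgcs := hasCompactSupport_gradient hcs
  have hH : Continuous (fderiv ℝ (gradient ρ)) := hgs.continuous_fderiv (by simp)
  have hz1 : ∀ z, 1 ≤ ‖z‖ → ρ z = 0 := fun z hz => hρ.eq_zero z (by linarith)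
  have hgz : ∀ z, 1 / 2 < ‖z‖ → gradient ρ z = 0 := fun z hz =>
    gradient_eq_zero_of_norm_gt hρ.eq_zero hz
  have hgz1 : ∀ z, 1 ≤ ‖z‖ → gradient ρ z = 0 := fun z hz => hgz z (by linarith)
  have hHz1 : ∀ z, 1 ≤ ‖z‖ → fderiv ℝ (gradient ρ) z = 0 := fun z hz =>
    fderiv_eq_zero_of_norm_gt hgz (by linarith)
  have hli : ∀ t ∈ I, LocallyIntegrable (φ t) := fun t ht => hsol.continuousOn.locallyIntegrable ht
  have hlit : ∀ t ∈ I, LocallyIntegrable (φt t) := fun t ht =>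
    hsol.continuousOn_timeDeriv.locallyIntegrable ht
  have cΦ := continuousOn_mollify hsol.continuousOn hρc hz1
  have cΦt := continuousOn_mollify hsol.continuousOn_timeDeriv hρc hz1
  have cD := continuousOn_mollify hsol.continuousOn hgs.continuous hgz1
  have cDt := continuousOn_mollify hsol.continuousOn_timeDeriv hgs.continuous hgz1
  have cH := continuousOn_mollify hsol.continuousOn hH hHz1
  have hsub : J ×ˢ (univ : Set (Space n)) ⊆ I ×ˢ univ := prod_mono hJI le_rfl
  have cc : Continuous fun t : ℝ => t ^ (μ / 2) := Real.continuous_rpow_const (by positivity)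
  have cc' : ContinuousOn (fun z : ℝ × Space n => z.1 ^ (μ / 2)) (J ×ˢ univ) :=
    (cc.comp continuous_fst).continuousOn
  have cq : ContinuousOn (fun z : ℝ × Space n => μ / (2 * z.1)) (J ×ˢ univ) :=
    continuousOn_const.div (continuousOn_const.mul continuousOn_fst) fun z hz =>
      (mul_pos two_pos (hpos _ hz.1)).ne'
  have slice : ∀ {E : Type} [TopologicalSpace E] {h : ℝ × Space n → E},
      ContinuousOn h (I ×ˢ univ) → ∀ x, ContinuousOn (fun t => h (t, x)) I := fun hh x =>
    hh.comp (continuousOn_id.prodMk continuousOn_const) fun t ht => ⟨ht, mem_univ _⟩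
  have dΦ : ∀ x, ∀ t ∈ I, HasDerivWithinAt (fun t => mollify (φ t) ρ x)
      (mollify (φt t) ρ x) I t := fun x t ht =>
    hasDerivWithinAt_mollify hsol.continuousOn hsol.continuousOn_timeDeriv hsol.hasTimeDeriv hρc
      hz1 ht x
  have dD : ∀ x, ∀ t ∈ I, HasDerivWithinAt (fun t => mollify (φ t) (gradient ρ) x)
      (mollify (φt t) (gradient ρ) x) I t := fun x t ht =>
    hasDerivWithinAt_mollify hsol.continuousOn hsol.continuousOn_timeDeriv hsol.hasTimeDeriv
      hgs.continuous hgz1 ht x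
  have sΦ : ∀ t ∈ I, ∀ k : ℕ∞, ContDiff ℝ k (mollify (φ t) ρ) := fun t ht k =>
    contDiff_mollify (hli t ht) (hρs.of_le (by exact_mod_cast le_top)) hcs
  have sΦt : ∀ t ∈ I, ∀ k : ℕ∞, ContDiff ℝ k (mollify (φt t) ρ) := fun t ht k =>
    contDiff_mollify (hlit t ht) (hρs.of_le (by exact_mod_cast le_top)) hcs
  have sD : ∀ t ∈ I, ContDiff ℝ 1 (mollify (φ t) (gradient ρ)) := fun t ht =>
    contDiff_mollify (k := 1) (hli t ht) (hgs.of_le (by simp)) hgcs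
  have fH : ∀ t ∈ I, ∀ x, fderiv ℝ (fun x => t ^ (μ / 2) • mollify (φ t) (gradient ρ) x) x
      = t ^ (μ / 2) • mollify (φ t) (fderiv ℝ (gradient ρ)) x := fun t ht x => by
    have h : HasFDerivAt (fun x => t ^ (μ / 2) • mollify (φ t) (gradient ρ) x)
        (t ^ (μ / 2) • mollify (φ t) (fderiv ℝ (gradient ρ)) x) x :=
      (hasFDerivAt_mollify (hli t ht) (hgs.of_le (by simp)) hgcs x).fun_const_smul (t ^ (μ / 2))
    exact h.fderiv
  have fΦ : ∀ t ∈ I, ∀ x v, fderiv ℝ (mollify (φ t) ρ) x v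
      = inner ℝ (mollify (φ t) (gradient ρ) x) v := fun t ht x v =>
    inner_mollify_gradient (hli t ht) hρs hcs x v
  have fΦt : ∀ t ∈ I, ∀ x v, fderiv ℝ (mollify (φt t) ρ) x v
      = inner ℝ (mollify (φt t) (gradient ρ) x) v := fun t ht x v =>
    inner_mollify_gradient (hlit t ht) hρs hcs x v
  have hI0 : t₀ ∈ I := ⟨le_rfl, hT.le⟩
  have z0 : ∀ x, mollify (φ t₀) ρ x = 0 := mollify_eq_zero hsol.initial ρ
  have zD : ∀ x, mollify (φ t₀) (gradient ρ) x = 0 := mollify_eq_zero hsol.initial _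
  have zt : ∀ x, mollify (φt t₀) ρ x = 0 := mollify_eq_zero hsol.initial_timeDeriv ρ
  have nhds_le : 𝓝[>] t₀ ≤ 𝓝[I] t₀ := by
    rw [← nhdsWithin_Ioc_eq_nhdsGT hT]
    exact nhdsWithin_mono _ hJI
  have lim : ∀ {E : Type} [TopologicalSpace E] {h : ℝ × Space n → E},
      ContinuousOn h (I ×ˢ univ) → ∀ x, Tendsto (fun t => h (t, x)) (𝓝[>] t₀) (𝓝 (h (t₀, x))) :=
    fun hh x => ((slice hh x) t₀ hI0).tendsto.mono_left nhds_le
  have limc : Tendsto (fun t : ℝ => t ^ (μ / 2)) (𝓝[>] t₀) (𝓝 (t₀ ^ (μ / 2))) :=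
    (cc.tendsto t₀).mono_left nhdsWithin_le_nhds
  -- Because the data vanish, the difference quotient at `t₀` tends to `0`; it dominates `φ / t`
  -- since `t ≥ t - t₀`. For `t₀ = 0` this uses the vanishing initial velocity.
  have limq : ∀ x, Tendsto (fun t => mollify (φ t) ρ x / t) (𝓝[>] t₀) (𝓝 0) := by
    intro x
    have h1 := hasDerivWithinAt_iff_tendsto_slope.1 (dΦ x t₀ hI0)
    rw [zt] at h1
    have h2 : 𝓝[>] t₀ ≤ 𝓝[I \ {t₀}] t₀ := by
      rw [← nhdsWithin_Ioc_eq_nhdsGT hT]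
      exact nhdsWithin_mono _ fun t ht => ⟨hJI ht, ht.1.ne'⟩
    have h3 := (h1.mono_left h2).norm
    rw [norm_zero] at h3
    refine squeeze_zero_norm' ?_ h3
    filter_upwards [self_mem_nhdsWithin] with t ht
    rw [slope_def_field, z0, sub_zero, norm_div, norm_div]
    have h4 : 0 < t - t₀ := sub_pos.2 ht
    refine div_le_div_of_nonneg_left (norm_nonneg _) (by simpa using h4.ne') ?_
    rw [Real.norm_of_nonneg h4.le, Real.norm_of_nonneg (by linarith)]
    linarith
  -- Mean value inequality from the zero initial value, with `t - t₀ ≤ t`.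
  have mv : ∀ x K, (∀ t ∈ I, |mollify (φt t) ρ x| ≤ K) → ∀ t ∈ I, |mollify (φ t) ρ x| ≤ K * t := by
    intro x K hK t ht
    have hK0 : 0 ≤ K := (abs_nonneg _).trans (hK t ht)
    have := (convex_Icc t₀ T).norm_image_sub_le_of_norm_hasDerivWithin_le (dΦ x) hK hI0 ht
    rw [z0, sub_zero, Real.norm_eq_abs, Real.norm_of_nonneg (sub_nonneg.2 ht.1)] at this
    exact this.trans (mul_le_mul_of_nonneg_left (by linarith) hK0)
  refine
    { continuousOn_val := cc'.mul (cΦ.mono hsub)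
      continuousOn_vel := cc'.mul ((cΦt.mono hsub).add (cq.mul (cΦ.mono hsub)))
      continuousOn_grad := cc'.smul (cD.mono hsub)
      continuousOn_gradVel := cc'.smul ((cDt.mono hsub).add (cq.smul (cD.mono hsub)))
      continuousOn_hess := (cc'.smul (cH.mono hsub)).congr fun z hz => fH z.1 (hJI hz.1) z.2
      contDiff_val := fun t ht => contDiff_const.mul (sΦ t (hJI ht) 1)
      contDiff_vel := fun t ht =>
        contDiff_const.mul ((sΦt t (hJI ht) 1).add (contDiff_const.mul (sΦ t (hJI ht) 1)))
      contDiff_grad := fun t ht => (sD t (hJI ht)).const_smul _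
      fderiv_val := fun t ht x v => ?_
      fderiv_vel := fun t ht x v => ?_
      symm := fun t ht x v w => ?_
      deriv_val := fun x t ht => ?_
      deriv_grad := fun x t ht => ?_
      absolutelyContinuous := fun x s hs => ?_
      equation := fun x => ?_
      bound := fun R => ?_
      tendsto_val := fun x => ?_
      tendsto_vel := fun x => ?_
      tendsto_grad := fun x => ?_ }
  · have h1 := ((sΦ t (hJI ht) 1).differentiable one_ne_zero x).hasFDerivAt.const_mul (t ^ (μ / 2))
    rw [h1.fderiv, _root_.smul_apply, fΦ t (hJI ht), real_inner_smul_left, smul_eq_mul]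
  · have h1 := ((sΦ t (hJI ht) 1).differentiable one_ne_zero x).hasFDerivAt
    have h2 := ((sΦt t (hJI ht) 1).differentiable one_ne_zero x).hasFDerivAt
    have h3 := (h2.add (h1.const_mul (μ / (2 * t)))).const_mul (t ^ (μ / 2))
    have h4 := h3.fderiv
    simp only [Pi.add_apply] at h4
    rw [h4]
    simp only [_root_.smul_apply, _root_.add_apply, fΦ t (hJI ht), fΦt t (hJI ht),
      real_inner_smul_left, inner_add_left, smul_eq_mul]
  · rw [fH t (hJI ht), ← (hasFDerivAt_mollify (hli t (hJI ht)) (hgs.of_le (by simp)) hgcs x).fderiv]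
    simp only [_root_.smul_apply, real_inner_smul_left, real_inner_smul_right]
    rw [inner_fderiv_symm (sΦ t (hJI ht) 2) (sD t (hJI ht)) (fΦ t (hJI ht))]
  · refine ((hasDerivAt_rpow_half (μ := μ) (hpos t ht)).hasDerivWithinAt.mul
      ((dΦ x t (hJI ht)).mono hJI)).congr_deriv ?_
    ring
  · refine ((hasDerivAt_rpow_half (μ := μ) (hpos t ht)).hasDerivWithinAt.smul
      ((dD x t (hJI ht)).mono hJI)).congr_deriv ?_
    rw [smul_add, smul_smul]
  · have hsI : Icc s T ⊆ I := Icc_subset_Icc_left hs.1.le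
    have hp : ∀ t ∈ Icc s T, 0 < t := fun t ht => ht₀.trans_lt (hs.1.trans_le ht.1)
    have a1 := (absolutelyContinuous_mollify hsol hρ ht₀ hfF hf x hs).1
    have a2 : AbsolutelyContinuousOnInterval (fun t => mollify (φ t) ρ x) s T :=
      absolutelyContinuousOnInterval_of_hasDerivWithinAt hs.2.le
        (fun t ht => (dΦ x t (hsI ht)).mono hsI) ((slice cΦt x).mono hsI)
    have a3 : AbsolutelyContinuousOnInterval (fun t : ℝ => t ^ (μ / 2)) s T := by
      refine absolutelyContinuousOnInterval_of_hasDerivWithinAt hs.2.le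
        (fun t ht => (hasDerivAt_rpow_half (hp t ht)).hasDerivWithinAt) ?_
      exact cc.continuousOn.mul (continuousOn_const.div (continuousOn_const.mul continuousOn_id)
        fun t ht => (mul_pos two_pos (hp t ht)).ne')
    have a4 : AbsolutelyContinuousOnInterval (fun t : ℝ => μ / (2 * t)) s T := by
      refine ContDiffOn.absolutelyContinuousOnInterval ?_
      rw [uIcc_of_le hs.2.le]
      exact contDiffOn_const.div (contDiffOn_const.mul contDiffOn_id)
        fun t ht => (mul_pos two_pos (hp t ht)).ne'
    exact a3.mul (a1.add (a4.mul a2))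
  · refine ae_imp_mem_Ioo fun s hs => ?_
    filter_upwards [(absolutelyContinuous_mollify hsol hρ ht₀ hfF hf x hs).2] with t ht htm
    have ht0 : 0 < t := ht₀.trans_lt (hs.1.trans htm.1)
    have htI : t ∈ I := ⟨(hs.1.trans htm.1).le, htm.2.le⟩
    have h1 : HasDerivAt (fun t => mollify (φ t) ρ x) (mollify (φt t) ρ x) t :=
      (dΦ x t htI).hasDerivAt (Icc_mem_nhds (hs.1.trans htm.1) htm.2)
    have h2 : HasDerivAt (fun t : ℝ => μ / (2 * t)) (-(μ / (2 * t ^ 2))) t := by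
      refine ((hasDerivAt_const t μ).div ((hasDerivAt_id t).const_mul 2)
        (by positivity)).congr_deriv ?_
      simp only [id]
      field_simp
      ring
    -- Differentiating the rescaled velocity cancels the damping term; the remaining multiples of `φ
    -- / t²` add up to `-μ (2 - μ) / 4`.
    refine ((hasDerivAt_rpow_half (μ := μ) ht0).mul
      ((ht htm).add (h2.mul h1))).congr_deriv ?_
    rw [fH t htI]
    have h3 : tr (t ^ (μ / 2) • mollify (φ t) (fderiv ℝ (gradient ρ)) x)
        = t ^ (μ / 2) * tr (mollify (φ t) (fderiv ℝ (gradient ρ)) x) := by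
      simp [tr, Finset.mul_sum]
    rw [h3]
    simp only [Pi.add_apply, Pi.mul_apply]
    field_simp
    ring
  · have hcpt : IsCompact (I ×ˢ Metric.closedBall (0 : Space n) R) :=
      isCompact_Icc.prod (isCompact_closedBall _ _)
    have hs' : I ×ˢ Metric.closedBall (0 : Space n) R ⊆ I ×ˢ univ :=
      prod_mono le_rfl (subset_univ _)
    obtain ⟨K₁, hK₁⟩ := hcpt.exists_bound_of_continuousOn (cΦt.mono hs')
    obtain ⟨K₂, hK₂⟩ := hcpt.exists_bound_of_continuousOn (cD.mono hs')
    -- `K₁` bounds the mollified velocity, hence also the mollified `φ` divided by `t`; the summand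
    -- `μ / 2` accounts for the correction term in the rescaled velocity, and `K₂` bounds the
    -- gradient.
    refine ⟨T ^ (μ / 2) * ((1 + μ / 2) * |K₁| + |K₂|), fun t ht x hx => ?_⟩
    have ht0 := hpos t ht
    have hx' : x ∈ Metric.closedBall (0 : Space n) R := by simpa using hx
    have e1 : ∀ t ∈ I, |mollify (φt t) ρ x| ≤ |K₁| := fun t ht =>
      (hK₁ (t, x) ⟨ht, hx'⟩).trans (le_abs_self _)
    have e2 := mv x _ e1 t (hJI ht)
    have e3 : ‖mollify (φ t) (gradient ρ) x‖ ≤ |K₂| :=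
      (hK₂ (t, x) ⟨hJI ht, hx'⟩).trans (le_abs_self _)
    have hc0 : 0 ≤ t ^ (μ / 2) := Real.rpow_nonneg ht0.le _
    have hcT : t ^ (μ / 2) ≤ T ^ (μ / 2) :=
      Real.rpow_le_rpow ht0.le ht.2 (by positivity)
    have hk1 := abs_nonneg K₁
    have hk2 := abs_nonneg K₂
    have hm := mul_nonneg hμ.le hk1
    refine ⟨?_, ?_, ?_⟩
    · rw [abs_mul, abs_of_nonneg hc0, mul_assoc]
      refine mul_le_mul hcT (e2.trans (mul_le_mul_of_nonneg_right (by nlinarith) ht0.le))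
        (abs_nonneg _) (hc0.trans hcT)
    · rw [abs_mul, abs_of_nonneg hc0]
      refine mul_le_mul hcT ?_ (abs_nonneg _) (hc0.trans hcT)
      refine (abs_add_le _ _).trans ?_
      have : |μ / (2 * t) * mollify (φ t) ρ x| ≤ μ / 2 * |K₁| := by
        rw [abs_mul, abs_of_nonneg (by positivity)]
        refine (mul_le_mul_of_nonneg_left e2 (by positivity)).trans (le_of_eq ?_)
        field_simp
      nlinarith [e1 t (hJI ht)]
    · rw [norm_smul, Real.norm_of_nonneg hc0]
      exact mul_le_mul hcT (by nlinarith) (norm_nonneg _) (hc0.trans hcT)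
  · have := limc.mul (limq x)
    rw [mul_zero] at this
    exact this.congr fun t => by ring
  · have h1 := lim cΦt x
    simp only [zt] at h1
    have := limc.mul (h1.add ((limq x).const_mul (μ / 2)))
    simp only [mul_zero, add_zero] at this
    refine this.congr fun t => ?_
    rw [div_mul_div_comm, mul_div_right_comm]
  · have h1 := lim cD x
    simp only [zD] at h1
    have := limc.smul h1
    rwa [smul_zero] at this

end DampedWave

/-! ### The weighted source under mollification. -/

namespace DampedWave

variable {n : ℕ} {ρ : Space n → ℝ}

/-- Jensen's inequality for a mollification. -/
lemma enorm_mollify_sq_le (hρ : IsMollifier (1 / 2) ρ) {w : Space n → ℝ} (hw : Measurable w)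
    (x : Space n) :
    ‖mollify w ρ x‖ₑ ^ 2 ≤ ∫⁻ y, ENNReal.ofReal (ρ (x - y)) * ‖w y‖ₑ ^ 2 := by
  have hρm : Measurable fun y => ρ (x - y) :=
    (hρ.contDiff.continuous.comp (continuous_const.sub continuous_id)).measurable
  -- Splitting the kernel as `√ρ * √ρ` and applying the Cauchy–Schwarz inequality; one factor has
  -- norm one because `ρ` has integral one.
  set a : Space n → ℝ≥0∞ := fun y => ENNReal.ofReal (√(ρ (x - y)))
  have ha : Measurable a := hρm.sqrt.ennreal_ofReal
  have ha2 : ∀ y, a y * a y = ENNReal.ofReal (ρ (x - y)) := fun y => by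
    rw [← ENNReal.ofReal_mul (Real.sqrt_nonneg _), Real.mul_self_sqrt (hρ.nonneg _)]
  have hone : ∫⁻ y, a y ^ (2 : ℝ) = 1 := by
    have h1 : ∀ y, a y ^ (2 : ℝ) = ENNReal.ofReal (ρ (x - y)) := fun y => by
      rw [← ha2, ENNReal.rpow_two, sq]
    simp only [h1]
    rw [← ofReal_integral_eq_lintegral_ofReal
      ((hρ.contDiff.continuous.integrable_of_hasCompactSupport hρ.hasCompactSupport).comp_sub_left x)
      (Eventually.of_forall fun y => hρ.nonneg _), integral_sub_left_eq_self, hρ.integral_eq,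
      ENNReal.ofReal_one]
  have h2 : ‖mollify w ρ x‖ₑ ≤ ∫⁻ y, ((fun y => a y * ‖w y‖ₑ) * a) y := by
    refine (enorm_integral_le_lintegral_enorm _).trans (le_of_eq (lintegral_congr fun y => ?_))
    rw [enorm_smul, Pi.mul_apply, mul_right_comm, ha2, mul_comm, Real.enorm_eq_ofReal (hρ.nonneg _)]
  have h3 := h2.trans (ENNReal.lintegral_mul_le_Lp_mul_Lq volume
    (Real.HolderConjugate.two_two) (ha.mul hw.enorm).aemeasurable ha.aemeasurable)
  rw [hone, ENNReal.one_rpow, mul_one] at h3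
  calc _ ≤ ((∫⁻ y, (a y * ‖w y‖ₑ) ^ (2 : ℝ)) ^ (1 / 2 : ℝ)) ^ 2 := by gcongr
    _ = ∫⁻ y, (a y * ‖w y‖ₑ) ^ (2 : ℝ) := by
        rw [← ENNReal.rpow_natCast, ← ENNReal.rpow_mul]
        norm_num
    _ = _ := by
        refine lintegral_congr fun y => ?_
        rw [ENNReal.rpow_two, mul_pow, sq (a y), ha2]

/-- Mollification is bounded on `L²` with slowly varying weights. -/
lemma lintegral_weight_mollify_sq_le (hρ : IsMollifier (1 / 2) ρ) {w : Space n → ℝ}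
    (hw : Measurable w) {κ : Space n → ℝ≥0∞} (hκ : Measurable κ) {K : ℝ≥0∞}
    (h : ∀ x y, ‖x - y‖ ≤ 1 → κ x ≤ K * κ y) :
    ∫⁻ x, κ x * ‖mollify w ρ x‖ₑ ^ 2 ≤ K * ∫⁻ y, κ y * ‖w y‖ₑ ^ 2 := by
  have hρm : Measurable fun z : Space n × Space n => ρ (z.1 - z.2) :=
    (hρ.contDiff.continuous.comp (continuous_fst.sub continuous_snd)).measurable
  have hm : Measurable fun y => κ y * ‖w y‖ₑ ^ 2 := hκ.mul (hw.enorm.pow_const 2)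
  calc _ ≤ ∫⁻ x, ∫⁻ y, ENNReal.ofReal (ρ (x - y)) * (K * (κ y * ‖w y‖ₑ ^ 2)) := by
        refine lintegral_mono fun x => ?_
        refine (mul_le_mul_right (enorm_mollify_sq_le hρ hw x) _).trans ?_
        have hm' : Measurable fun y => ENNReal.ofReal (ρ (x - y)) * ‖w y‖ₑ ^ 2 :=
          (hρm.comp measurable_prodMk_left).ennreal_ofReal.mul (hw.enorm.pow_const 2)
        rw [← lintegral_const_mul _ hm']
        refine lintegral_mono fun y => ?_
        -- The comparison of weights is needed only where the kernel does not vanish.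
        by_cases hxy : ‖x - y‖ ≤ 1
        · calc _ = κ x * (ENNReal.ofReal (ρ (x - y)) * ‖w y‖ₑ ^ 2) := rfl
            _ ≤ K * κ y * (ENNReal.ofReal (ρ (x - y)) * ‖w y‖ₑ ^ 2) := by
                gcongr
                exact h x y hxy
            _ = _ := by ring
        · simp [hρ.eq_zero (x - y) (by linarith [not_le.1 hxy])]
    _ = ∫⁻ y, ∫⁻ x, ENNReal.ofReal (ρ (x - y)) * (K * (κ y * ‖w y‖ₑ ^ 2)) :=
        lintegral_lintegral_swap (by
          exact (hρm.ennreal_ofReal.mul (measurable_const.mul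
            (hm.comp measurable_snd))).aemeasurable)
    _ = ∫⁻ y, K * (κ y * ‖w y‖ₑ ^ 2) := by
        refine lintegral_congr fun y => ?_
        have h1 : Measurable fun x => ENNReal.ofReal (ρ (x - y)) :=
          (hρ.contDiff.continuous.comp (continuous_id.sub continuous_const)).measurable.ennreal_ofReal
        rw [lintegral_mul_const _ h1, ← ofReal_integral_eq_lintegral_ofReal
          ((hρ.contDiff.continuous.integrable_of_hasCompactSupport
            hρ.hasCompactSupport).comp_sub_right y)
          (Eventually.of_forall fun x => hρ.nonneg _), integral_sub_right_eq_self, hρ.integral_eq,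
          ENNReal.ofReal_one, one_mul]
    _ = _ := lintegral_const_mul _ hm

/-- The weight of the source. -/
noncomputable def sourceWeight (γ t : ℝ) (x : Space n) : ℝ :=
  (1 + |t - ‖x‖|) ^ γ * (1 + |t + ‖x‖|) ^ γ

lemma sourceWeight_nonneg (γ t : ℝ) (x : Space n) : 0 ≤ sourceWeight γ t x := by
  unfold sourceWeight; positivity

lemma continuous_sourceWeight {γ : ℝ} :
    Continuous fun z : ℝ × Space n => sourceWeight γ z.1 z.2 := by
  unfold sourceWeight
  refine Continuous.mul ?_ ?_ <;>
  · refine Continuous.rpow_const (by fun_prop) fun z => Or.inl ?_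
    positivity

lemma one_le_sourceWeight {γ : ℝ} (hγ : 0 ≤ γ) (t : ℝ) (x : Space n) :
    1 ≤ sourceWeight γ t x := by
  unfold sourceWeight
  exact one_le_mul_of_one_le_of_one_le (Real.one_le_rpow (by simp) hγ)
    (Real.one_le_rpow (by simp) hγ)

/-- Moving `x` by at most `1` changes `‖x‖` by at most `1`, so each factor `1 + |t ± ‖x‖|` at most
doubles. -/
lemma sourceWeight_le {γ : ℝ} (hγ : 0 ≤ γ) (t : ℝ) {x y : Space n} (h : ‖x - y‖ ≤ 1) :
    sourceWeight γ t x ≤ 2 ^ γ * 2 ^ γ * sourceWeight γ t y := by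
  have h1 := (abs_norm_sub_norm_le x y).trans h
  have ha : (1 + |t - ‖x‖|) ^ γ ≤ 2 ^ γ * (1 + |t - ‖y‖|) ^ γ := by
    rw [← Real.mul_rpow (by norm_num) (by positivity)]
    refine Real.rpow_le_rpow (by positivity) ?_ hγ
    have := abs_sub_abs_le_abs_sub (t - ‖x‖) (t - ‖y‖)
    rw [show t - ‖x‖ - (t - ‖y‖) = -(‖x‖ - ‖y‖) by ring, abs_neg] at this
    linarith [abs_nonneg (t - ‖y‖)]
  have hb : (1 + |t + ‖x‖|) ^ γ ≤ 2 ^ γ * (1 + |t + ‖y‖|) ^ γ := by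
    rw [← Real.mul_rpow (by norm_num) (by positivity)]
    refine Real.rpow_le_rpow (by positivity) ?_ hγ
    have := abs_sub_abs_le_abs_sub (t + ‖x‖) (t + ‖y‖)
    rw [show t + ‖x‖ - (t + ‖y‖) = ‖x‖ - ‖y‖ by ring] at this
    linarith [abs_nonneg (t + ‖y‖)]
  unfold sourceWeight
  calc _ ≤ (2 ^ γ * (1 + |t - ‖y‖|) ^ γ) * (2 ^ γ * (1 + |t + ‖y‖|) ^ γ) := by gcongr
    _ = _ := by ring

/-- Since `γ ≥ 1`, both `⟨s⟩` and `⟨s⟩ ^ γ` are at most `(1 + |s|) ^ γ`. The two summands thus have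
the same bound, which turns `M ^ 2 / 8` into `M ^ 2 / 4`. -/
lemma sourceDensity_le {γ : ℝ} (hγ : 1 ≤ γ) (M : ℝ) (G : ℝ → Space n → ℝ) (t : ℝ) (x : Space n) :
    sourceDensity γ M G t x ≤ M ^ 2 / 4 * (sourceWeight γ t x * G t x ^ 2) := by
  have hle : ∀ s, bracket s ≤ (1 + |s|) ^ γ := fun s =>
    (bracket_le s).trans (Real.self_le_rpow_of_one_le (by simp) hγ)
  have hle' : ∀ s, bracket s ^ γ ≤ (1 + |s|) ^ γ := fun s =>
    Real.rpow_le_rpow (bracket_pos s).le (bracket_le s) (by linarith)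
  have h0 : ∀ s, 0 ≤ bracket s ^ γ := fun s => Real.rpow_nonneg (bracket_pos s).le _
  have h1 : ∀ s : ℝ, 0 ≤ (1 + |s|) ^ γ := fun s => by positivity
  unfold sourceDensity sourceWeight
  have hsum : bracket (t - ‖x‖) * bracket (t + ‖x‖) ^ γ
      + bracket (t + ‖x‖) * bracket (t - ‖x‖) ^ γ
      ≤ 2 * ((1 + |t - ‖x‖|) ^ γ * (1 + |t + ‖x‖|) ^ γ) := by
    have a := mul_le_mul (hle (t - ‖x‖)) (hle' (t + ‖x‖)) (h0 _) (h1 _)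
    have b := mul_le_mul (hle (t + ‖x‖)) (hle' (t - ‖x‖)) (h0 _) (h1 _)
    linarith [mul_comm ((1 + |t - ‖x‖|) ^ γ) ((1 + |t + ‖x‖|) ^ γ)]
  calc _ ≤ M ^ 2 / 8 * (2 * ((1 + |t - ‖x‖|) ^ γ * (1 + |t + ‖x‖|) ^ γ)) * G t x ^ 2 := by
        gcongr
    _ = _ := by ring

lemma stronglyMeasurable_mollify {f : ℝ → Space n → ℝ}
    (hf : StronglyMeasurable fun z : ℝ × Space n => f z.1 z.2) (hρ : Continuous ρ) :
    StronglyMeasurable fun z : ℝ × Space n => mollify (f z.1) ρ z.2 := by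
  refine StronglyMeasurable.integral_prod_right'
    (f := fun q : (ℝ × Space n) × Space n => f q.1.1 q.2 • ρ (q.1.2 - q.2)) ?_
  exact (hf.comp_measurable ((measurable_fst.comp measurable_fst).prodMk measurable_snd)).smul
    (hρ.comp ((continuous_snd.comp continuous_fst).sub continuous_snd)).stronglyMeasurable

/-- The source term of a mollified equation in terms of the original source. -/
lemma lintegral_sourceDensity_mollify_le (hρ : IsMollifier (1 / 2) ρ) {f : ℝ → Space n → ℝ}
    (hf : StronglyMeasurable fun z : ℝ × Space n => f z.1 z.2) {γ μ M t₀ T : ℝ} (hγ : 1 ≤ γ)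
    (ht₀ : 0 ≤ t₀) :
    ∫⁻ z, ENNReal.ofReal (sourceDensity γ M
        (fun t x => t ^ (μ / 2) * mollify (f t) ρ x) z.1 z.2)
        ∂((volume.restrict (Ioc t₀ T)).prod (volume : Measure (Space n)))
      ≤ ENNReal.ofReal (M ^ 2 / 4 * (2 ^ γ * 2 ^ γ)) *
        ∫⁻ z, ENNReal.ofReal (z.1 ^ μ * sourceWeight γ z.1 z.2) * ‖f z.1 z.2‖ₑ ^ 2
          ∂((volume.restrict (Ioc t₀ T)).prod (volume : Measure (Space n))) := by
  have hγ0 : 0 ≤ γ := by linarith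
  have hmm := stronglyMeasurable_mollify hf hρ.contDiff.continuous
  have hsw := (continuous_sourceWeight (n := n) (γ := γ)).measurable
  have hpw : Measurable fun z : ℝ × Space n => ENNReal.ofReal (z.1 ^ μ * sourceWeight γ z.1 z.2) :=
    ((measurable_fst.pow_const μ).mul hsw).ennreal_ofReal
  set K : ℝ≥0∞ := ENNReal.ofReal (2 ^ γ * 2 ^ γ)
  calc _ ≤ ∫⁻ z, ENNReal.ofReal (M ^ 2 / 4) *
          (ENNReal.ofReal (z.1 ^ μ * sourceWeight γ z.1 z.2) * ‖mollify (f z.1) ρ z.2‖ₑ ^ 2)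
          ∂((volume.restrict (Ioc t₀ T)).prod (volume : Measure (Space n))) := by
        refine lintegral_mono_ae ?_
        have hpos : ∀ᵐ z ∂((volume.restrict (Ioc t₀ T)).prod (volume : Measure (Space n))),
            0 < z.1 := by
          have := (ae_restrict_mem (μ := volume) (measurableSet_Ioc (a := t₀) (b := T)))
          filter_upwards [Measure.quasiMeasurePreserving_fst.ae this] with z hz
          exact ht₀.trans_lt hz.1
        filter_upwards [hpos] with z hz
        rw [← ofReal_norm, Real.norm_eq_abs, ← ENNReal.ofReal_pow (abs_nonneg _), sq_abs,
          ← ENNReal.ofReal_mul (mul_nonneg (Real.rpow_nonneg hz.le _) (sourceWeight_nonneg _ _ _)),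
          ← ENNReal.ofReal_mul (by positivity)]
        refine ENNReal.ofReal_le_ofReal ((sourceDensity_le hγ M _ z.1 z.2).trans (le_of_eq ?_))
        rw [mul_pow, ← Real.rpow_natCast (z.1 ^ (μ / 2)), ← Real.rpow_mul hz.le,
          show μ / 2 * ((2 : ℕ) : ℝ) = μ by push_cast; ring]
        ring
    _ = ENNReal.ofReal (M ^ 2 / 4) * ∫⁻ z, (ENNReal.ofReal (z.1 ^ μ * sourceWeight γ z.1 z.2)
          * ‖mollify (f z.1) ρ z.2‖ₑ ^ 2)
          ∂((volume.restrict (Ioc t₀ T)).prod (volume : Measure (Space n))) :=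
        lintegral_const_mul _ (hpw.mul (hmm.measurable.enorm.pow_const 2))
    _ = ENNReal.ofReal (M ^ 2 / 4) * ∫⁻ t in Ioc t₀ T, ∫⁻ x,
          (ENNReal.ofReal (t ^ μ * sourceWeight γ t x) * ‖mollify (f t) ρ x‖ₑ ^ 2) := by
        have hm : Measurable fun z : ℝ × Space n =>
            ENNReal.ofReal (z.1 ^ μ * sourceWeight γ z.1 z.2) * ‖mollify (f z.1) ρ z.2‖ₑ ^ 2 :=
          hpw.mul (hmm.measurable.enorm.pow_const 2)
        rw [lintegral_prod _ hm.aemeasurable]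
    _ ≤ ENNReal.ofReal (M ^ 2 / 4) * ∫⁻ t in Ioc t₀ T, K * ∫⁻ x,
          (ENNReal.ofReal (t ^ μ * sourceWeight γ t x) * ‖f t x‖ₑ ^ 2) := by
        refine mul_le_mul_right (setLIntegral_mono' measurableSet_Ioc fun t ht => ?_) _
        refine lintegral_weight_mollify_sq_le hρ (hf.measurable.comp measurable_prodMk_left)
          (hpw.comp measurable_prodMk_left) fun x y hxy => ?_
        simp only [Function.comp_apply, K]
        rw [← ENNReal.ofReal_mul (by positivity)]
        refine ENNReal.ofReal_le_ofReal ?_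
        have h1 := mul_le_mul_of_nonneg_left (sourceWeight_le hγ0 t hxy)
          (Real.rpow_nonneg (ht₀.trans_lt ht.1).le μ)
        linarith
    _ = _ := by
        have hm : Measurable fun z : ℝ × Space n =>
            ENNReal.ofReal (z.1 ^ μ * sourceWeight γ z.1 z.2) * ‖f z.1 z.2‖ₑ ^ 2 :=
          hpw.mul (hf.measurable.enorm.pow_const 2)
        rw [lintegral_const_mul _ hm.lintegral_prod_right', ← mul_assoc,
          ← ENNReal.ofReal_mul (by positivity), lintegral_prod _ hm.aemeasurable]

end DampedWave

/-! ### Comparison of the energy with the norms of the solution. -/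

namespace DampedWave

variable {n : ℕ} {μ t₀ T : ℝ} {F φ φt f : ℝ → Space n → ℝ} {φx : ℝ → Space n → Space n}

/-- The weighted density of the energy norm of `(a, b, d)`, standing for a function, its time
derivative and its gradient. -/
noncomputable def normDensity (μ t : ℝ) (x : Space n) (a b : ℝ) (d : Space n) : ℝ :=
  (1 + |t - ‖x‖|) * t ^ μ * (b ^ 2 + ‖d‖ ^ 2 + (a / ‖x‖) ^ 2 + (a / t) ^ 2)

lemma continuous_normDensity (μ t : ℝ) (x : Space n) :
    Continuous fun z : ℝ × ℝ × Space n => normDensity μ t x z.1 z.2.1 z.2.2 := by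
  unfold normDensity
  fun_prop

/-- The constant comparing `normDensity` with `coerciveForm`. -/
noncomputable def normConst (m α : ℝ) : ℝ := 4 * (2 + 3 / α + (2 * m ^ 2 + 1) / (m * (m - 1)))

lemma normConst_pos {m α : ℝ} (hm : 1 < m) (hα : 0 < α) : 0 < normConst m α := by
  have : 0 < m - 1 := by linarith
  unfold normConst; positivity

/-- Here `A` is the radial derivative, `B = ψ / r`, `τ = ψ / t` and `N` is the squared gradient.
Control of `B` needs `m > 1` and control of `τ` needs `α > 0`. Then `A` is recovered from `A + m B`
at the cost `2 m² B²`, and the unscaled velocity from `p` at the cost `2 τ²`. Together with `B²` and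
`τ²` themselves this gives the coefficients `2 m² + 1` and `3`. -/
lemma sum_sq_le_coercive {m α : ℝ} (hm : 1 < m) (hα : 0 < α) (hμ₀ : 0 < μ) (hμ₂ : μ < 2)
    {p A B τ N : ℝ} (hA : A ^ 2 ≤ N) :
    (p - μ / 2 * τ) ^ 2 + N + B ^ 2 + τ ^ 2
      ≤ (2 + 3 / α + (2 * m ^ 2 + 1) / (m * (m - 1)))
        * (p ^ 2 + (A + m * B) ^ 2 + (N - A ^ 2) + m * (m - 1) * B ^ 2 + α * τ ^ 2) := by
  have hmm : 0 < m * (m - 1) := mul_pos (by linarith) (by linarith)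
  have hB := mul_nonneg hmm.le (sq_nonneg B)
  have hτ := mul_nonneg hα.le (sq_nonneg τ)
  have hD := sq_nonneg (A + m * B)
  set Q := p ^ 2 + (A + m * B) ^ 2 + (N - A ^ 2) + m * (m - 1) * B ^ 2 + α * τ ^ 2 with hQ
  have hQ1 : p ^ 2 + (A + m * B) ^ 2 + (N - A ^ 2) ≤ Q := by linarith
  have hQ2 : B ^ 2 ≤ Q / (m * (m - 1)) := by
    rw [le_div_iff₀ hmm, mul_comm]
    linarith [sq_nonneg p]
  have hQ3 : τ ^ 2 ≤ Q / α := by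
    rw [le_div_iff₀ hα, mul_comm]
    linarith [sq_nonneg p]
  have h1 : (p - μ / 2 * τ) ^ 2 ≤ 2 * p ^ 2 + 2 * τ ^ 2 := by
    have : (μ / 2) ^ 2 ≤ 1 := by nlinarith
    nlinarith [sq_nonneg (p + μ / 2 * τ), mul_le_mul_of_nonneg_right this (sq_nonneg τ)]
  have h2 : A ^ 2 ≤ 2 * (A + m * B) ^ 2 + 2 * m ^ 2 * B ^ 2 := by
    linarith [sq_nonneg (A + 2 * (m * B))]
  have h3 : (2 * m ^ 2 + 1) * B ^ 2 ≤ (2 * m ^ 2 + 1) * (Q / (m * (m - 1))) :=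
    mul_le_mul_of_nonneg_left hQ2 (by positivity)
  calc _ ≤ 2 * Q + 3 * (Q / α) + (2 * m ^ 2 + 1) * (Q / (m * (m - 1))) := by linarith
    _ = _ := by ring

/-- Undoing the substitution, `t ^ (μ / 2) ∂ₜφ = ∂ₜψ - (μ / 2) ψ / t`, and the other quantities
merely acquire the factor `t ^ (μ / 2)`. The `4` in `normConst` comes from `1 + |s| ≤ 2 ⟨s⟩`. -/
lemma normDensity_le {m α : ℝ} (hm : 1 < m) (hα : 0 < α) (hμ₀ : 0 < μ) (hμ₂ : μ < 2)
    {ψ P : ℝ → Space n → ℝ} {g : ℝ → Space n → Space n} {t : ℝ} (ht : 0 < t) {x : Space n}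
    {a b : ℝ} {d : Space n} (hψ : ψ t x = t ^ (μ / 2) * a)
    (hP : P t x = t ^ (μ / 2) * (b + μ / (2 * t) * a)) (hg : g t x = t ^ (μ / 2) • d) :
    normDensity μ t x a b d
      ≤ normConst m α * (bracket (t - ‖x‖) / 2 * coerciveForm m α ψ P g t x) := by
  have hc0 : 0 ≤ t ^ (μ / 2) := Real.rpow_nonneg ht.le _
  have hc2 : t ^ μ = (t ^ (μ / 2)) ^ 2 := by
    rw [← Real.rpow_natCast (t ^ (μ / 2)), ← Real.rpow_mul ht.le,
      show μ / 2 * ((2 : ℕ) : ℝ) = μ by push_cast; ring]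
  have e : t ^ μ * (b ^ 2 + ‖d‖ ^ 2 + (a / ‖x‖) ^ 2 + (a / t) ^ 2)
      = (P t x - μ / 2 * (ψ t x / t)) ^ 2 + ‖g t x‖ ^ 2 + (ψ t x / ‖x‖) ^ 2
        + (ψ t x / t) ^ 2 := by
    have h1 : P t x - μ / 2 * (ψ t x / t) = t ^ (μ / 2) * b := by
      rw [hψ, hP]; field_simp; ring
    rw [h1, hg, norm_smul, Real.norm_of_nonneg hc0, hψ, hc2]
    ring
  set A := inner ℝ x (g t x) / ‖x‖
  set B := ψ t x / ‖x‖
  set τ := ψ t x / t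
  set p := P t x
  have hQ : coerciveForm m α ψ P g t x
      = p ^ 2 + (A + m * B) ^ 2 + (‖g t x‖ ^ 2 - A ^ 2) + m * (m - 1) * B ^ 2 + α * τ ^ 2 := by
    simp only [coerciveForm, A, B, τ, p]
    rw [add_div, mul_div_assoc, div_pow (inner ℝ x (g t x))]
  have hA : A ^ 2 ≤ ‖g t x‖ ^ 2 := by
    rw [← sq_abs]
    refine pow_le_pow_left₀ (abs_nonneg _) ?_ 2
    rw [abs_div, abs_norm]
    refine div_le_of_le_mul₀ (norm_nonneg _) (norm_nonneg _) ?_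
    rw [mul_comm]
    exact abs_real_inner_le_norm _ _
  have hsum := sum_sq_le_coercive hm hα hμ₀ hμ₂ (p := p) (B := B) (τ := τ) hA
  rw [← hQ] at hsum
  have hb : 1 + |t - ‖x‖| ≤ 4 * (bracket (t - ‖x‖) / 2) := by linarith [le_bracket (t - ‖x‖)]
  unfold normDensity normConst
  rw [mul_assoc, e]
  calc _ ≤ 4 * (bracket (t - ‖x‖) / 2)
        * ((2 + 3 / α + (2 * m ^ 2 + 1) / (m * (m - 1)))
          * coerciveForm m α ψ P g t x) :=
        mul_le_mul hb hsum (by positivity) (by linarith [bracket_pos (t - ‖x‖)])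
    _ = _ := by ring

/-- The weighted energy norm of a mollified solution. -/
lemma lintegral_normDensity_mollify_le {ρ : Space n → ℝ} {γ M m : ℝ} {p : ℝ → ℝ}
    (hsol : IsDampedWaveSolution μ t₀ T F φ φt φx) (hρ : IsMollifier (1 / 2) ρ)
    (hp : ∀ s, HasDerivAt p (-(bracket s) ^ (-γ)) s) (hp1 : ∀ s, 1 ≤ p s) (hpM : ∀ s, p s ≤ M)
    (hn4 : 4 ≤ n) (hn : (n : ℝ) = 2 * m + 1) (hm : 1 < m) (hμ₀ : 0 < μ) (hμ₂ : μ < 2) (hγ : 1 ≤ γ)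
    (ht₀ : 0 ≤ t₀)
    (hfF : (fun z : ℝ × Space n => f z.1 z.2) =ᵐ[volume.restrict (Ioo t₀ T ×ˢ univ)]
      fun z => F z.1 z.2)
    (hf : ∀ s ∈ Ioo t₀ T, ∀ R,
      IntegrableOn (fun z : ℝ × Space n => f z.1 z.2) (Ioo s T ×ˢ Metric.ball 0 R))
    (hfm : StronglyMeasurable fun z : ℝ × Space n => f z.1 z.2)
    (hfin : ∫⁻ z, ENNReal.ofReal (z.1 ^ μ * sourceWeight γ z.1 z.2) * ‖f z.1 z.2‖ₑ ^ 2
      ∂((volume.restrict (Ioc t₀ T)).prod (volume : Measure (Space n))) ≠ ⊤)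
    {t : ℝ} (ht : t ∈ Ioc t₀ T) :
    ∫⁻ x, ENNReal.ofReal (normDensity μ t x (mollify (φ t) ρ x) (mollify (φt t) ρ x)
        (mollify (φ t) (gradient ρ) x))
      ≤ ENNReal.ofReal (normConst m (μ * (2 - μ) / 4) * (M ^ 2 / 4 * (2 ^ γ * 2 ^ γ))) *
        ∫⁻ z, ENNReal.ofReal (z.1 ^ μ * sourceWeight γ z.1 z.2) * ‖f z.1 z.2‖ₑ ^ 2
          ∂((volume.restrict (Ioc t₀ T)).prod (volume : Measure (Space n))) := by
  have hα : 0 < μ * (2 - μ) / 4 := by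
    have : 0 < 2 - μ := by linarith
    positivity
  have hK := normConst_pos hm hα
  have hw := regularWave_mollify hsol hρ hμ₀ ht₀ (ht.1.trans_le ht.2) hfF hf
  have hle := lintegral_sourceDensity_mollify_le (μ := μ) (M := M) (T := T) hρ hfm hγ ht₀
  have hmeas : AEStronglyMeasurable (fun z : ℝ × Space n => sourceDensity γ M
      (fun t x => t ^ (μ / 2) * mollify (f t) ρ x) z.1 z.2)
      ((volume.restrict (Ioc t₀ T)).prod (volume : Measure (Space n))) := by
    have hmm := (stronglyMeasurable_mollify hfm hρ.contDiff.continuous).measurable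
    have hb : Measurable bracket := (contDiff_bracket (k := 0)).continuous.measurable
    have h1 : Measurable fun z : ℝ × Space n => bracket (z.1 - ‖z.2‖) :=
      hb.comp (measurable_fst.sub measurable_snd.norm)
    have h2 : Measurable fun z : ℝ × Space n => bracket (z.1 + ‖z.2‖) :=
      hb.comp (measurable_fst.add measurable_snd.norm)
    have h3 : Measurable fun z : ℝ × Space n => z.1 ^ (μ / 2) * mollify (f z.1) ρ z.2 :=
      (measurable_fst.pow_const _).mul hmm
    exact ((((h1.mul (h2.pow_const γ)).add (h2.mul (h1.pow_const γ))).const_mul _).mul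
      (h3.pow_const 2)).aestronglyMeasurable
  -- Finiteness of the weighted norm of the original source passes to the mollified one; it is the
  -- only integrability the energy estimate asks of the source.
  have hG : Integrable (fun z : ℝ × Space n => sourceDensity γ M
      (fun t x => t ^ (μ / 2) * mollify (f t) ρ x) z.1 z.2)
      ((volume.restrict (Ioc t₀ T)).prod (volume : Measure (Space n))) := by
    refine ⟨hmeas, ?_⟩
    rw [hasFiniteIntegral_iff_ofReal (Eventually.of_forall fun z => sourceDensity_nonneg _ _ _ _ _)]
    exact hle.trans_lt (ENNReal.mul_lt_top ENNReal.ofReal_lt_top hfin.lt_top)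
  have hest := lintegral_coerciveForm_le (q := fun s => bracket s ^ (-γ)) hp (fun _ => rfl) hp1 hpM
    hw hn4 hn hm.le hα.le ht₀ ht hG
  rw [ofReal_integral_eq_lintegral_ofReal hG
    (Eventually.of_forall fun z => sourceDensity_nonneg _ _ _ _ _)] at hest
  have ht0 : 0 < t := ht₀.trans_lt ht.1
  calc _ ≤ ∫⁻ x, ENNReal.ofReal (normConst m (μ * (2 - μ) / 4)) * ENNReal.ofReal
          (bracket (t - ‖x‖) / 2 * coerciveForm m (μ * (2 - μ) / 4)
            (fun t x => t ^ (μ / 2) * mollify (φ t) ρ x)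
            (fun t x => t ^ (μ / 2) * (mollify (φt t) ρ x + μ / (2 * t) * mollify (φ t) ρ x))
            (fun t x => t ^ (μ / 2) • mollify (φ t) (gradient ρ) x) t x) := by
        refine lintegral_mono fun x => ?_
        rw [← ENNReal.ofReal_mul hK.le]
        exact ENNReal.ofReal_le_ofReal (normDensity_le hm hα hμ₀ hμ₂ ht0 rfl rfl rfl)
    _ ≤ _ := by
        rw [lintegral_const_mul' _ _ ENNReal.ofReal_ne_top, ENNReal.ofReal_mul hK.le, mul_assoc]
        exact mul_le_mul_right (hest.trans hle) _

/-- The weighted energy norm of a solution. -/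
lemma lintegral_normDensity_le {γ M m : ℝ} {p : ℝ → ℝ}
    (hsol : IsDampedWaveSolution μ t₀ T F φ φt φx)
    (hp : ∀ s, HasDerivAt p (-(bracket s) ^ (-γ)) s) (hp1 : ∀ s, 1 ≤ p s) (hpM : ∀ s, p s ≤ M)
    (hn4 : 4 ≤ n) (hn : (n : ℝ) = 2 * m + 1) (hm : 1 < m) (hμ₀ : 0 < μ) (hμ₂ : μ < 2) (hγ : 1 ≤ γ)
    (ht₀ : 0 ≤ t₀)
    (hfF : (fun z : ℝ × Space n => f z.1 z.2) =ᵐ[volume.restrict (Ioo t₀ T ×ˢ univ)]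
      fun z => F z.1 z.2)
    (hf : ∀ s ∈ Ioo t₀ T, ∀ R,
      IntegrableOn (fun z : ℝ × Space n => f z.1 z.2) (Ioo s T ×ˢ Metric.ball 0 R))
    (hfm : StronglyMeasurable fun z : ℝ × Space n => f z.1 z.2)
    (hfin : ∫⁻ z, ENNReal.ofReal (z.1 ^ μ * sourceWeight γ z.1 z.2) * ‖f z.1 z.2‖ₑ ^ 2
      ∂((volume.restrict (Ioc t₀ T)).prod (volume : Measure (Space n))) ≠ ⊤)
    {t : ℝ} (ht : t ∈ Ioc t₀ T) :
    ∫⁻ x, ENNReal.ofReal (normDensity μ t x (φ t x) (φt t x) (φx t x))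
      ≤ ENNReal.ofReal (normConst m (μ * (2 - μ) / 4) * (M ^ 2 / 4 * (2 ^ γ * 2 ^ γ))) *
        ∫⁻ z, ENNReal.ofReal (z.1 ^ μ * sourceWeight γ z.1 z.2) * ‖f z.1 z.2‖ₑ ^ 2
          ∂((volume.restrict (Ioc t₀ T)).prod (volume : Measure (Space n))) := by
  obtain ⟨ρ, hρ, hlim⟩ := exists_mollifier (n := n)
  have htI : t ∈ Icc t₀ T := Ioc_subset_Icc_self ht
  have hli := hsol.continuousOn.locallyIntegrable htI
  have hlit := hsol.continuousOn_timeDeriv.locallyIntegrable htI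
  have hmol : ∀ (w : Space n → ℝ) k x, ∫ y, ρ k (x - y) • w y = mollify w (ρ k) x :=
    fun w k x => integral_congr_ae (Eventually.of_forall fun y => mul_comm _ _)
  set E : ℕ → Space n → ℝ≥0∞ := fun k x => ENNReal.ofReal (normDensity μ t x
    (mollify (φ t) (ρ k) x) (mollify (φt t) (ρ k) x) (mollify (φ t) (gradient (ρ k)) x))
  have hE : ∀ k, Measurable (E k) := fun k => by
    have hc := (hρ k).hasCompactSupport
    have hgs := contDiff_gradient (hρ k).contDiff
    have h1 := (contDiff_mollify (k := 0) hli ((hρ k).contDiff.of_le (by simp)) hc).continuous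
    have h2 := (contDiff_mollify (k := 0) hlit ((hρ k).contDiff.of_le (by simp)) hc).continuous
    have h3 := (contDiff_mollify (k := 0) hli (hgs.of_le (by simp))
      (hasCompactSupport_gradient hc)).continuous
    have h1m := h1.measurable
    have h2m := h2.measurable
    have h3m := h3.norm.measurable
    refine Measurable.ennreal_ofReal ?_
    unfold normDensity
    fun_prop
  have hae : ∀ᵐ x, ENNReal.ofReal (normDensity μ t x (φ t x) (φt t x) (φx t x))
      = liminf (fun k => E k x) atTop := by
    filter_upwards [hlim (φ t) hli, hlim (φt t) hlit,
      hlim (φx t) (hsol.continuousOn_grad.locallyIntegrable htI)] with x h1 h2 h3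
    simp only [hmol] at h1 h2
    -- The kernel `gradient ρ` acting on `φ` is the mollifier acting on the weak gradient, so this
    -- limit is again an instance of almost everywhere convergence of mollifications.
    have h3' : Tendsto (fun k => mollify (φ t) (gradient (ρ k)) x) atTop (𝓝 (φx t x)) :=
      h3.congr fun k => integral_smul_weakGradient (hsol.hasWeakGradient t htI) (hρ k).contDiff
        (hρ k).hasCompactSupport x
    have h4 := ((continuous_normDensity μ t x).tendsto (φ t x, φt t x, φx t x)).comp
      (h1.prodMk_nhds (h2.prodMk_nhds h3'))
    exact ((ENNReal.continuous_ofReal.tendsto _).comp h4).liminf_eq.symm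
  rw [lintegral_congr_ae hae]
  refine (lintegral_liminf_le hE).trans ?_
  refine (liminf_le_liminf (Eventually.of_forall fun k => lintegral_normDensity_mollify_le hsol
    (hρ k) hp hp1 hpM hn4 hn hm hμ₀ hμ₂ hγ ht₀ hfF hf hfm hfin ht)).trans ?_
  rw [liminf_const]

end DampedWave

/-! ### From squared integrals to the norms of the statement. -/

namespace DampedWave

variable {n : ℕ}

lemma sq_eLpNorm_two {X : Type*} [MeasurableSpace X] {ν : Measure X} (g : X → ℝ) :
    eLpNorm g 2 ν ^ 2 = ∫⁻ x, ENNReal.ofReal (g x ^ 2) ∂ν := by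
  have h := eLpNorm_nnreal_pow_eq_lintegral (μ := ν) (f := g) (p := 2) two_ne_zero
  simp only [NNReal.coe_ofNat, ENNReal.rpow_two, ENNReal.coe_ofNat] at h
  rw [h]
  refine lintegral_congr fun x => ?_
  rw [← ofReal_norm, ← ENNReal.ofReal_pow (norm_nonneg _), Real.norm_eq_abs, sq_abs]

lemma sq_rpow_half {a : ℝ} (ha : 0 ≤ a) (b : ℝ) : (a ^ (b / 2)) ^ 2 = a ^ b := by
  rw [← Real.rpow_natCast (a ^ (b / 2)), ← Real.rpow_mul ha,
    show b / 2 * ((2 : ℕ) : ℝ) = b by push_cast; ring]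

lemma mul_eLpNorm_le {g : Space n → ℝ} {E : Space n → ℝ} {c K : ℝ} (hc : 0 ≤ c) (hK : 0 ≤ K)
    {N : ℝ≥0∞} (h : ∀ x, c ^ 2 * g x ^ 2 ≤ E x)
    (hE : ∫⁻ x, ENNReal.ofReal (E x) ≤ ENNReal.ofReal K * N ^ 2) :
    ENNReal.ofReal c * eLpNorm g 2 volume ≤ ENNReal.ofReal (√K) * N := by
  rw [← ENNReal.rpow_le_rpow_iff two_pos, ENNReal.rpow_two, ENNReal.rpow_two, mul_pow, mul_pow,
    sq_eLpNorm_two, ← ENNReal.ofReal_pow hc, ← ENNReal.ofReal_pow (Real.sqrt_nonneg _),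
    Real.sq_sqrt hK, ← lintegral_const_mul' _ _ ENNReal.ofReal_ne_top]
  refine le_trans (lintegral_mono fun x => ?_) hE
  rw [← ENNReal.ofReal_mul (sq_nonneg _)]
  exact ENNReal.ofReal_le_ofReal (h x)

lemma lintegral_source_le {γ μ t₀ T : ℝ} (ht₀ : 0 ≤ t₀) {f F : ℝ → Space n → ℝ}
    (hfF : (fun z : ℝ × Space n => f z.1 z.2) =ᵐ[volume.restrict (Ioo t₀ T ×ˢ univ)]
      fun z => F z.1 z.2) :
    ∫⁻ z, ENNReal.ofReal (z.1 ^ μ * sourceWeight γ z.1 z.2) * ‖f z.1 z.2‖ₑ ^ 2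
        ∂((volume.restrict (Ioc t₀ T)).prod (volume : Measure (Space n)))
      ≤ eLpNorm (fun z : ℝ × Space n => (1 + |z.1 - ‖z.2‖|) ^ (γ / 2)
          * (1 + |z.1 + ‖z.2‖|) ^ (γ / 2) * z.1 ^ (μ / 2) * F z.1 z.2) 2
          (volume.restrict (Icc t₀ T ×ˢ univ)) ^ 2 := by
  have h1 : (volume.restrict (Ioc t₀ T)).prod (volume : Measure (Space n))
      = volume.restrict (Ioo t₀ T ×ˢ univ) := by
    rw [← restrict_Ioo_eq_restrict_Ioc, ← Measure.restrict_univ (μ := (volume : Measure (Space n))),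
      Measure.prod_restrict, Measure.volume_eq_prod]
  rw [h1, sq_eLpNorm_two]
  refine le_trans (le_of_eq (lintegral_congr_ae ?_))
    (lintegral_mono' (Measure.restrict_mono (Set.prod_mono Ioo_subset_Icc_self le_rfl) le_rfl) le_rfl)
  filter_upwards [hfF, ae_restrict_mem (measurableSet_Ioo.prod MeasurableSet.univ)] with z hz hzm
  have hz0 : 0 < z.1 := ht₀.trans_lt hzm.1.1
  rw [hz, ← ofReal_norm, Real.norm_eq_abs, ← ENNReal.ofReal_pow (abs_nonneg _), sq_abs,
    ← ENNReal.ofReal_mul (mul_nonneg (Real.rpow_nonneg hz0.le _) (sourceWeight_nonneg _ _ _))]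
  congr 1
  rw [mul_pow, mul_pow, mul_pow, sq_rpow_half hz0.le, sq_rpow_half (by positivity),
    sq_rpow_half (by positivity), sourceWeight]
  ring

/-- For `t > s > 0` the weight is at least `s ^ μ`, so the source is square integrable on bounded
cylinders, hence integrable there, up to and including the final time. -/
lemma integrableOn_of_lintegral_ne_top {γ μ t₀ T : ℝ} (hγ : 0 ≤ γ) (hμ : 0 ≤ μ) (ht₀ : 0 ≤ t₀)
    {f : ℝ → Space n → ℝ} (hfm : StronglyMeasurable fun z : ℝ × Space n => f z.1 z.2)
    (hfin : ∫⁻ z, ENNReal.ofReal (z.1 ^ μ * sourceWeight γ z.1 z.2) * ‖f z.1 z.2‖ₑ ^ 2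
      ∂((volume.restrict (Ioc t₀ T)).prod (volume : Measure (Space n))) ≠ ⊤)
    {s : ℝ} (hs : s ∈ Ioo t₀ T) (R : ℝ) :
    IntegrableOn (fun z : ℝ × Space n => f z.1 z.2) (Ioo s T ×ˢ Metric.ball 0 R) := by
  have hs0 : 0 < s := ht₀.trans_lt hs.1
  have hfinite : IsFiniteMeasure (volume.restrict (Ioo s T ×ˢ Metric.ball (0 : Space n) R)) :=
    ⟨by
      rw [Measure.restrict_apply_univ, Measure.volume_eq_prod, Measure.prod_prod]
      exact ENNReal.mul_lt_top (by simp) measure_ball_lt_top⟩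
  have hle : volume.restrict (Ioo s T ×ˢ Metric.ball (0 : Space n) R)
      ≤ (volume.restrict (Ioc t₀ T)).prod (volume : Measure (Space n)) := by
    rw [Measure.volume_eq_prod, ← Measure.prod_restrict]
    exact Measure.prod_mono (Measure.restrict_mono
      ((Ioo_subset_Ioo_left hs.1.le).trans Ioo_subset_Ioc_self) le_rfl) Measure.restrict_le_self
  have hmem : MemLp (fun z : ℝ × Space n => f z.1 z.2) 2
      (volume.restrict (Ioo s T ×ˢ Metric.ball (0 : Space n) R)) := by
    refine ⟨hfm.aestronglyMeasurable, ?_⟩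
    rw [eLpNorm_lt_top_iff_lintegral_rpow_enorm_lt_top two_ne_zero ENNReal.ofNat_ne_top]
    simp only [ENNReal.toReal_ofNat, ENNReal.rpow_two]
    have h1 : ∫⁻ z in Ioo s T ×ˢ Metric.ball (0 : Space n) R, ‖f z.1 z.2‖ₑ ^ 2
        ≤ ∫⁻ z in Ioo s T ×ˢ Metric.ball (0 : Space n) R, ENNReal.ofReal (s ^ (-μ)) *
          (ENNReal.ofReal (z.1 ^ μ * sourceWeight γ z.1 z.2) * ‖f z.1 z.2‖ₑ ^ 2) := by
      refine setLIntegral_mono' (measurableSet_Ioo.prod measurableSet_ball) fun z hz => ?_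
      rw [← mul_assoc, ← ENNReal.ofReal_mul (by positivity)]
      refine le_mul_of_one_le_left zero_le ?_
      rw [ENNReal.one_le_ofReal]
      have h2 : s ^ μ ≤ z.1 ^ μ := Real.rpow_le_rpow hs0.le hz.1.1.le hμ
      have h3 : 0 < s ^ μ := by positivity
      rw [Real.rpow_neg hs0.le, inv_mul_eq_div, one_le_div h3]
      exact h2.trans (le_mul_of_one_le_right (h3.le.trans h2) (one_le_sourceWeight hγ _ _))
    refine h1.trans_lt ?_
    rw [lintegral_const_mul' _ _ ENNReal.ofReal_ne_top]
    exact ENNReal.mul_lt_top ENNReal.ofReal_lt_top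
      ((lintegral_mono' hle le_rfl).trans_lt hfin.lt_top)
  exact hmem.integrable one_le_two

end DampedWave

open DampedWave
theorem theorem1p1 (n : ℕ) (hn : 4 ≤ n) (μ γ : ℝ) (hμ₀ : 0 < μ) (hμ₂ : μ < 2) (hγ : 1 < γ) :
    ∃ C : ℝ, 0 < C ∧ ∀ t₀ T : ℝ, 0 ≤ t₀ → t₀ < T →
      ∀ (F φ φt : ℝ → EuclideanSpace ℝ (Fin n) → ℝ)
        (φx : ℝ → EuclideanSpace ℝ (Fin n) → EuclideanSpace ℝ (Fin n)),
        IsDampedWaveSolution μ t₀ T F φ φt φx →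
        (⨆ t ∈ Ioc t₀ T, ENNReal.ofReal (t ^ (μ / 2)) *
          (eLpNorm (fun x => (1 + |t - ‖x‖|) ^ (1 / 2 : ℝ)
              * √(φt t x ^ 2 + ‖φx t x‖ ^ 2)) 2 volume
            + eLpNorm (fun x => (1 + |t - ‖x‖|) ^ (1 / 2 : ℝ) * (φ t x / ‖x‖)) 2 volume
            + eLpNorm (fun x => (1 + |t - ‖x‖|) ^ (1 / 2 : ℝ) * (φ t x / t)) 2 volume))
        ≤ ENNReal.ofReal C *
          eLpNorm (fun z : ℝ × EuclideanSpace ℝ (Fin n) =>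
            (1 + |z.1 - ‖z.2‖|) ^ (γ / 2) * (1 + |z.1 + ‖z.2‖|) ^ (γ / 2)
              * z.1 ^ (μ / 2) * F z.1 z.2) 2 (volume.restrict (Icc t₀ T ×ˢ univ)) := by
  obtain ⟨M, p, hp1, hpM, hp⟩ := exists_ghost_weight hγ
  set m : ℝ := ((n : ℝ) - 1) / 2
  have hn' : (4 : ℝ) ≤ n := by exact_mod_cast hn
  have hm : 1 < m := by simp only [m]; linarith
  have hα : 0 < μ * (2 - μ) / 4 := by
    have : 0 < 2 - μ := by linarith
    positivity
  have hK := normConst_pos hm hα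
  have hM : 0 < M := zero_lt_one.trans_le ((hp1 0).trans (hpM 0))
  set K := normConst m (μ * (2 - μ) / 4) * (M ^ 2 / 4 * (2 ^ γ * 2 ^ γ))
  have hK0 : 0 < K := by positivity
  -- Each of the three norms is bounded separately by `√K` times the right-hand norm.
  refine ⟨3 * √K, by positivity, fun t₀ T ht₀ hT F φ φt φx hsol => ?_⟩
  set N := eLpNorm (fun z : ℝ × EuclideanSpace ℝ (Fin n) =>
    (1 + |z.1 - ‖z.2‖|) ^ (γ / 2) * (1 + |z.1 + ‖z.2‖|) ^ (γ / 2)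
      * z.1 ^ (μ / 2) * F z.1 z.2) 2 (volume.restrict (Icc t₀ T ×ˢ univ))
  -- An infinite right side makes the claim trivial, the constant being positive. Otherwise its
  -- finiteness provides the integrability of the source used below.
  by_cases hN : N = ⊤
  · rw [hN, ENNReal.mul_top (by simpa using hK0)]
    exact le_top
  have hFm := hsol.locallyIntegrableOn_source.aestronglyMeasurable
  -- A strongly measurable representative on the whole product makes every time slice measurable, as
  -- the mollification of the source requires.
  set f : ℝ → Space n → ℝ := fun t x => hFm.mk _ (t, x)
  have hfm : StronglyMeasurable fun z : ℝ × Space n => f z.1 z.2 := hFm.stronglyMeasurable_mk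
  have hfF : (fun z : ℝ × Space n => f z.1 z.2) =ᵐ[volume.restrict (Ioo t₀ T ×ˢ univ)]
      fun z => F z.1 z.2 := hFm.ae_eq_mk.symm
  have hS := lintegral_source_le (γ := γ) (μ := μ) ht₀ hfF
  have hfin := (hS.trans_lt (ENNReal.pow_lt_top (lt_top_iff_ne_top.2 hN))).ne
  refine iSup₂_le fun t ht => ?_
  have ht0 : 0 < t := ht₀.trans_lt ht.1
  have hE := (lintegral_normDensity_le hsol hp hp1 hpM hn (by simp only [m]; ring) hm hμ₀ hμ₂ hγ.le
    ht₀ hfF (fun s hs R => integrableOn_of_lintegral_ne_top (by linarith) hμ₀.le ht₀ hfm hfin hs R)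
    hfm hfin ht).trans (mul_le_mul_right hS _)
  have hc : 0 ≤ t ^ (μ / 2) := Real.rpow_nonneg ht0.le _
  have hsq : ∀ x : Space n, ∀ a, (t ^ (μ / 2)) ^ 2 * ((1 + |t - ‖x‖|) ^ (1 / 2 : ℝ) * a) ^ 2
      = (1 + |t - ‖x‖|) * t ^ μ * a ^ 2 := fun x a => by
    rw [mul_pow, sq_rpow_half ht0.le, sq_rpow_half (by positivity), Real.rpow_one]
    ring
  have hw : ∀ x : Space n, 0 ≤ (1 + |t - ‖x‖|) * t ^ μ := fun x => by positivity
  have key : ∀ a : Space n → ℝ,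
      (∀ x, a x ^ 2 ≤ φt t x ^ 2 + ‖φx t x‖ ^ 2 + (φ t x / ‖x‖) ^ 2 + (φ t x / t) ^ 2) →
      ENNReal.ofReal (t ^ (μ / 2)) * eLpNorm (fun x => (1 + |t - ‖x‖|) ^ (1 / 2 : ℝ) * a x) 2 volume
        ≤ ENNReal.ofReal (√K) * N := fun a ha =>
    mul_eLpNorm_le hc hK0.le (fun x => (hsq x _).le.trans (mul_le_mul_of_nonneg_left (ha x) (hw x)))
      hE
  have k1 := key (fun x => √(φt t x ^ 2 + ‖φx t x‖ ^ 2)) fun x => by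
    rw [Real.sq_sqrt (by positivity)]
    linarith [sq_nonneg (φ t x / ‖x‖), sq_nonneg (φ t x / t)]
  have k2 := key (fun x => φ t x / ‖x‖) fun x => by
    linarith [sq_nonneg (φt t x), sq_nonneg ‖φx t x‖, sq_nonneg (φ t x / t)]
  have k3 := key (fun x => φ t x / t) fun x => by
    linarith [sq_nonneg (φt t x), sq_nonneg ‖φx t x‖, sq_nonneg (φ t x / ‖x‖)]
  rw [mul_add, mul_add]
  refine (add_le_add (add_le_add k1 k2) k3).trans (le_of_eq ?_)
  rw [ENNReal.ofReal_mul (by norm_num), show ENNReal.ofReal 3 = 3 by simp]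
  ring
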